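/- Let $k\ge 2$, let $P$ be a probability measure on a measurable space $\mathcal X$ (for instance the Borel space of a separable topological space), $\mathcal H$ a separable real Hilbert space, $X_1,X_2,\dots$ i.i.d. with law $P$, and let $r:\mathcal X^k\to\mathcal H$ be symmetric and Bochner measurable with $\mathbb E\|r(X_1,\dots,X_k)\|^2<\infty$. No degeneracy of $r$ is assumed. Put $C=\int r\,dP^k$ and let $f^*\in\mathcal H$ be a fixed target with $f^*\ne C$. For a kernel $g$ of $m$ variables let $U_m^n[g]$ be the average of $g(X_{i_1},\dots,X_{i_m})$ over all $m$-tuples of pairwise distinct indices in $\{1,\dots,n\}$. Put $\hat C=U_k^n[r]$, $\hat C_\alpha=(1-\alpha)\hat C+\alpha f^*$, $\Delta=\mathbb E\|\hat C-C\|^2$, $\alpha_*=\Delta/(\Delta+\|C-f^*\|^2)$, $\kappa_k(x_1,\dots,x_k)=\|r(x_1,\dots,x_k)\|^2$, $\kappa_{2k}(x_1,\dots,x_{2k})=\langle r(x_1,\dots,x_k),r(x_{k+1},\dots,x_{2k})\rangle$, $$\hat\Delta_{\rm degen}=\binom nk^{-1}\bigl(U_k^n[\kappa_k]-U_{2k}^n[\kappa_{2k}]\bigr),\qquad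 \tilde\alpha_{\rm degen}=\frac{\hat\Delta_{\rm degen}}{\hat\Delta_{\rm degen}+\|\hat C-f^*\|^2}\quad(\text{with } 0/0=0).$$ Suppose there are positive constants $\sigma,\sigma_1,\sigma_2,\theta,\theta_1,\theta_2$ such that for all integers $p\ge2$ $$\mathbb E\|r(X_1,\dots,X_k)-C\|^p\le\tfrac{p!}2\sigma^2\theta^{p-2},\quad \mathbb E|\kappa_k-\mathbb E\kappa_k|^p\le\tfrac{p!}2\sigma_1^2\theta_1^{p-2},\quad \mathbb E|\kappa_{2k}-\mathbb E\kappa_{2k}|^p\le\tfrac{p!}2\sigma_2^2\theta_2^{p-2},$$ where $\kappa_k,\kappa_{2k}$ are evaluated at $(X_1,\dots,X_k)$ and $(X_1,\dots,X_{2k})$. Then, as $n\to\infty$ (with $n\ge 2k$): (i) $|\tilde\alpha_{\rm degen}-\alpha_*|=O_{\mathbb P}(n^{-1})$; (ii) $\bigl|\,\|\hat C_{\tilde\alpha_{\rm degen}}-C\|-\|\hat C_{\alpha_*}-C\|\,\bigr|=O_{\mathbb P}(n^{-1})$; (iii) $\hat C_{\tilde\alpha_{\rm degen}}$ is a $\sqrt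 n$-consistent estimator of $C$, i.e. $\|\hat C_{\tilde\alpha_{\rm degen}}-C\|=O_{\mathbb P}(n^{-1/2})$; (iv) for every $n\ge2k$ all the risks below are finite, the minimum of $\mathbb E\|\hat C_\alpha-C\|^2$ over deterministic $\alpha\in\mathbb R$ is attained, and $$\Bigl|\mathbb E\|\hat C_{\tilde\alpha_{\rm degen}}-C\|^2-\min_{\alpha\in\mathbb R}\mathbb E\|\hat C_\alpha-C\|^2\Bigr|\le K n^{-3/2}\qquad(n\ge2k)$$ for a constant $K$ that does not depend on $n$. Moreover, if $r-C$ is not $P$-completely degenerate, then $\min_{\alpha}\mathbb E\|\hat C_\alpha-C\|^2\le\mathbb E\|\hat C_{\tilde\alpha_{\rm degen}}-C\|^2$ for all sufficiently large $n$. Here $r-C$ is $P$-completely degenerate if $\mathbb E[r(x_1,\dots,x_i,X_{i+1},\dots,X_k)]=C$ for $P^i$-almost all $(x_1,\dots,x_i)$ and every $0\le i<k$, and $r$ is not $P^k$-almost everywhere constant. -/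

import Mathlib

open MeasureTheory ProbabilityTheory Filter

noncomputable section

namespace Shrinkage

section Kernels

variable {𝒳 : Type*} {E : Type*} [NormedAddCommGroup E] [NormedSpace ℝ E]

/-- A function of `k` variables is symmetric if it is invariant under all permutations of its
arguments. -/
def IsSymmetric {k : ℕ} (r : (Fin k → 𝒳) → E) : Prop :=
  ∀ (s : Equiv.Perm (Fin k)) (x : Fin k → 𝒳), r (x ∘ s) = r x

/-- The U-statistic `U_m^n(g)` of order `m` with kernel `g`, computed from the sample
`x = (x_1, …, x_n)`: the average of `g (x_{i_1}, …, x_{i_m})` over all `n! / (n - m)!` tuples of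
pairwise distinct indices.  For a symmetric `g` this is also the average over
`i_1 < ⋯ < i_m`. -/
def uStat (m n : ℕ) (g : (Fin m → 𝒳) → E) (x : Fin n → 𝒳) : E :=
  ((n.descFactorial m : ℝ))⁻¹ • ∑ i : Fin m ↪ Fin n, g (fun j => x (i j))

/-- The Bochner integral `C = ∫ r dP^k`. -/
def target [MeasurableSpace 𝒳] {k : ℕ} (P : Measure 𝒳) (r : (Fin k → 𝒳) → E) : E :=
  ∫ x, r x ∂(Measure.pi fun _ : Fin k => P)

/-- The canonical function of order `i`:
`r_i (x_1, …, x_i) = ∫ r (x_1, …, x_i, y_{i+1}, …, y_k) dP(y_{i+1}) ⋯ dP(y_k)`. -/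
def canonical [MeasurableSpace 𝒳] {k : ℕ} (P : Measure 𝒳) (r : (Fin k → 𝒳) → E) (i : ℕ)
    (x : Fin i → 𝒳) : E :=
  ∫ y : Fin (k - i) → 𝒳,
    r (fun j => if h : (j : ℕ) < i then x ⟨j, h⟩ else y ⟨(j : ℕ) - i, by omega⟩)
    ∂(Measure.pi fun _ : Fin (k - i) => P)

/-- `P`-complete degeneracy (up to null sets, since `r` matters only up to null sets): the
canonical functions of order `0, …, k - 1` vanish and `r` is not constant. -/
def IsCompletelyDegenerate [MeasurableSpace 𝒳] {k : ℕ} (P : Measure 𝒳)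
    (r : (Fin k → 𝒳) → E) : Prop :=
  (∀ i < k, ∀ᵐ x ∂(Measure.pi fun _ : Fin i => P), canonical P r i x = 0) ∧
    ¬ ∃ c : E, ∀ᵐ x ∂(Measure.pi fun _ : Fin k => P), r x = c

end Kernels

/-- The Bernstein-type moment condition `𝔼 ‖Z‖ ^ p ≤ (p! / 2) σ² θ ^ (p - 2)` for all integers
`p ≥ 2` (in particular all these moments are finite). -/
def BernsteinMoments {Ω E : Type*} [MeasurableSpace Ω] [NormedAddCommGroup E]
    (μ : Measure Ω) (Z : Ω → E) (σ θ : ℝ) : Prop :=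
  ∀ p : ℕ, 2 ≤ p → Integrable (fun ω => ‖Z ω‖ ^ p) μ ∧
    ∫ ω, ‖Z ω‖ ^ p ∂μ ≤ (p.factorial : ℝ) / 2 * σ ^ 2 * θ ^ (p - 2)

/-- `Y n = O_ℙ(a n)` as `n → ∞`. -/
def IsBigOP {Ω : Type*} [MeasurableSpace Ω] (μ : Measure Ω) (Y : ℕ → Ω → ℝ) (a : ℕ → ℝ) : Prop :=
  ∀ ε : ℝ, 0 < ε → ∃ M : ℝ, 0 < M ∧ ∃ N : ℕ, ∀ n ≥ N,
    μ {ω | M * a n < |Y n ω|} ≤ ENNReal.ofReal ε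

section Estimators

variable {𝒳 H : Type*} [NormedAddCommGroup H] [InnerProductSpace ℝ H]

/-- `κ_k (x_1, …, x_k) = ⟨r (x_1, …, x_k), r (x_1, …, x_k)⟩`. -/
def kappaK {k : ℕ} (r : (Fin k → 𝒳) → H) (x : Fin k → 𝒳) : ℝ :=
  inner ℝ (r x) (r x)

/-- `κ_{2k} (x_1, …, x_{2k}) = ⟨r (x_1, …, x_k), r (x_{k+1}, …, x_{2k})⟩`. -/
def kappa2K {k : ℕ} (r : (Fin k → 𝒳) → H) (x : Fin (k + k) → 𝒳) : ℝ :=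
  inner ℝ (r fun j => x (Fin.castAdd k j)) (r fun j => x (Fin.natAdd k j))

/-- The estimator `Δ̂_degen` of the risk of the U-statistic. -/
def deltaDegen {k : ℕ} (r : (Fin k → 𝒳) → H) (n : ℕ) (x : Fin n → 𝒳) : ℝ :=
  ((n.choose k : ℝ))⁻¹ * (uStat k n (kappaK r) x - uStat (k + k) n (kappa2K r) x)

/-- The shrinkage coefficient `α̃_degen = Δ̂_degen / (Δ̂_degen + ‖Ĉ - f‖²)`. -/
def alphaDegen {k : ℕ} (r : (Fin k → 𝒳) → H) (f : H) (n : ℕ) (x : Fin n → 𝒳) : ℝ :=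
  deltaDegen r n x / (deltaDegen r n x + ‖uStat k n r x - f‖ ^ 2)

/-- The shrunken estimator `Ĉ_α = (1 - α) Ĉ + α f`. -/
def shrink {k : ℕ} (r : (Fin k → 𝒳) → H) (f : H) (n : ℕ) (α : ℝ) (x : Fin n → 𝒳) : H :=
  (1 - α) • uStat k n r x + α • f

variable [MeasurableSpace 𝒳] {Ω : Type*} [MeasurableSpace Ω]

/-- The first `n` observations `(X_1, …, X_n)`. -/
def sample (X : ℕ → Ω → 𝒳) (n : ℕ) (ω : Ω) : Fin n → 𝒳 := fun i => X i ω

/-- The risk `𝔼 ‖Ĉ_a - C‖²` of the shrunken estimator whose coefficient `a`, a function of the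
sample, may be random. -/
def risk {k : ℕ} (P : Measure 𝒳) (μ : Measure Ω) (X : ℕ → Ω → 𝒳) (r : (Fin k → 𝒳) → H) (f : H)
    (n : ℕ) (a : (Fin n → 𝒳) → ℝ) : ℝ :=
  ∫ ω, ‖shrink r f n (a (sample X n ω)) (sample X n ω) - target P r‖ ^ 2 ∂μ

/-- The risk `Δ = 𝔼 ‖Ĉ - C‖²` of the U-statistic itself. -/
def delta {k : ℕ} (P : Measure 𝒳) (μ : Measure Ω) (X : ℕ → Ω → 𝒳) (r : (Fin k → 𝒳) → H)
    (n : ℕ) : ℝ :=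
  ∫ ω, ‖uStat k n r (sample X n ω) - target P r‖ ^ 2 ∂μ

/-- The oracle coefficient `α_* = Δ / (Δ + ‖C - f‖²)`. -/
def alphaStar {k : ℕ} (P : Measure 𝒳) (μ : Measure Ω) (X : ℕ → Ω → 𝒳) (r : (Fin k → 𝒳) → H)
    (f : H) (n : ℕ) : ℝ :=
  delta P μ X r n / (delta P μ X r n + ‖target P r - f‖ ^ 2)

/-- The oracle risk `min_α 𝔼 ‖Ĉ_α - C‖²` over all deterministic `α ∈ ℝ`. -/
def oracleRisk {k : ℕ} (P : Measure 𝒳) (μ : Measure Ω) (X : ℕ → Ω → 𝒳) (r : (Fin k → 𝒳) → H)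
    (f : H) (n : ℕ) : ℝ :=
  ⨅ α : ℝ, risk P μ X r f n (fun _ => α)

end Estimators

end Shrinkage

end

open Shrinkage

/-! Write Z = Ĉ - C, d = f - C ≠ 0, T = U_k(κ_k) - U_{2k}(κ_{2k}) and β = 1 / binom(n, k). For n ≥
2k the estimated coefficient is a = βT / (βT + ‖Z - d‖²), and the shrunken estimator has error (1 -
a) Z + a d. Since |κ_{2k}| is at most half the sum of the two corresponding values of κ_k, T ≥ 0,
hence 0 ≤ a ≤ 1 (`abs_uStat_kappa2K_le`, `varStat_nonneg`).

The Bernstein condition on r - C makes all moments of r finite. Then E‖Z‖^{2m} = O(n^{-m}) by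
Hoeffding's block averaging and a moment bound for i.i.d. sums in Hilbert space
(`exists_integral_norm_uStat_pow_le`), and all moments of T are bounded in n
(`exists_integral_varStat_pow_le`).

For the rates, either ‖Z‖ ≤ ‖d‖/2 and a ≤ 4βT/‖d‖², with β = O(n^{-k}) and k ≥ 2, or ‖Z‖ is large,
an event controlled by the fourth moment of Z. Thus E[a(1 + ‖Z‖²)] = O(n^{-2})
(`exists_integral_randCoeff_le`). The oracle coefficient is O(n^{-1}), so (i), (ii) and (iii) follow
from Markov's inequality. Estimated shrinkage changes the risk Δ = E‖Z‖² by O(n^{-2}), and the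
oracle gains exactly Δ²/(Δ + ‖d‖²) = O(n^{-2}); this gives the two-sided bound in (iv), in fact with
rate n^{-2}.

For the lower bound, let c < k be the first order at which a canonical function of r - C does not
vanish. Mixed moments of U-statistics see canonical functions only at the number of shared indices,
so Δ is of exact order n^{-c} and the oracle gain is of exact order n^{-2c}. The risk change from
estimated shrinkage is at least 2β E[T⟨Z, d⟩]/‖d‖² minus remainders (`norm_sq_shrink_sub_ge`). T is
a difference of two U-statistics, so this covariance is O(n^{-c}) as well, and β = O(n^{-c-1}). With
T truncated at √n in the remainders, the risk decreases by at most O(n^{-2c-1/2}), which the oracle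
gain eventually exceeds (`eventually_nonneg_excess`). If no such c exists and r - C is not
completely degenerate, then r = C almost everywhere and the oracle risk is 0. -/

namespace Shrinkage

/-! ### Averages over tuples of distinct indices as averages over permutations. -/

section Averages

variable {E : Type*} [AddCommGroup E] [Module ℝ E]

/-- Averages over embeddings are averages over permutations. -/
lemma descFactorial_smul_sum_perm {k n : ℕ} (e : Fin k ↪ Fin n) (F : (Fin k ↪ Fin n) → E) :
    (n.descFactorial k : ℝ) • ∑ π : Equiv.Perm (Fin n), F (e.trans π.toEmbedding)
      = (n.factorial : ℝ) • ∑ j, F j := by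
  have hconst : ∀ j : Fin k ↪ Fin n,
      ∑ π : Equiv.Perm (Fin n), F (j.trans π.toEmbedding)
        = ∑ π : Equiv.Perm (Fin n), F (e.trans π.toEmbedding) := by
    -- Any two embeddings differ by a permutation ρ of `Fin n`, and π ↦ π ρ reindexes the sum.
    intro j
    obtain ⟨ρ, hρ⟩ := Equiv.Perm.exists_extending_pair e j e.injective j.injective
    refine Fintype.sum_equiv (Equiv.mulRight ρ) _ _ fun π => ?_
    congr 1
    ext a
    simp [hρ]
  have hsum : ∑ j : Fin k ↪ Fin n, ∑ π : Equiv.Perm (Fin n), F (j.trans π.toEmbedding)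
      = (n.factorial : ℝ) • ∑ j, F j := by
    rw [Finset.sum_comm]
    have : ∀ π : Equiv.Perm (Fin n), ∑ j : Fin k ↪ Fin n, F (j.trans π.toEmbedding)
        = ∑ j, F j := by
      intro π
      exact Fintype.sum_equiv (Equiv.embeddingCongr (Equiv.refl _) π) _ _ fun j => by
        congr 1
    simp_rw [this]
    rw [Finset.sum_const, Finset.card_univ, Fintype.card_perm, Fintype.card_fin, Nat.cast_smul_eq_nsmul]
  rw [← hsum]
  simp_rw [hconst]
  rw [Finset.sum_const, Finset.card_univ, Fintype.card_embedding_eq, Fintype.card_fin,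
    Fintype.card_fin, Nat.cast_smul_eq_nsmul]

lemma descFactorial_cast_ne_zero {m n : ℕ} (h : m ≤ n) : (n.descFactorial m : ℝ) ≠ 0 := by
  rw [Nat.cast_ne_zero]
  exact (Nat.pos_iff_ne_zero.mp (Nat.descFactorial_pos.2 h))

lemma avg_embedding_eq_avg_perm {k n : ℕ} (e : Fin k ↪ Fin n) (F : (Fin k ↪ Fin n) → E) :
    (n.descFactorial k : ℝ)⁻¹ • ∑ j, F j
      = (n.factorial : ℝ)⁻¹ • ∑ π : Equiv.Perm (Fin n), F (e.trans π.toEmbedding) := by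
  have hk : k ≤ n := by simpa using Fintype.card_le_of_embedding e
  have h1 := descFactorial_cast_ne_zero hk
  have h2 : (n.factorial : ℝ) ≠ 0 := by exact_mod_cast n.factorial_ne_zero
  rw [inv_smul_eq_iff₀ h1, smul_comm, eq_inv_smul_iff₀ h2, descFactorial_smul_sum_perm]

/-- The average over embeddings is compatible with restriction to some of the arguments. -/
lemma avg_embedding_trans {k m n : ℕ} (hm : m ≤ n) (w : Fin k ↪ Fin m)
    (F : (Fin k ↪ Fin n) → E) :
    (n.descFactorial m : ℝ)⁻¹ • ∑ i : Fin m ↪ Fin n, F (w.trans i)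
      = (n.descFactorial k : ℝ)⁻¹ • ∑ j, F j := by
  -- For any embedding e, both sides equal the average of F (π ∘ e ∘ w) over permutations π.
  have e : Fin m ↪ Fin n := Fin.castLEEmb hm
  rw [avg_embedding_eq_avg_perm e, avg_embedding_eq_avg_perm (w.trans e)]
  rfl

end Averages

/-! ### Pointwise facts on U-statistics, and counting tuples that share indices. -/

section Deterministic

variable {𝒳 H : Type*} [NormedAddCommGroup H] [InnerProductSpace ℝ H]

lemma uStat_const_sub {E : Type*} [NormedAddCommGroup E] [NormedSpace ℝ E] {k n : ℕ} (h : k ≤ n)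
    (r : (Fin k → 𝒳) → E) (c : E) (x : Fin n → 𝒳) :
    uStat k n (fun y => r y - c) x = uStat k n r x - c := by
  unfold uStat
  rw [Finset.sum_sub_distrib, smul_sub, Finset.sum_const, Finset.card_univ,
    Fintype.card_embedding_eq, Fintype.card_fin, Fintype.card_fin, ← Nat.cast_smul_eq_nsmul ℝ,
    smul_smul, inv_mul_cancel₀ (descFactorial_cast_ne_zero h), one_smul]

lemma uStat_nonneg {k n : ℕ} {g : (Fin k → 𝒳) → ℝ} (hg : ∀ y, 0 ≤ g y) (x : Fin n → 𝒳) :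
    0 ≤ uStat k n g x := by
  unfold uStat
  exact smul_nonneg (by positivity) (Finset.sum_nonneg fun _ _ => hg _)

lemma kappaK_nonneg {k : ℕ} (r : (Fin k → 𝒳) → H) (x : Fin k → 𝒳) : 0 ≤ kappaK r x :=
  real_inner_self_nonneg

/-- The cross term is dominated by the diagonal term. -/
lemma abs_uStat_kappa2K_le {k n : ℕ} (h : k + k ≤ n) (r : (Fin k → 𝒳) → H) (x : Fin n → 𝒳) :
    |uStat (k + k) n (kappa2K r) x| ≤ uStat k n (kappaK r) x := by
  have h1 : uStat k n (kappaK r) x = (n.descFactorial (k + k) : ℝ)⁻¹ •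
      ∑ i : Fin (k + k) ↪ Fin n, kappaK r (fun j => x (i (Fin.castAdd k j))) :=
    (avg_embedding_trans h (Fin.castAddEmb k) fun j => kappaK r fun a => x (j a)).symm
  have h2 : uStat k n (kappaK r) x = (n.descFactorial (k + k) : ℝ)⁻¹ •
      ∑ i : Fin (k + k) ↪ Fin n, kappaK r (fun j => x (i (Fin.natAdd k j))) :=
    (avg_embedding_trans h (Fin.natAddEmb k) fun j => kappaK r fun a => x (j a)).symm
  have h3 : uStat k n (kappaK r) x = (n.descFactorial (k + k) : ℝ)⁻¹ *
      ∑ i : Fin (k + k) ↪ Fin n, (kappaK r (fun j => x (i (Fin.castAdd k j)))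
        + kappaK r (fun j => x (i (Fin.natAdd k j)))) / 2 := by
    rw [smul_eq_mul] at h1 h2
    rw [← Finset.sum_div, Finset.sum_add_distrib]
    linear_combination (h1 + h2) / 2
  rw [h3]
  unfold uStat
  rw [smul_eq_mul, abs_mul, abs_of_nonneg (a := (n.descFactorial (k + k) : ℝ)⁻¹) (by positivity)]
  refine mul_le_mul_of_nonneg_left ((Finset.abs_sum_le_sum_abs _ _).trans
    (Finset.sum_le_sum fun i _ => ?_)) (by positivity)
  unfold kappa2K kappaK
  refine (abs_real_inner_le_norm _ _).trans ?_
  rw [real_inner_self_eq_norm_sq, real_inner_self_eq_norm_sq]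
  nlinarith [sq_nonneg (‖r fun j => x (i (Fin.castAdd k j))‖ - ‖r fun j => x (i (Fin.natAdd k j))‖)]

/-- Number of embeddings with prescribed values on some of the arguments. -/
lemma avg_indicator_le {c k n : ℕ} (hk : k ≤ n) (w : Fin c ↪ Fin k) (b : Fin c → Fin n) :
    (n.descFactorial k : ℝ)⁻¹ * ∑ j : Fin k ↪ Fin n, (if ∀ a, j (w a) = b a then 1 else 0 : ℝ)
      ≤ (n.descFactorial c : ℝ)⁻¹ := by
  have h := avg_embedding_trans hk w fun j => (if ∀ a, j a = b a then 1 else 0 : ℝ)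
  simp only [smul_eq_mul, Function.Embedding.trans_apply] at h
  rw [h]
  refine mul_le_of_le_one_right (by positivity) ?_
  rw [Finset.sum_ite, Finset.sum_const_zero, add_zero, Finset.sum_const, nsmul_eq_mul, mul_one]
  rw [← Nat.cast_one, Nat.cast_le, Finset.card_le_one]
  intro p hp q hq
  simp only [Finset.mem_filter, Finset.mem_univ, true_and] at hp hq
  ext a
  rw [hp, hq]

lemma avg_indicator_eq {c k n : ℕ} (hk : k ≤ n) (w : Fin c ↪ Fin k) (b : Fin c ↪ Fin n) :
    (n.descFactorial k : ℝ)⁻¹ * ∑ j : Fin k ↪ Fin n, (if ∀ a, j (w a) = b a then 1 else 0 : ℝ)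
      = (n.descFactorial c : ℝ)⁻¹ := by
  have h := avg_embedding_trans hk w fun j => (if ∀ a, j a = b a then 1 else 0 : ℝ)
  simp only [smul_eq_mul, Function.Embedding.trans_apply] at h
  rw [h]
  rw [Finset.sum_eq_single b]
  · simp
  · intro j _ hj
    rw [if_neg]
    contrapose! hj
    ext a
    rw [hj]
  · simp

/-- The number of arguments on which `j` takes a value of `i`. -/
def overlap {m k n : ℕ} (i : Fin m ↪ Fin n) (j : Fin k ↪ Fin n) : ℕ :=
  (Finset.univ.filter fun a => ∃ b, i b = j a).card

lemma exists_of_le_overlap {c m k n : ℕ} {i : Fin m ↪ Fin n} {j : Fin k ↪ Fin n}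
    (h : c ≤ overlap i j) :
    ∃ (w : Fin c ↪ Fin k) (v : Fin c → Fin m), ∀ a, j (w a) = i (v a) := by
  unfold overlap at h
  obtain ⟨s, hs, hc⟩ := Finset.exists_subset_card_eq h
  have hmem : ∀ a : Fin c, ∃ b, i b = j (s.orderEmbOfFin hc a) := fun a => by
    have := hs (s.orderEmbOfFin_mem hc a)
    simpa using this
  choose v hv using hmem
  exact ⟨(s.orderEmbOfFin hc).toEmbedding, v, fun a => (hv a).symm⟩

/-- Union bound over the choices of c arguments of j and of the arguments of i with which they
coincide. A random tuple shares at least c indices with a fixed one with probability O(n^{-c}). -/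
lemma avg_overlap_ge_le {c m k n : ℕ} (hk : k ≤ n) (i : Fin m ↪ Fin n) :
    (n.descFactorial k : ℝ)⁻¹ * ∑ j : Fin k ↪ Fin n, (if c ≤ overlap i j then 1 else 0 : ℝ)
      ≤ (k.descFactorial c * m ^ c : ℕ) * (n.descFactorial c : ℝ)⁻¹ := by
  calc (n.descFactorial k : ℝ)⁻¹ * ∑ j : Fin k ↪ Fin n, (if c ≤ overlap i j then 1 else 0 : ℝ)
      ≤ (n.descFactorial k : ℝ)⁻¹ * ∑ j : Fin k ↪ Fin n,
          ∑ p : (Fin c ↪ Fin k) × (Fin c → Fin m),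
            (if ∀ a, j (p.1 a) = i (p.2 a) then 1 else 0 : ℝ) := by
        refine mul_le_mul_of_nonneg_left (Finset.sum_le_sum fun j _ => ?_) (by positivity)
        split_ifs with h
        · obtain ⟨w, v, hwv⟩ := exists_of_le_overlap h
          refine le_trans ?_ (Finset.single_le_sum (fun p _ => ?_) (Finset.mem_univ (w, v)))
          · simp [hwv]
          · split_ifs <;> simp
        · exact Finset.sum_nonneg fun p _ => by split_ifs <;> simp
    _ = ∑ p : (Fin c ↪ Fin k) × (Fin c → Fin m), (n.descFactorial k : ℝ)⁻¹ *
          ∑ j : Fin k ↪ Fin n, (if ∀ a, j (p.1 a) = i (p.2 a) then 1 else 0 : ℝ) := by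
        rw [Finset.sum_comm, Finset.mul_sum]
    _ ≤ ∑ p : (Fin c ↪ Fin k) × (Fin c → Fin m), (n.descFactorial c : ℝ)⁻¹ :=
        Finset.sum_le_sum fun p _ => avg_indicator_le hk p.1 fun a => i (p.2 a)
    _ = _ := by
        rw [Finset.sum_const, Finset.card_univ, nsmul_eq_mul]
        simp [Fintype.card_embedding_eq]

/-- Count only the tuples that agree with i on the first c arguments. Among these, an overlap other
than c forces one more coincidence j a = i b with a ≥ c; there are at most k² such pairs, and each
has probability at most 1 / n(n-1)⋯(n-c). -/
lemma avg_overlap_eq_ge {c k n : ℕ} (hc : c ≤ k) (hk : k ≤ n) (i : Fin k ↪ Fin n) :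
    (n.descFactorial c : ℝ)⁻¹ - (k * k : ℕ) * (n.descFactorial (c + 1) : ℝ)⁻¹ ≤
    (n.descFactorial k : ℝ)⁻¹ * ∑ j : Fin k ↪ Fin n, (if overlap i j = c then 1 else 0 : ℝ) := by
  set w : Fin c ↪ Fin k := Fin.castLEEmb hc with hw
  set S : Finset (Fin k × Fin k) := Finset.univ.filter fun p => c ≤ (p.1 : ℕ) with hS
  have key : ∀ j : Fin k ↪ Fin n, (if ∀ a, j (w a) = i (w a) then 1 else 0 : ℝ)
      ≤ (if overlap i j = c then 1 else 0 : ℝ) + ∑ p ∈ S,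
        (if (∀ a, j (w a) = i (w a)) ∧ j p.1 = i p.2 then 1 else 0 : ℝ) := by
    intro j
    have hnn : 0 ≤ ∑ p ∈ S,
        (if (∀ a, j (w a) = i (w a)) ∧ j p.1 = i p.2 then 1 else 0 : ℝ) :=
      Finset.sum_nonneg fun p _ => by split_ifs <;> simp
    by_cases h1 : ∀ a, j (w a) = i (w a)
    swap
    · rw [if_neg h1]
      split_ifs <;> linarith
    rw [if_pos h1]
    by_cases h2 : overlap i j = c
    · rw [if_pos h2]; linarith
    rw [if_neg h2, zero_add]
    have h3 : ∃ a b : Fin k, c ≤ (a : ℕ) ∧ j a = i b := by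
      by_contra! h4
      apply h2
      unfold overlap
      have : (Finset.univ.filter fun a => ∃ b, i b = j a)
          = Finset.univ.map w := by
        ext a
        simp only [Finset.mem_filter, Finset.mem_univ, true_and, Finset.mem_map]
        constructor
        · rintro ⟨b, hb⟩
          have hlt : (a : ℕ) < c := by
            by_contra hge
            exact h4 a b (by omega) hb.symm
          exact ⟨⟨a, hlt⟩, by ext; simp [hw]⟩
        · rintro ⟨b, rfl⟩
          exact ⟨w b, (h1 b).symm⟩
      rw [this, Finset.card_map, Finset.card_univ, Fintype.card_fin]
    obtain ⟨a, b, hab, he⟩ := h3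
    refine le_trans ?_ (Finset.single_le_sum (fun p _ => ?_)
      (show (a, b) ∈ S by simp [hS, hab]))
    · rw [if_pos ⟨h1, he⟩]
    · split_ifs <;> simp
  have hpair : ∀ p ∈ S, (n.descFactorial k : ℝ)⁻¹ * ∑ j : Fin k ↪ Fin n,
      (if (∀ a, j (w a) = i (w a)) ∧ j p.1 = i p.2 then 1 else 0 : ℝ)
        ≤ (n.descFactorial (c + 1) : ℝ)⁻¹ := by
    intro p hp
    have hp' : c ≤ (p.1 : ℕ) := by simpa [hS] using hp
    -- As p.1 lies outside the first c arguments, the extra coincidence prescribes j at c + 1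
    -- distinct arguments. The prescribed values may repeat, which the upper bound allows.
    have hinj : Function.Injective (Fin.snoc (α := fun _ => Fin k) w p.1) := by
      rw [Fin.snoc_injective_iff]
      refine ⟨w.injective, ?_⟩
      rintro ⟨a, ha⟩
      have := congrArg Fin.val ha
      simp [hw] at this
      have := a.2
      omega
    refine le_trans (le_of_eq ?_)
      (avg_indicator_le hk ⟨_, hinj⟩ (Fin.snoc (α := fun _ => Fin n) (fun a => i (w a)) (i p.2)))
    congr 1
    refine Finset.sum_congr rfl fun j _ => ?_
    congr 1
    rw [eq_iff_iff, Fin.forall_fin_succ']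
    simp
  have hcard : (S.card : ℝ) ≤ (k * k : ℕ) := by
    rw [Nat.cast_le]
    refine (Finset.card_le_univ _).trans ?_
    simp
  have h0 := avg_indicator_eq hk w (w.trans i)
  simp only [Function.Embedding.trans_apply] at h0
  rw [← h0, sub_le_iff_le_add]
  calc _ ≤ (n.descFactorial k : ℝ)⁻¹ * ∑ j : Fin k ↪ Fin n,
        ((if overlap i j = c then 1 else 0 : ℝ) + ∑ p ∈ S,
        (if (∀ a, j (w a) = i (w a)) ∧ j p.1 = i p.2 then 1 else 0 : ℝ)) :=
        mul_le_mul_of_nonneg_left (Finset.sum_le_sum fun j _ => key j) (by positivity)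
    _ = (n.descFactorial k : ℝ)⁻¹ * ∑ j : Fin k ↪ Fin n, (if overlap i j = c then 1 else 0 : ℝ)
        + ∑ p ∈ S, (n.descFactorial k : ℝ)⁻¹ * ∑ j : Fin k ↪ Fin n,
        (if (∀ a, j (w a) = i (w a)) ∧ j p.1 = i p.2 then 1 else 0 : ℝ) := by
        rw [Finset.sum_add_distrib, mul_add, Finset.sum_comm (s := Finset.univ) (t := S),
          Finset.mul_sum]
        simp only [Finset.mul_sum]
    _ ≤ _ := by
        refine add_le_add le_rfl ((Finset.sum_le_sum hpair).trans ?_)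
        rw [Finset.sum_const, nsmul_eq_mul]
        exact mul_le_mul_of_nonneg_right hcard (by positivity)

end Deterministic

/-! ### Product measures, and mixed moments of kernels at overlapping tuples. -/

section Product

variable {𝒳 : Type*} [MeasurableSpace 𝒳] (P : Measure 𝒳) [IsProbabilityMeasure P]

lemma measurePreserving_precomp {ι κ : Type*} [Fintype ι] [Fintype κ] {e : κ → ι}
    (he : Function.Injective e) :
    MeasurePreserving (fun (x : ι → 𝒳) a => x (e a)) (Measure.pi fun _ => P)
      (Measure.pi fun _ => P) := by
  refine ⟨by fun_prop, ?_⟩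
  have h := (iIndepFun_pi (μ := fun _ : ι => P) (X := fun _ (x : 𝒳) => x)
    fun _ => aemeasurable_id).precomp he
  have h2 := h.map_fun_eq_pi_map fun a => (measurable_pi_apply (e a)).aemeasurable
  refine h2.trans ?_
  congr 1
  ext1 a
  exact (measurePreserving_eval (fun _ : ι => P) (e a)).map_eq

lemma measurePreserving_split {ι κ κ' : Type*} [Fintype ι] [Fintype κ] [Fintype κ']
    {e : κ → ι} {e' : κ' → ι} (he : Function.Injective (Sum.elim e e')) :
    MeasurePreserving (fun (x : ι → 𝒳) => ((fun a => x (e a)), fun a => x (e' a)))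
      (Measure.pi fun _ => P) ((Measure.pi fun _ => P).prod (Measure.pi fun _ => P)) :=
  (measurePreserving_sumPiEquivProdPi (fun _ : κ ⊕ κ' => P)).comp
    (measurePreserving_precomp P he)

lemma measurePreserving_curry {ι κ : Type*} [Fintype ι] [Fintype κ] :
    MeasurePreserving (fun (x : ι × κ → 𝒳) a b => x (a, b)) (Measure.pi fun _ => P)
      (Measure.pi fun _ => Measure.pi fun _ => P) := by
  refine ⟨by fun_prop, ?_⟩
  have h := Measure.infinitePi_map_curry fun (_ : ι) (_ : κ) => P
  simp only [Measure.infinitePi_eq_pi] at h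
  exact h

/-- The vector with first coordinates `x` and remaining coordinates `y`. -/
def glue {k l : ℕ} (x : Fin l → 𝒳) (y : Fin (k - l) → 𝒳) : Fin k → 𝒳 :=
  fun j => if h : (j : ℕ) < l then x ⟨j, h⟩ else y ⟨(j : ℕ) - l, by omega⟩

/-- The glued vector selects k distinct coordinates of an independent family indexed by `Fin m ⊕ Fin
(k - l)`, because u is injective. -/
lemma measurePreserving_glue {k l m : ℕ} (u : Fin l ↪ Fin m) :
    MeasurePreserving
      (fun p : (Fin m → 𝒳) × (Fin (k - l) → 𝒳) => (glue (fun a => p.1 (u a)) p.2 : Fin k → 𝒳))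
      ((Measure.pi fun _ => P).prod (Measure.pi fun _ => P)) (Measure.pi fun _ => P) := by
  have he : Function.Injective (fun j : Fin k => if h : (j : ℕ) < l then
      (Sum.inl (u ⟨j, h⟩) : Fin m ⊕ Fin (k - l)) else Sum.inr ⟨(j : ℕ) - l, by omega⟩) := by
    intro a b hab
    dsimp only at hab
    split_ifs at hab with h1 h2 h2
    · have := u.injective (Sum.inl_injective hab)
      simp only [Fin.mk.injEq] at this
      exact Fin.ext this
    · have := Sum.inr_injective hab
      simp only [Fin.mk.injEq] at this
      exact Fin.ext (by omega)
  have h := (measurePreserving_precomp P he).comp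
    (measurePreserving_sumPiEquivProdPi_symm (fun _ : Fin m ⊕ Fin (k - l) => P))
  convert h using 1
  ext p j
  simp only [glue, Function.comp_apply]
  split_ifs <;> rfl

variable {H : Type*} [NormedAddCommGroup H] [InnerProductSpace ℝ H]

lemma integral_comp_measurePreserving {α β E : Type*} [MeasurableSpace α] [MeasurableSpace β]
    [NormedAddCommGroup E] [NormedSpace ℝ E] {μ : Measure α} {ν : Measure β} {φ : α → β}
    (h : MeasurePreserving φ μ ν) {g : β → E} (hg : AEStronglyMeasurable g ν) :
    ∫ x, g (φ x) ∂μ = ∫ y, g y ∂ν := by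
  rw [← h.map_eq] at hg ⊢
  exact (integral_map h.measurable.aemeasurable hg).symm

lemma memLp_two_integrable_inner {α : Type*} [MeasurableSpace α] {μ : Measure α} {f g : α → H}
    (hf : MemLp f 2 μ) (hg : MemLp g 2 μ) : Integrable (fun x => (inner ℝ (f x) (g x) : ℝ)) μ := by
  refine Integrable.mono' ((memLp_two_iff_integrable_sq_norm hf.1).1 hf |>.add
    ((memLp_two_iff_integrable_sq_norm hg.1).1 hg)) (hf.1.inner hg.1)
    (ae_of_all _ fun x => ?_)
  rw [Real.norm_eq_abs]
  refine (abs_real_inner_le_norm _ _).trans ?_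
  simp only [Pi.add_apply]
  nlinarith [sq_nonneg (‖f x‖ - ‖g x‖), sq_nonneg (‖f x‖), sq_nonneg (‖g x‖)]

lemma abs_integral_inner_le {α : Type*} [MeasurableSpace α] {μ : Measure α} {f g : α → H}
    (hf : MemLp f 2 μ) (hg : MemLp g 2 μ) :
    |∫ x, (inner ℝ (f x) (g x) : ℝ) ∂μ| ≤ ∫ x, ‖f x‖ ^ 2 ∂μ + ∫ x, ‖g x‖ ^ 2 ∂μ := by
  have h1 := (memLp_two_iff_integrable_sq_norm hf.1).1 hf
  have h2 := (memLp_two_iff_integrable_sq_norm hg.1).1 hg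
  rw [← integral_add h1 h2, ← Real.norm_eq_abs]
  refine norm_integral_le_of_norm_le (h1.add h2) (ae_of_all _ fun x => ?_)
  rw [Real.norm_eq_abs]
  refine (abs_real_inner_le_norm _ _).trans ?_
  nlinarith [sq_nonneg (‖f x‖ - ‖g x‖), sq_nonneg (‖f x‖), sq_nonneg (‖g x‖)]

variable [CompleteSpace H] {P}

/-- Fubini: integrating out the fresh variables y, which G does not see, turns q into its canonical
function of order l in the shared variables. -/
lemma integral_inner_glue {k l m : ℕ} (u : Fin l ↪ Fin m) {G : (Fin m → 𝒳) → H}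
    {q : (Fin k → 𝒳) → H} (hG : MemLp G 2 (Measure.pi fun _ => P))
    (hq : MemLp q 2 (Measure.pi fun _ => P)) :
    Integrable (fun p : (Fin m → 𝒳) × (Fin (k - l) → 𝒳) =>
      (inner ℝ (G p.1) (q (glue (fun a => p.1 (u a)) p.2)) : ℝ))
      ((Measure.pi fun _ => P).prod (Measure.pi fun _ => P)) ∧
    Integrable (fun z : Fin m → 𝒳 => (inner ℝ (G z) (canonical P q l fun a => z (u a)) : ℝ))
      (Measure.pi fun _ => P) ∧
    ∫ p : (Fin m → 𝒳) × (Fin (k - l) → 𝒳),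
      (inner ℝ (G p.1) (q (glue (fun a => p.1 (u a)) p.2)) : ℝ)
      ∂((Measure.pi fun _ => P).prod (Measure.pi fun _ => P))
    = ∫ z : Fin m → 𝒳, (inner ℝ (G z) (canonical P q l fun a => z (u a)) : ℝ)
      ∂(Measure.pi fun _ => P) := by
  have hg := hq.comp_measurePreserving (measurePreserving_glue (k := k) P u)
  have hG' := hG.comp_measurePreserving (measurePreserving_fst (μ := Measure.pi fun _ : Fin m => P)
    (ν := Measure.pi fun _ : Fin (k - l) => P))
  have hint := memLp_two_integrable_inner hG' hg
  have hgi := (hg.integrable one_le_two).prod_right_ae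
  have hae : (fun z : Fin m → 𝒳 => ∫ y : Fin (k - l) → 𝒳,
      (inner ℝ (G z) (q (glue (fun a => z (u a)) y)) : ℝ) ∂(Measure.pi fun _ => P))
      =ᵐ[Measure.pi fun _ => P]
      fun z : Fin m → 𝒳 => (inner ℝ (G z) (canonical P q l fun a => z (u a)) : ℝ) := by
    filter_upwards [hgi] with z hz
    exact integral_inner hz _
  refine ⟨hint, hint.integral_prod_left.congr hae, ?_⟩
  rw [← integral_congr_ae hae]
  exact integral_prod _ hint

/-- A reordering that puts the shared indices of j first, so that a symmetric kernel at j has the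
glued form with `overlap i j` shared variables. -/
lemma exists_perm_overlap {k m n : ℕ} (i : Fin m ↪ Fin n) (j : Fin k ↪ Fin n) :
    ∃ (t : Equiv.Perm (Fin k)) (u : Fin (overlap i j) ↪ Fin m),
      (∀ (a : Fin k) (h : (a : ℕ) < overlap i j), j (t a) = i (u ⟨a, h⟩)) ∧
      (∀ a : Fin k, overlap i j ≤ (a : ℕ) → ∀ b, i b ≠ j (t a)) := by
  classical
  set l := overlap i j with hl
  have hlk : l ≤ k := (Finset.card_le_univ _).trans (by simp)
  have hcard : Fintype.card {a : Fin k // (a : ℕ) < l} = Fintype.card {a : Fin k // ∃ b, i b = j a} := by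
    rw [Fintype.card_subtype, Fintype.card_subtype]
    have : (Finset.univ.filter fun a : Fin k => (a : ℕ) < l)
        = Finset.univ.map (Fin.castLEEmb hlk) := by
      ext a
      simp only [Finset.mem_filter, Finset.mem_univ, true_and, Finset.mem_map]
      constructor
      · intro h; exact ⟨⟨a, h⟩, by ext; simp⟩
      · rintro ⟨b, rfl⟩; simp
    rw [this, Finset.card_map, Finset.card_univ, Fintype.card_fin, hl, overlap]
  set t : Equiv.Perm (Fin k) := (Fintype.equivOfCardEq hcard).extendSubtype with ht
  have h1 : ∀ (a : Fin k), (a : ℕ) < l → ∃ b, i b = j (t a) := fun a ha =>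
    Equiv.extendSubtype_mem (q := fun a => ∃ b, i b = j a) (Fintype.equivOfCardEq hcard) a ha
  have h2 : ∀ (a : Fin k), ¬ (a : ℕ) < l → ¬ ∃ b, i b = j (t a) := fun a ha =>
    Equiv.extendSubtype_not_mem (q := fun a => ∃ b, i b = j a) (Fintype.equivOfCardEq hcard) a ha
  choose v hv using h1
  refine ⟨t, ⟨fun a => v (Fin.castLE hlk a) a.2, ?_⟩, ?_, ?_⟩
  · intro a b hab
    dsimp only at hab
    have := congrArg i hab
    rw [hv, hv] at this
    have := t.injective (j.injective this)
    simpa using this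
  · intro a h
    exact (hv a h).symm
  · intro a ha b hb
    exact h2 a (by omega) ⟨b, hb⟩

/-- The mixed second moment of two kernels evaluated at overlapping tuples. -/
lemma exists_integral_inner_embedding {k m n : ℕ} {G : (Fin m → 𝒳) → H}
    {q : (Fin k → 𝒳) → H} (hqs : IsSymmetric q) (hG : MemLp G 2 (Measure.pi fun _ => P))
    (hq : MemLp q 2 (Measure.pi fun _ => P)) (i : Fin m ↪ Fin n) (j : Fin k ↪ Fin n) :
    ∃ u : Fin (overlap i j) ↪ Fin m,
      ∫ x : Fin n → 𝒳, (inner ℝ (G fun a => x (i a)) (q fun a => x (j a)) : ℝ)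
        ∂(Measure.pi fun _ => P)
      = ∫ z : Fin m → 𝒳, (inner ℝ (G z) (canonical P q (overlap i j) fun a => z (u a)) : ℝ)
        ∂(Measure.pi fun _ => P) := by
  obtain ⟨t, u, h1, h2⟩ := exists_perm_overlap i j
  refine ⟨u, ?_⟩
  obtain ⟨hint, -, heq⟩ := integral_inner_glue u hG hq
  rw [← heq]
  -- v lists the indices of j not used by i, so the coordinates at i and at v are independent.
  set v : Fin (k - overlap i j) → Fin n := fun b => j (t ⟨overlap i j + b, by omega⟩) with hv
  have hinj : Function.Injective (Sum.elim i v) := by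
    refine i.injective.sumElim ?_ ?_
    · intro a b hab
      have := t.injective (j.injective hab)
      simp only [Fin.mk.injEq, Nat.add_left_cancel_iff] at this
      exact Fin.ext this
    · intro a b
      exact h2 _ (by simp) a
  rw [← integral_comp_measurePreserving (measurePreserving_split P hinj) hint.1]
  congr 1
  ext x
  congr 1
  rw [← hqs t]
  congr 1
  ext a
  simp only [Function.comp_apply, glue]
  split_ifs with h
  · rw [h1 a h]
  · simp only [hv]
    congr 3
    ext
    simp only
    omega

/-- The mixed second moment of a kernel with itself is the second moment of a canonical
function. -/
lemma integral_inner_canonical_self {k l : ℕ} (hl : l ≤ k) {q : (Fin k → 𝒳) → H}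
    (hqs : IsSymmetric q) (hq : MemLp q 2 (Measure.pi fun _ => P)) (u : Fin l ↪ Fin k) :
    Integrable (fun x => ‖canonical P q l x‖ ^ 2) (Measure.pi fun _ => P) ∧
    ∫ z : Fin k → 𝒳, (inner ℝ (q z) (canonical P q l fun a => z (u a)) : ℝ)
        ∂(Measure.pi fun _ => P) = ∫ x, ‖canonical P q l x‖ ^ 2 ∂(Measure.pi fun _ => P) := by
  set w : Fin l ↪ Fin k := Fin.castLEEmb hl with hw
  obtain ⟨-, hintu, -⟩ := integral_inner_glue u hq hq
  obtain ⟨-, hint, -⟩ := integral_inner_glue w hq hq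
  -- By symmetry of q the arguments selected by u may be replaced by the first l; averaging q over
  -- the others then leaves ⟨q_l, q_l⟩.
  obtain ⟨s, hs⟩ := Equiv.Perm.exists_extending_pair u w u.injective w.injective
  have e1 : ∫ z : Fin k → 𝒳, (inner ℝ (q z) (canonical P q l fun a => z (u a)) : ℝ)
        ∂(Measure.pi fun _ => P)
      = ∫ z : Fin k → 𝒳, (inner ℝ (q z) (canonical P q l fun a => z (w a)) : ℝ)
        ∂(Measure.pi fun _ => P) := by
    rw [← integral_comp_measurePreserving (measurePreserving_precomp P s.injective) hintu.1]
    congr 1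
    ext z
    have : q (fun a => z (s a)) = q z := hqs s z
    rw [this]
    congr 2
    ext a
    exact congrArg z (hs a)
  rw [e1]
  have hgl := measurePreserving_glue (k := k) P (Function.Embedding.refl (Fin l))
  have hint2 := hgl.integrable_comp_of_integrable hint
  have hqi := ((hq.comp_measurePreserving hgl).integrable one_le_two).prod_right_ae
  have hfun : ∀ (x : Fin l → 𝒳) (y : Fin (k - l) → 𝒳),
      (fun a => glue x y (w a)) = x := by
    intro x y
    ext a
    simp [glue, hw]
  have hae : (fun x : Fin l → 𝒳 => ∫ y : Fin (k - l) → 𝒳,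
      (inner ℝ (q (glue x y)) (canonical P q l fun a => glue x y (w a)) : ℝ)
        ∂(Measure.pi fun _ => P)) =ᵐ[Measure.pi fun _ => P]
      fun x => ‖canonical P q l x‖ ^ 2 := by
    filter_upwards [hqi] with x hx
    simp_rw [hfun]
    rw [← real_inner_self_eq_norm_sq]
    simp_rw [real_inner_comm]
    exact integral_inner hx _
  refine ⟨(Integrable.integral_prod_left hint2).congr hae, ?_⟩
  rw [← integral_congr_ae hae, ← integral_comp_measurePreserving hgl hint.1]
  exact integral_prod _ hint2

end Product

/-! ### First and second moments of U-statistics. -/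

section Moments

variable {𝒳 : Type*} [MeasurableSpace 𝒳] {P : Measure 𝒳} [IsProbabilityMeasure P]
  {H : Type*} [NormedAddCommGroup H] [InnerProductSpace ℝ H]

lemma memLp_embedding {E : Type*} [NormedAddCommGroup E] {k n : ℕ} {p : ENNReal}
    {g : (Fin k → 𝒳) → E} (hg : MemLp g p (Measure.pi fun _ => P)) (i : Fin k ↪ Fin n) :
    MemLp (fun x : Fin n → 𝒳 => g fun a => x (i a)) p (Measure.pi fun _ => P) :=
  hg.comp_measurePreserving (measurePreserving_precomp P i.injective)

lemma integral_embedding {E : Type*} [NormedAddCommGroup E] [NormedSpace ℝ E] {k n : ℕ}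
    {g : (Fin k → 𝒳) → E} (hg : AEStronglyMeasurable g (Measure.pi fun _ => P))
    (i : Fin k ↪ Fin n) :
    ∫ x : Fin n → 𝒳, g (fun a => x (i a)) ∂(Measure.pi fun _ => P)
      = ∫ y, g y ∂(Measure.pi fun _ => P) :=
  integral_comp_measurePreserving (measurePreserving_precomp P i.injective) hg

lemma memLp_uStat {E : Type*} [NormedAddCommGroup E] [NormedSpace ℝ E] {k : ℕ} (n : ℕ)
    {p : ENNReal} {g : (Fin k → 𝒳) → E} (hg : MemLp g p (Measure.pi fun _ => P)) :
    MemLp (uStat k n g) p (Measure.pi fun _ => P) :=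
  (memLp_finsetSum (f := fun (i : Fin k ↪ Fin n) (x : Fin n → 𝒳) => g fun a => x (i a))
    Finset.univ fun i _ => memLp_embedding hg i).const_smul _

lemma integral_uStat {E : Type*} [NormedAddCommGroup E] [NormedSpace ℝ E] {k n : ℕ}
    (hk : k ≤ n) {g : (Fin k → 𝒳) → E} (hg : Integrable g (Measure.pi fun _ => P)) :
    ∫ x, uStat k n g x ∂(Measure.pi fun _ => P) = ∫ y, g y ∂(Measure.pi fun _ => P) := by
  unfold uStat
  rw [integral_smul, integral_finsetSum _ fun i _ =>
    memLp_one_iff_integrable.1 (memLp_embedding (memLp_one_iff_integrable.2 hg) i)]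
  simp_rw [integral_embedding hg.1]
  rw [Finset.sum_const, Finset.card_univ, Fintype.card_embedding_eq, Fintype.card_fin,
    Fintype.card_fin, ← Nat.cast_smul_eq_nsmul ℝ, smul_smul,
    inv_mul_cancel₀ (descFactorial_cast_ne_zero hk), one_smul]

lemma integral_inner_uStat {k m : ℕ} (n : ℕ) {G : (Fin m → 𝒳) → H} {q : (Fin k → 𝒳) → H}
    (hG : MemLp G 2 (Measure.pi fun _ => P)) (hq : MemLp q 2 (Measure.pi fun _ => P)) :
    ∫ x, (inner ℝ (uStat m n G x) (uStat k n q x) : ℝ) ∂(Measure.pi fun _ => P)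
      = (n.descFactorial m : ℝ)⁻¹ * ∑ i : Fin m ↪ Fin n, ((n.descFactorial k : ℝ)⁻¹ *
        ∑ j : Fin k ↪ Fin n, ∫ x : Fin n → 𝒳,
          (inner ℝ (G fun a => x (i a)) (q fun a => x (j a)) : ℝ) ∂(Measure.pi fun _ => P)) := by
  have hij : ∀ (i : Fin m ↪ Fin n) (j : Fin k ↪ Fin n), Integrable (fun x : Fin n → 𝒳 =>
      (inner ℝ (G fun a => x (i a)) (q fun a => x (j a)) : ℝ)) (Measure.pi fun _ => P) :=
    fun i j => memLp_two_integrable_inner (memLp_embedding hG i) (memLp_embedding hq j)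
  unfold uStat
  simp_rw [real_inner_smul_left, sum_inner, real_inner_smul_right, inner_sum]
  rw [integral_const_mul, integral_finsetSum _ fun i _ =>
    (integrable_finsetSum _ fun j _ => hij i j).const_mul _]
  congr 1
  refine Finset.sum_congr rfl fun i _ => ?_
  rw [integral_const_mul, integral_finsetSum _ fun j _ => hij i j]

variable [CompleteSpace H]

/-- Canonical functions of order less than `c` do not contribute to mixed moments. -/
lemma abs_integral_inner_uStat_le {c k m n : ℕ} (hk : k ≤ n) (hm : m ≤ n)
    {G : (Fin m → 𝒳) → H} {q : (Fin k → 𝒳) → H} (hqs : IsSymmetric q)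
    (hG : MemLp G 2 (Measure.pi fun _ => P)) (hq : MemLp q 2 (Measure.pi fun _ => P))
    (hc : ∀ l < c, ∀ᵐ x ∂(Measure.pi fun _ : Fin l => P), canonical P q l x = 0) :
    |∫ x, (inner ℝ (uStat m n G x) (uStat k n q x) : ℝ) ∂(Measure.pi fun _ => P)|
      ≤ (k.descFactorial c * m ^ c : ℕ) * (n.descFactorial c : ℝ)⁻¹ *
        (∫ y, ‖G y‖ ^ 2 ∂(Measure.pi fun _ => P) + ∫ y, ‖q y‖ ^ 2 ∂(Measure.pi fun _ => P)) := by
  set B := ∫ y, ‖G y‖ ^ 2 ∂(Measure.pi fun _ => P) + ∫ y, ‖q y‖ ^ 2 ∂(Measure.pi fun _ => P)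
    with hB
  have hB0 : 0 ≤ B := add_nonneg (integral_nonneg fun _ => by positivity)
    (integral_nonneg fun _ => by positivity)
  have hterm : ∀ (i : Fin m ↪ Fin n) (j : Fin k ↪ Fin n), |∫ x : Fin n → 𝒳,
      (inner ℝ (G fun a => x (i a)) (q fun a => x (j a)) : ℝ) ∂(Measure.pi fun _ => P)|
        ≤ (if c ≤ overlap i j then 1 else 0) * B := by
    intro i j
    split_ifs with h
    · rw [one_mul]
      refine (abs_integral_inner_le (memLp_embedding hG i) (memLp_embedding hq j)).trans
        (le_of_eq ?_)
      rw [integral_embedding (g := fun y => ‖G y‖ ^ 2) (by have := hG.1; fun_prop) i,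
        integral_embedding (g := fun y => ‖q y‖ ^ 2) (by have := hq.1; fun_prop) j]
    · obtain ⟨u, hu⟩ := exists_integral_inner_embedding hqs hG hq i j
      have h0 := (measurePreserving_precomp P u.injective).quasiMeasurePreserving.ae
        (hc _ (not_le.1 h))
      rw [hu, integral_eq_zero_of_ae]
      · simp
      filter_upwards [h0] with z hz
      rw [hz]
      simp
  rw [integral_inner_uStat n hG hq, abs_mul, abs_of_nonneg
    (a := (n.descFactorial m : ℝ)⁻¹) (by positivity)]
  have hrow : ∀ i : Fin m ↪ Fin n, |(n.descFactorial k : ℝ)⁻¹ *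
        ∑ j : Fin k ↪ Fin n, ∫ x : Fin n → 𝒳,
          (inner ℝ (G fun a => x (i a)) (q fun a => x (j a)) : ℝ) ∂(Measure.pi fun _ => P)|
      ≤ (k.descFactorial c * m ^ c : ℕ) * (n.descFactorial c : ℝ)⁻¹ * B := by
    intro i
    rw [abs_mul, abs_of_nonneg (a := (n.descFactorial k : ℝ)⁻¹) (by positivity)]
    calc _ ≤ (n.descFactorial k : ℝ)⁻¹ * ∑ j : Fin k ↪ Fin n,
          (if c ≤ overlap i j then 1 else 0) * B :=
          mul_le_mul_of_nonneg_left ((Finset.abs_sum_le_sum_abs _ _).trans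
            (Finset.sum_le_sum fun j _ => hterm i j)) (by positivity)
      _ = ((n.descFactorial k : ℝ)⁻¹ * ∑ j : Fin k ↪ Fin n,
          (if c ≤ overlap i j then 1 else 0)) * B := by rw [← Finset.sum_mul, mul_assoc]
      _ ≤ _ := mul_le_mul_of_nonneg_right (avg_overlap_ge_le hk i) hB0
  calc _ ≤ (n.descFactorial m : ℝ)⁻¹ * ∑ i : Fin m ↪ Fin n,
        ((k.descFactorial c * m ^ c : ℕ) * (n.descFactorial c : ℝ)⁻¹ * B) :=
        mul_le_mul_of_nonneg_left ((Finset.abs_sum_le_sum_abs _ _).trans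
          (Finset.sum_le_sum fun i _ => hrow i)) (by positivity)
    _ = _ := by
        rw [Finset.sum_const, Finset.card_univ, Fintype.card_embedding_eq, Fintype.card_fin,
          Fintype.card_fin, nsmul_eq_mul, ← mul_assoc,
          inv_mul_cancel₀ (descFactorial_cast_ne_zero hm), one_mul]

/-- Every term of the double sum is the second moment of a canonical function, hence nonnegative.
Keeping only the pairs of tuples with overlap exactly c gives the bound. -/
lemma integral_norm_sq_uStat_ge {c k n : ℕ} (hc : c ≤ k) (hk : k ≤ n)
    {q : (Fin k → 𝒳) → H} (hqs : IsSymmetric q) (hq : MemLp q 2 (Measure.pi fun _ => P)) :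
    ((n.descFactorial c : ℝ)⁻¹ - (k * k : ℕ) * (n.descFactorial (c + 1) : ℝ)⁻¹) *
      ∫ x, ‖canonical P q c x‖ ^ 2 ∂(Measure.pi fun _ => P)
      ≤ ∫ x, ‖uStat k n q x‖ ^ 2 ∂(Measure.pi fun _ => P) := by
  set ζ := ∫ x, ‖canonical P q c x‖ ^ 2 ∂(Measure.pi fun _ => P) with hζ
  have hζ0 : 0 ≤ ζ := integral_nonneg fun _ => by positivity
  have hterm : ∀ (i : Fin k ↪ Fin n) (j : Fin k ↪ Fin n),
      (if overlap i j = c then 1 else 0) * ζ ≤ ∫ x : Fin n → 𝒳,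
      (inner ℝ (q fun a => x (i a)) (q fun a => x (j a)) : ℝ) ∂(Measure.pi fun _ => P) := by
    intro i j
    obtain ⟨u, hu⟩ := exists_integral_inner_embedding hqs hq hq i j
    have hle : overlap i j ≤ k := (Finset.card_le_univ _).trans (by simp)
    rw [hu, (integral_inner_canonical_self hle hqs hq u).2]
    split_ifs with h
    · subst h
      rw [one_mul]
    · rw [zero_mul]
      exact integral_nonneg fun _ => by positivity
  simp_rw [← real_inner_self_eq_norm_sq]
  rw [integral_inner_uStat n hq hq]
  calc _ = (n.descFactorial k : ℝ)⁻¹ * ∑ i : Fin k ↪ Fin n,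
        (((n.descFactorial c : ℝ)⁻¹ - (k * k : ℕ) * (n.descFactorial (c + 1) : ℝ)⁻¹) * ζ) := by
        rw [Finset.sum_const, Finset.card_univ, Fintype.card_embedding_eq, Fintype.card_fin,
          Fintype.card_fin, nsmul_eq_mul, ← mul_assoc,
          inv_mul_cancel₀ (descFactorial_cast_ne_zero hk), one_mul]
    _ ≤ _ := by
        refine mul_le_mul_of_nonneg_left (Finset.sum_le_sum fun i _ => ?_) (by positivity)
        refine (mul_le_mul_of_nonneg_right (avg_overlap_eq_ge hc hk i) hζ0).trans ?_
        rw [mul_assoc, Finset.sum_mul]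
        exact mul_le_mul_of_nonneg_left (Finset.sum_le_sum fun j _ => hterm i j) (by positivity)

lemma inv_descFactorial_le {c n : ℕ} (hn : 2 * c ≤ n) (h0 : 0 < n) :
    (n.descFactorial c : ℝ)⁻¹ ≤ 2 ^ c * ((n : ℝ) ^ c)⁻¹ := by
  have hn0 : (0 : ℝ) < n := by exact_mod_cast h0
  have h1 : (n : ℝ) / 2 ≤ ((n + 1 - c : ℕ) : ℝ) := by
    rw [div_le_iff₀ two_pos]
    norm_cast
    omega
  have h2 : ((n : ℝ) / 2) ^ c ≤ (n.descFactorial c : ℝ) :=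
    (pow_le_pow_left₀ (by positivity) h1 c).trans
      (by exact_mod_cast Nat.pow_sub_le_descFactorial n c)
  refine (inv_anti₀ (by positivity) h2).trans (le_of_eq ?_)
  rw [div_pow, inv_div, div_eq_mul_inv]

/-- The subtracted term is k²/(n - c) times the first one, hence at most half of it. -/
lemma inv_descFactorial_sub_ge {c n : ℕ} (k : ℕ) (hn : 2 * (k * k) + c < n) :
    2⁻¹ * ((n : ℝ) ^ c)⁻¹ ≤
      (n.descFactorial c : ℝ)⁻¹ - (k * k : ℕ) * (n.descFactorial (c + 1) : ℝ)⁻¹ := by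
  have hpos : (0 : ℝ) < n.descFactorial c := by
    exact_mod_cast Nat.descFactorial_pos.2 (by omega)
  have hnc : (0 : ℝ) < ((n - c : ℕ) : ℝ) := by
    exact_mod_cast (by omega : 0 < n - c)
  have hle : (n.descFactorial c : ℝ) ≤ (n : ℝ) ^ c := by
    exact_mod_cast Nat.descFactorial_le_pow n c
  have h2 : ((k * k : ℕ) : ℝ) * ((n - c : ℕ) : ℝ)⁻¹ ≤ 2⁻¹ := by
    rw [← div_eq_mul_inv, div_le_iff₀ hnc]
    have : ((2 * (k * k) : ℕ) : ℝ) ≤ ((n - c : ℕ) : ℝ) := by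
      exact_mod_cast (by omega : 2 * (k * k) ≤ n - c)
    push_cast at this ⊢
    linarith
  have h5 : (n.descFactorial (c + 1) : ℝ)⁻¹
      = ((n - c : ℕ) : ℝ)⁻¹ * (n.descFactorial c : ℝ)⁻¹ := by
    rw [Nat.descFactorial_succ, Nat.cast_mul, mul_inv]
  rw [h5]
  have h3 := inv_anti₀ hpos hle
  have h4 : (0 : ℝ) ≤ (n.descFactorial c : ℝ)⁻¹ := by positivity
  nlinarith [mul_le_mul_of_nonneg_right h2 h4]

end Moments

/-! ### Integrability and Jensen's inequality for averages. -/

section Moments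

variable {E : Type*} [NormedAddCommGroup E]

variable {Y : Type*} [MeasurableSpace Y] {Q : Measure Y} [IsProbabilityMeasure Q]

lemma integrable_one_add_norm_pow {q : Y → E} (p : ℕ) (hq : MemLp q p Q) :
    Integrable (fun y => (1 + ‖q y‖) ^ p) Q := by
  have h := ((memLp_const (1 : ℝ)).add hq.norm).integrable_norm_pow'
  refine h.congr (ae_of_all _ fun y => ?_)
  simp only [Pi.add_apply, Real.norm_eq_abs]
  rw [abs_of_nonneg (by positivity)]

lemma memLp_sum_eval {q : Y → E} {p : ENNReal} (hq : MemLp q p Q) (N : ℕ) :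
    MemLp (fun y : Fin N → Y => ∑ b, q (y b)) p (Measure.pi fun _ => Q) :=
  memLp_finsetSum (f := fun b (y : Fin N → Y) => q (y b)) Finset.univ fun b _ =>
    hq.comp_measurePreserving (measurePreserving_eval (fun _ => Q) b)

lemma norm_avg_pow_le [NormedSpace ℝ E] {ι : Type*} [Fintype ι] {c : ℝ} (hc : c = Fintype.card ι)
    (h0 : c ≠ 0) (v : ι → E) (p : ℕ) : ‖c⁻¹ • ∑ i, v i‖ ^ p ≤ c⁻¹ * ∑ i, ‖v i‖ ^ p := by
  have hc0 : 0 ≤ c⁻¹ := by rw [hc]; positivity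
  have h := Real.pow_arith_mean_le_arith_mean_pow Finset.univ (fun _ : ι => c⁻¹) (fun i => ‖v i‖)
    (fun _ _ => hc0) (by rw [Finset.sum_const, Finset.card_univ, nsmul_eq_mul, ← hc,
      mul_inv_cancel₀ h0]) (fun _ _ => norm_nonneg _) p
  rw [← Finset.mul_sum, ← Finset.mul_sum] at h
  refine le_trans (pow_le_pow_left₀ (norm_nonneg _) ?_ p) h
  rw [norm_smul, Real.norm_of_nonneg hc0]
  exact mul_le_mul_of_nonneg_left (norm_sum_le _ _) hc0

end Moments

/-! ### Even moments of i.i.d. sums in a Hilbert space. -/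

section HilbertMoments

/-- First-order Taylor remainder of t^{m+1} at a, to be used with a = ‖s‖², a + b = ‖s + ξ‖², A = 1
+ ‖s‖ and B = 1 + ‖ξ‖. The remainder has degree only 2m in A, since b² contributes A² where two
factors of a would contribute A⁴. -/
lemma abs_add_pow_sub_le (m : ℕ) : ∃ K : ℝ, 0 ≤ K ∧ ∀ a b A B : ℝ, 0 ≤ a → a ≤ A ^ 2 → 1 ≤ A →
    1 ≤ B → |b| ≤ 2 * A * B ^ 2 → |a + b| ≤ (A * B) ^ 2 →
    |(a + b) ^ (m + 1) - a ^ (m + 1) - (m + 1) * a ^ m * b| ≤ K * A ^ (2 * m) * B ^ (2 * m + 2) := by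
  induction m with
  | zero => exact ⟨0, le_rfl, fun a b A B _ _ _ _ _ _ => by simp⟩
  | succ m ih =>
    obtain ⟨K, hK, h⟩ := ih
    refine ⟨K + 4 * (m + 1), by positivity, fun a b A B ha haA hA hB hb hab => ?_⟩
    have h1 := h a b A B ha haA hA hB hb hab
    -- The remainder of degree m + 2 is (a + b) times that of degree m + 1, plus (m + 1) a^m b².
    have e : (a + b) ^ (m + 1 + 1) - a ^ (m + 1 + 1) - ((m + 1 : ℕ) + 1) * a ^ (m + 1) * b
        = (a + b) * ((a + b) ^ (m + 1) - a ^ (m + 1) - (m + 1) * a ^ m * b)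
          + (m + 1) * (a ^ m * b ^ 2) := by
      push_cast
      ring
    have hb2 : b ^ 2 ≤ (2 * A * B ^ 2) ^ 2 := sq_le_sq' (by linarith [neg_abs_le b])
      ((le_abs_self b).trans hb)
    have ham : a ^ m ≤ (A ^ 2) ^ m := pow_le_pow_left₀ ha haA m
    have h2 : a ^ m * b ^ 2 ≤ 4 * (A ^ (2 * (m + 1)) * B ^ (2 * (m + 1) + 2)) := by
      calc a ^ m * b ^ 2 ≤ (A ^ 2) ^ m * (2 * A * B ^ 2) ^ 2 := by gcongr
        _ = 4 * (A ^ (2 * (m + 1)) * B ^ 4) := by ring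
        _ ≤ _ := by
          have hB4 : B ^ 4 ≤ B ^ (2 * (m + 1) + 2) := pow_le_pow_right₀ hB (by omega)
          gcongr
    have h3 : |(a + b) * ((a + b) ^ (m + 1) - a ^ (m + 1) - (m + 1) * a ^ m * b)|
        ≤ K * (A ^ (2 * (m + 1)) * B ^ (2 * (m + 1) + 2)) := by
      rw [abs_mul]
      calc _ ≤ (A * B) ^ 2 * (K * A ^ (2 * m) * B ^ (2 * m + 2)) := by gcongr
        _ = _ := by ring
    rw [e]
    refine (abs_add_le _ _).trans ?_
    have h4 : |((m : ℝ) + 1) * (a ^ m * b ^ 2)| = ((m : ℝ) + 1) * (a ^ m * b ^ 2) :=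
      abs_of_nonneg (by positivity)
    rw [h4]
    have h5 := mul_le_mul_of_nonneg_left h2 (by positivity : (0 : ℝ) ≤ (m : ℝ) + 1)
    linarith

variable {H : Type*} [NormedAddCommGroup H] [InnerProductSpace ℝ H]

/-- The term linear in ξ is kept exactly, so that it integrates to zero for an independent centred
ξ. The rest, including the ‖ξ‖² part of the first-order term, grows only like ‖s‖^{2m}. -/
lemma norm_add_pow_le (m : ℕ) : ∃ K : ℝ, 0 ≤ K ∧ ∀ s ξ : H,
    ‖s + ξ‖ ^ (2 * m + 2) ≤ ‖s‖ ^ (2 * m + 2) + 2 * (m + 1) * (‖s‖ ^ (2 * m) * inner ℝ s ξ)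
      + K * ((1 + ‖s‖) ^ (2 * m) * (1 + ‖ξ‖) ^ (2 * m + 2)) := by
  obtain ⟨K, hK, h⟩ := abs_add_pow_sub_le m
  refine ⟨K + (m + 1), by positivity, fun s ξ => ?_⟩
  have hs := norm_nonneg s
  have hx := norm_nonneg ξ
  have hi := abs_le.1 (abs_real_inner_le_norm s ξ)
  have e : ‖s + ξ‖ ^ 2 = ‖s‖ ^ 2 + (2 * inner ℝ s ξ + ‖ξ‖ ^ 2) := by
    rw [norm_add_sq_real]; ring
  have hsx : 0 ≤ ‖s‖ * ‖ξ‖ := by positivity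
  have hsx2 : 0 ≤ ‖s‖ * ‖ξ‖ ^ 2 := by positivity
  have h1 := h (‖s‖ ^ 2) (2 * inner ℝ s ξ + ‖ξ‖ ^ 2) (1 + ‖s‖) (1 + ‖ξ‖) (by positivity)
    (by nlinarith) (by linarith) (by linarith)
    (by rw [abs_le]; constructor <;> nlinarith [sq_nonneg ‖ξ‖])
    (by
      rw [← e, abs_of_nonneg (by positivity)]
      refine pow_le_pow_left₀ (norm_nonneg _) ((norm_add_le _ _).trans ?_) 2
      nlinarith)
  rw [← e] at h1
  have h2 := (abs_le.1 h1).2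
  have h3 : ‖s‖ ^ (2 * m) * ‖ξ‖ ^ 2 ≤ (1 + ‖s‖) ^ (2 * m) * (1 + ‖ξ‖) ^ (2 * m + 2) := by
    calc _ ≤ (1 + ‖s‖) ^ (2 * m) * (1 + ‖ξ‖) ^ 2 := by gcongr <;> linarith
      _ ≤ _ := by
        gcongr
        · linarith
        · omega
  have h4 := mul_le_mul_of_nonneg_left h3 (by positivity : (0 : ℝ) ≤ (m : ℝ) + 1)
  have e1 : (‖s + ξ‖ ^ 2) ^ (m + 1) = ‖s + ξ‖ ^ (2 * m + 2) := by rw [← pow_mul]; ring_nf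
  have e2 : (‖s‖ ^ 2) ^ (m + 1) = ‖s‖ ^ (2 * m + 2) := by rw [← pow_mul]; ring_nf
  have e3 : (‖s‖ ^ 2) ^ m = ‖s‖ ^ (2 * m) := by rw [← pow_mul]
  rw [e1, e2, e3] at h2
  linarith

lemma one_add_pow_le {t : ℝ} (ht : 0 ≤ t) (p : ℕ) : (1 + t) ^ p ≤ 2 ^ p * (1 + t ^ p) := by
  refine (add_pow_le zero_le_one ht p).trans ?_
  rw [one_pow]
  gcongr
  · norm_num
  · omega

variable {Y : Type*} [MeasurableSpace Y] {Q : Measure Y} [IsProbabilityMeasure Q] [CompleteSpace H]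

/-- Even moments of sums of i.i.d. centred vectors in a Hilbert space. -/
lemma exists_integral_norm_sum_pow_le {q : Y → H} (hq : ∀ p : ℕ, MemLp q p Q)
    (h0 : ∫ y, q y ∂Q = 0) (m : ℕ) :
    ∃ K : ℝ, 0 ≤ K ∧ ∀ N : ℕ,
      ∫ y : Fin N → Y, ‖∑ b, q (y b)‖ ^ (2 * m) ∂(Measure.pi fun _ => Q) ≤ K * (N : ℝ) ^ m := by
  induction m with
  | zero => exact ⟨1, zero_le_one, fun N => by simp⟩
  | succ m ih =>
    obtain ⟨K, hK, ih⟩ := ih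
    obtain ⟨L, hL, hpt⟩ := norm_add_pow_le (H := H) m
    set J := ∫ x, (1 + ‖q x‖) ^ (2 * m + 2) ∂Q with hJ
    have hJ0 : 0 ≤ J := integral_nonneg fun _ => by positivity
    -- K' (N + 1)^m bounds the increment of the moment when one summand is added: L comes from the
    -- pointwise expansion, J from the new summand, and 2^{2m}(1 + K) from the bound for exponent m.
    -- The inner induction on N sums these increments.
    set K' := L * (J * (2 ^ (2 * m) * (1 + K))) with hK'
    have hK'0 : 0 ≤ K' := by positivity
    refine ⟨K', hK'0, fun N => ?_⟩
    induction N with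
    | zero => simp
    | succ N ihN =>
      set S : (Fin N → Y) → H := fun y => ∑ b, q (y b) with hS
      have hSm : ∀ p : ℕ, MemLp S p (Measure.pi fun _ => Q) := fun p => memLp_sum_eval (hq p) N
      have mp := measurePreserving_piFinSuccAbove (fun _ : Fin (N + 1) => Q) 0
      have hqm := (hq 0).1
      have hSmm := (hSm 0).1
      have e1 : ∫ y : Fin (N + 1) → Y, ‖∑ b, q (y b)‖ ^ (2 * (m + 1)) ∂(Measure.pi fun _ => Q)
          = ∫ p : Y × (Fin N → Y), ‖S p.2 + q p.1‖ ^ (2 * m + 2)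
            ∂(Q.prod (Measure.pi fun _ => Q)) := by
        rw [← integral_comp_measurePreserving mp]
        · congr 1
          ext y
          rw [Fin.sum_univ_succ, add_comm]
          rfl
        · exact ((hSmm.comp_snd.add hqm.comp_fst).norm.pow _)
      have i1 : Integrable (fun p : Y × (Fin N → Y) => ‖S p.2‖ ^ (2 * m + 2))
          (Q.prod (Measure.pi fun _ => Q)) := by
        have := (hSm (2 * m + 2)).integrable_norm_pow'
        exact this.comp_snd Q
      have i2 : Integrable (fun p : Y × (Fin N → Y) => ‖S p.2‖ ^ (2 * m) * inner ℝ (S p.2) (q p.1))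
          (Q.prod (Measure.pi fun _ => Q)) := by
        have hd : Integrable (fun p : Y × (Fin N → Y) => ‖q p.1‖ * ‖S p.2‖ ^ (2 * m + 1))
            (Q.prod (Measure.pi fun _ => Q)) :=
          Integrable.mul_prod (f := fun x => ‖q x‖) (g := fun y => ‖S y‖ ^ (2 * m + 1))
            (by simpa using (hq 1).integrable_norm_pow') (hSm (2 * m + 1)).integrable_norm_pow'
        refine hd.mono' ((hSmm.comp_snd.norm.pow _).mul (hSmm.comp_snd.inner hqm.comp_fst))
          (ae_of_all _ fun p => ?_)
        rw [Real.norm_eq_abs, abs_mul, abs_of_nonneg (a := ‖S p.2‖ ^ (2 * m)) (by positivity)]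
        calc _ ≤ ‖S p.2‖ ^ (2 * m) * (‖S p.2‖ * ‖q p.1‖) := by
              gcongr
              exact abs_real_inner_le_norm _ _
          _ = _ := by ring
      have i3a := integrable_one_add_norm_pow (2 * m + 2) (hq (2 * m + 2))
      have i3b := integrable_one_add_norm_pow (2 * m) (hSm (2 * m))
      have i3 : Integrable (fun p : Y × (Fin N → Y) =>
          (1 + ‖S p.2‖) ^ (2 * m) * (1 + ‖q p.1‖) ^ (2 * m + 2))
          (Q.prod (Measure.pi fun _ => Q)) := by
        have := Integrable.mul_prod i3a i3b
        exact this.congr (ae_of_all _ fun p => mul_comm _ _)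
      -- The new summand is independent of the partial sum and centred.
      have z2 : ∫ p : Y × (Fin N → Y), ‖S p.2‖ ^ (2 * m) * inner ℝ (S p.2) (q p.1)
          ∂(Q.prod (Measure.pi fun _ => Q)) = 0 := by
        rw [integral_prod_symm _ i2]
        refine integral_eq_zero_of_ae (ae_of_all _ fun y => ?_)
        have hqi : Integrable q Q := memLp_one_iff_integrable.1 (by simpa using hq 1)
        dsimp only
        rw [integral_const_mul, integral_inner hqi, h0]
        simp
      have z3 : ∫ p : Y × (Fin N → Y), (1 + ‖S p.2‖) ^ (2 * m) * (1 + ‖q p.1‖) ^ (2 * m + 2)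
          ∂(Q.prod (Measure.pi fun _ => Q)) ≤ J * (2 ^ (2 * m) * ((1 + K) * ((N : ℝ) + 1) ^ m)) := by
        have : ∫ p : Y × (Fin N → Y), (1 + ‖S p.2‖) ^ (2 * m) * (1 + ‖q p.1‖) ^ (2 * m + 2)
          ∂(Q.prod (Measure.pi fun _ => Q))
          = J * ∫ y, (1 + ‖S y‖) ^ (2 * m) ∂(Measure.pi fun _ => Q) := by
          rw [hJ, ← integral_prod_mul]
          congr 1
          ext p
          exact mul_comm _ _
        rw [this]
        refine mul_le_mul_of_nonneg_left ?_ hJ0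
        have iS := (hSm (2 * m)).integrable_norm_pow'
        calc _ ≤ ∫ y, 2 ^ (2 * m) * (1 + ‖S y‖ ^ (2 * m)) ∂(Measure.pi fun _ => Q) :=
              integral_mono i3b (((integrable_const _).add iS).const_mul _)
                fun y => one_add_pow_le (norm_nonneg _) _
          _ = 2 ^ (2 * m) * (1 + ∫ y, ‖S y‖ ^ (2 * m) ∂(Measure.pi fun _ => Q)) := by
              rw [integral_const_mul, integral_add (integrable_const _) iS]
              simp
          _ ≤ _ := by
              have h1 := ih N
              have h2 : (N : ℝ) ^ m ≤ ((N : ℝ) + 1) ^ m := by gcongr; linarith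
              have h3 : (1 : ℝ) ≤ ((N : ℝ) + 1) ^ m := one_le_pow₀ (by linarith [N.cast_nonneg (α := ℝ)])
              have h4 := mul_le_mul_of_nonneg_left h2 hK
              gcongr
              linarith
      have z1 : ∫ p : Y × (Fin N → Y), ‖S p.2‖ ^ (2 * m + 2) ∂(Q.prod (Measure.pi fun _ => Q))
          = ∫ y, ‖S y‖ ^ (2 * m + 2) ∂(Measure.pi fun _ => Q) := by
        exact integral_comp_measurePreserving measurePreserving_snd
          (g := fun y => ‖S y‖ ^ (2 * m + 2)) (hSmm.norm.pow _)
      have hint : Integrable (fun p : Y × (Fin N → Y) => ‖S p.2 + q p.1‖ ^ (2 * m + 2))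
          (Q.prod (Measure.pi fun _ => Q)) := by
        have h1 : MemLp (fun p : Y × (Fin N → Y) => S p.2 + q p.1) ((2 * m + 2 : ℕ) : ENNReal)
            (Q.prod (Measure.pi fun _ => Q)) :=
          ((hSm _).comp_measurePreserving measurePreserving_snd).add
            ((hq _).comp_measurePreserving measurePreserving_fst)
        exact h1.integrable_norm_pow'
      rw [e1]
      calc _ ≤ ∫ p : Y × (Fin N → Y), (‖S p.2‖ ^ (2 * m + 2)
            + 2 * (m + 1) * (‖S p.2‖ ^ (2 * m) * inner ℝ (S p.2) (q p.1))
            + L * ((1 + ‖S p.2‖) ^ (2 * m) * (1 + ‖q p.1‖) ^ (2 * m + 2)))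
            ∂(Q.prod (Measure.pi fun _ => Q)) :=
            integral_mono hint ((i1.add (i2.const_mul _)).add (i3.const_mul _))
              fun p => hpt _ _
        _ = ∫ y, ‖S y‖ ^ (2 * m + 2) ∂(Measure.pi fun _ => Q)
            + L * ∫ p : Y × (Fin N → Y), (1 + ‖S p.2‖) ^ (2 * m) * (1 + ‖q p.1‖) ^ (2 * m + 2)
              ∂(Q.prod (Measure.pi fun _ => Q)) := by
            have i12 : Integrable (fun p : Y × (Fin N → Y) => ‖S p.2‖ ^ (2 * m + 2)
                + 2 * (m + 1) * (‖S p.2‖ ^ (2 * m) * inner ℝ (S p.2) (q p.1)))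
                (Q.prod (Measure.pi fun _ => Q)) := i1.add (i2.const_mul _)
            rw [integral_add i12 (i3.const_mul _), integral_add i1 (i2.const_mul _), integral_const_mul, integral_const_mul, z2, z1]
            ring
        _ ≤ K' * (N : ℝ) ^ (m + 1) + L * (J * (2 ^ (2 * m) * ((1 + K) * ((N : ℝ) + 1) ^ m))) :=
            add_le_add ihN (mul_le_mul_of_nonneg_left z3 hL)
        _ = K' * ((N : ℝ) ^ m * N + ((N : ℝ) + 1) ^ m) := by rw [hK']; ring
        _ ≤ K' * (((N : ℝ) + 1) ^ m * N + ((N : ℝ) + 1) ^ m) := by gcongr; linarith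
        _ = K' * ((N + 1 : ℕ) : ℝ) ^ (m + 1) := by push_cast; ring

end HilbertMoments

/-! ### Nonnegativity of the variance estimator. -/

section Deterministic

variable {𝒳 H : Type*} [NormedAddCommGroup H] [InnerProductSpace ℝ H]

/-- The unnormalized variance estimator `U_k^n(κ_k) - U_{2k}^n(κ_{2k})`. -/
noncomputable def varStat {k : ℕ} (r : (Fin k → 𝒳) → H) (n : ℕ) (x : Fin n → 𝒳) : ℝ :=
  uStat k n (kappaK r) x - uStat (k + k) n (kappa2K r) x

lemma varStat_nonneg {k n : ℕ} (hn : k + k ≤ n) (r : (Fin k → 𝒳) → H) (x : Fin n → 𝒳) :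
    0 ≤ varStat r n x :=
  sub_nonneg.2 ((le_abs_self _).trans (abs_uStat_kappa2K_le hn r x))

lemma uStat_smul_const {m n : ℕ} (g : (Fin m → 𝒳) → ℝ) (d : H) (x : Fin n → 𝒳) :
    uStat m n (fun y => g y • d) x = uStat m n g x • d := by
  unfold uStat
  rw [← Finset.sum_smul, smul_assoc]

end Deterministic

/-! ### Higher moments of U-statistics, and moments of the variance estimator. -/

section UStatisticMoments

lemma memLp_of_integrable_norm_pow {Ω E : Type*} [MeasurableSpace Ω] [NormedAddCommGroup E]
    {μ : Measure Ω} [IsFiniteMeasure μ] {Z : Ω → E} (hZ : AEStronglyMeasurable Z μ)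
    (h : ∀ p : ℕ, 2 ≤ p → Integrable (fun ω => ‖Z ω‖ ^ p) μ) (p : ℕ) : MemLp Z p μ := by
  have h2 : MemLp Z ((p + 2 : ℕ) : ENNReal) μ := by
    rw [← integrable_norm_rpow_iff hZ (by simp) (by exact ENNReal.natCast_ne_top _)]
    simpa only [ENNReal.toReal_natCast, Real.rpow_natCast] using h (p + 2) (by omega)
  exact h2.mono_exponent (by exact_mod_cast (by omega : p ≤ p + 2))

variable {𝒳 : Type*} [MeasurableSpace 𝒳] {P : Measure 𝒳} [IsProbabilityMeasure P]
  {H : Type*} [NormedAddCommGroup H] [InnerProductSpace ℝ H]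

/-- Even moments of centred U-statistics, by Hoeffding's averaging over blocks. -/
lemma exists_integral_norm_uStat_pow_le [CompleteSpace H] {k : ℕ} (hk : 0 < k)
    {q : (Fin k → 𝒳) → H} (hq : ∀ p : ℕ, MemLp q p (Measure.pi fun _ => P))
    (h0 : ∫ y, q y ∂(Measure.pi fun _ => P) = 0) (m : ℕ) :
    ∃ K : ℝ, 0 ≤ K ∧ ∀ n : ℕ, k ≤ n →
      ∫ x, ‖uStat k n q x‖ ^ (2 * m) ∂(Measure.pi fun _ => P) ≤ K * ((n : ℝ) ^ m)⁻¹ := by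
  obtain ⟨K, hK, hKN⟩ := exists_integral_norm_sum_pow_le hq h0 m
  refine ⟨K * (2 * k) ^ m, by positivity, fun n hn => ?_⟩
  set N := n / k with hN
  have hN1 : 0 < N := Nat.div_pos hn hk
  have hN0 : (N : ℝ) ≠ 0 := by exact_mod_cast hN1.ne'
  have hfac : (n.factorial : ℝ) ≠ 0 := by exact_mod_cast n.factorial_ne_zero
  -- N = ⌊n/k⌋ disjoint blocks of k indices; for each permutation of the sample, the kernel values
  -- on the blocks are i.i.d.
  set e : Fin N × Fin k ↪ Fin n := finProdFinEquiv.toEmbedding.trans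
    (Fin.castLEEmb (Nat.div_mul_le_self n k)) with he
  have hinj : ∀ b, Function.Injective fun a => e (b, a) := fun b a a' h => by
    simpa using e.injective h
  have hmp : ∀ π : Equiv.Perm (Fin n), MeasurePreserving
      (fun (x : Fin n → 𝒳) (b : Fin N) (a : Fin k) => x (π (e (b, a))))
      (Measure.pi fun _ => P) (Measure.pi fun _ => Measure.pi fun _ => P) := fun π =>
    (measurePreserving_curry P).comp (measurePreserving_precomp P (π.injective.comp e.injective))
  have hrep : ∀ x : Fin n → 𝒳, uStat k n q x = (n.factorial : ℝ)⁻¹ • ∑ π : Equiv.Perm (Fin n),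
      (N : ℝ)⁻¹ • ∑ b : Fin N, q fun a => x (π (e (b, a))) := by
    intro x
    have hb : ∀ b : Fin N, uStat k n q x = (n.factorial : ℝ)⁻¹ • ∑ π : Equiv.Perm (Fin n),
        q fun a => x (π (e (b, a))) := fun b =>
      avg_embedding_eq_avg_perm ⟨_, hinj b⟩ fun j => q fun a => x (j a)
    rw [← Finset.smul_sum, Finset.sum_comm, smul_comm, Finset.smul_sum]
    simp_rw [← hb]
    rw [Finset.sum_const, Finset.card_univ, Fintype.card_fin, ← Nat.cast_smul_eq_nsmul ℝ,
      smul_smul, inv_mul_cancel₀ hN0, one_smul]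
  have hS := fun p : ℕ => memLp_sum_eval (hq p) N
  have hint : ∀ π : Equiv.Perm (Fin n), Integrable (fun x : Fin n → 𝒳 =>
      ‖∑ b : Fin N, q fun a => x (π (e (b, a)))‖ ^ (2 * m)) (Measure.pi fun _ => P) := fun π =>
    (hmp π).integrable_comp_of_integrable (hS (2 * m)).integrable_norm_pow'
  have hval : ∀ π : Equiv.Perm (Fin n), ∫ x : Fin n → 𝒳,
      ‖∑ b : Fin N, q fun a => x (π (e (b, a)))‖ ^ (2 * m) ∂(Measure.pi fun _ => P)
        ≤ K * (N : ℝ) ^ m := fun π => by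
    rw [integral_comp_measurePreserving (hmp π)
      (g := fun y : Fin N → Fin k → 𝒳 => ‖∑ b, q (y b)‖ ^ (2 * m)) ((hS 0).1.norm.pow _)]
    exact hKN N
  -- From n < k(N + 1) and N ≥ 1; this is the source of the factor (2k)^m.
  have hnN : (n : ℝ) ≤ 2 * k * N := by
    have h1 : n < k * (N + 1) := Nat.lt_mul_div_succ n hk
    have h2 : n ≤ 2 * k * N := by nlinarith
    exact_mod_cast h2
  have hn0 : (0 : ℝ) < n := by exact_mod_cast hk.trans_le hn
  calc ∫ x, ‖uStat k n q x‖ ^ (2 * m) ∂(Measure.pi fun _ => P)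
      ≤ ∫ x : Fin n → 𝒳, (n.factorial : ℝ)⁻¹ * ∑ π : Equiv.Perm (Fin n), ((N : ℝ)⁻¹ ^ (2 * m) *
        ‖∑ b : Fin N, q fun a => x (π (e (b, a)))‖ ^ (2 * m)) ∂(Measure.pi fun _ => P) := by
        refine integral_mono (memLp_uStat n (hq _)).integrable_norm_pow'
          ((integrable_finsetSum _ fun π _ => (hint π).const_mul _).const_mul _) fun x => ?_
        dsimp only
        rw [hrep]
        refine (norm_avg_pow_le (by rw [Fintype.card_perm, Fintype.card_fin]) hfac _ _).trans
          (le_of_eq ?_)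
        congr 1
        refine Finset.sum_congr rfl fun π _ => ?_
        rw [norm_smul, mul_pow, Real.norm_of_nonneg (by positivity)]
    _ = (n.factorial : ℝ)⁻¹ * ∑ π : Equiv.Perm (Fin n), ((N : ℝ)⁻¹ ^ (2 * m) * ∫ x : Fin n → 𝒳,
        ‖∑ b : Fin N, q fun a => x (π (e (b, a)))‖ ^ (2 * m) ∂(Measure.pi fun _ => P)) := by
        rw [integral_const_mul, integral_finsetSum _ fun π _ => (hint π).const_mul _]
        simp_rw [integral_const_mul]
    _ ≤ (n.factorial : ℝ)⁻¹ * ∑ π : Equiv.Perm (Fin n),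
        ((N : ℝ)⁻¹ ^ (2 * m) * (K * (N : ℝ) ^ m)) := by
        gcongr with π
        exact hval π
    _ = K * ((N : ℝ) ^ m)⁻¹ := by
        rw [Finset.sum_const, Finset.card_univ, Fintype.card_perm, Fintype.card_fin, nsmul_eq_mul,
          ← mul_assoc, inv_mul_cancel₀ hfac, one_mul]
        have hNm : (N : ℝ) ^ m ≠ 0 := pow_ne_zero m hN0
        rw [inv_pow, mul_comm 2 m, pow_mul]
        field_simp
    _ ≤ K * (2 * k) ^ m * ((n : ℝ) ^ m)⁻¹ := by
        rw [mul_assoc]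
        gcongr
        rw [inv_le_iff_one_le_mul₀ (by positivity), ← inv_pow, mul_assoc, ← mul_pow, ← mul_pow]
        refine one_le_pow₀ ?_
        rw [← mul_assoc, mul_right_comm, ← div_eq_mul_inv, le_div_iff₀ hn0]
        linarith

lemma memLp_kappaK {k : ℕ} {r : (Fin k → 𝒳) → H}
    (hr : ∀ p : ℕ, MemLp r p (Measure.pi fun _ => P)) (p : ℕ) :
    MemLp (kappaK r) p (Measure.pi fun _ => P) := by
  refine memLp_of_integrable_norm_pow ((hr 0).1.inner (hr 0).1) (fun p _ => ?_) p
  refine (hr (2 * p)).integrable_norm_pow'.congr (ae_of_all _ fun x => ?_)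
  simp only [kappaK, real_inner_self_eq_norm_sq, norm_pow, norm_norm, pow_mul]

lemma memLp_kappa2K {k : ℕ} {r : (Fin k → 𝒳) → H}
    (hr : ∀ p : ℕ, MemLp r p (Measure.pi fun _ => P)) (p : ℕ) :
    MemLp (kappa2K r) p (Measure.pi fun _ => P) := by
  have h1 := fun p => memLp_embedding (hr p) (Fin.castAddEmb k)
  have h2 := fun p => memLp_embedding (hr p) (Fin.natAddEmb (m := k) k)
  refine memLp_of_integrable_norm_pow ((h1 0).1.inner (h2 0).1) (fun p _ => ?_) p
  refine ((h1 (2 * p)).integrable_norm_pow'.add (h2 (2 * p)).integrable_norm_pow').mono'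
    (((h1 0).1.inner (h2 0).1).norm.pow _) (ae_of_all _ fun x => ?_)
  have h3 := norm_inner_le_norm (𝕜 := ℝ) (r fun j => x (Fin.castAdd k j))
    (r fun j => x (Fin.natAdd k j))
  rw [norm_pow, norm_norm]
  refine (pow_le_pow_left₀ (norm_nonneg _) h3 p).trans ?_
  simp only [Pi.add_apply, Fin.castAddEmb_apply, Fin.natAddEmb_apply, mul_pow,
    mul_comm 2 p, pow_mul]
  nlinarith [sq_nonneg (‖r fun j => x (Fin.castAdd k j)‖ ^ p - ‖r fun j => x (Fin.natAdd k j)‖ ^ p),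
    sq_nonneg (‖r fun j => x (Fin.castAdd k j)‖ ^ p), sq_nonneg (‖r fun j => x (Fin.natAdd k j)‖ ^ p)]

lemma memLp_varStat {k : ℕ} {r : (Fin k → 𝒳) → H}
    (hr : ∀ p : ℕ, MemLp r p (Measure.pi fun _ => P)) (n p : ℕ) :
    MemLp (varStat r n) p (Measure.pi fun _ => P) :=
  (memLp_uStat n (memLp_kappaK hr p)).sub (memLp_uStat n (memLp_kappa2K hr p))

/-- The cross term is dominated by the diagonal one, so the statistic is at most 2 U_k(κ_k). By
Jensen, the p-th power of U_k(κ_k) is at most U_k(κ_k^p), whose mean does not depend on n. -/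
lemma exists_integral_varStat_pow_le {k : ℕ} {r : (Fin k → 𝒳) → H}
    (hr : ∀ p : ℕ, MemLp r p (Measure.pi fun _ => P)) (p : ℕ) :
    ∃ A : ℝ, 0 ≤ A ∧ ∀ n : ℕ, k + k ≤ n →
      ∫ x, varStat r n x ^ p ∂(Measure.pi fun _ => P) ≤ A := by
  refine ⟨2 ^ p * ∫ y, kappaK r y ^ p ∂(Measure.pi fun _ => P),
    mul_nonneg (by positivity) (integral_nonneg fun y => pow_nonneg (kappaK_nonneg r y) p),
    fun n hn => ?_⟩
  have hkn : k ≤ n := by omega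
  have hpow : ∀ {m : ℕ} {g : (Fin m → 𝒳) → ℝ}, (∀ y, 0 ≤ g y) →
      MemLp g p (Measure.pi fun _ => P) →
      Integrable (fun y => g y ^ p) (Measure.pi fun _ => P) := fun h0 hg =>
    hg.integrable_norm_pow'.congr (ae_of_all _ fun y => by
      dsimp only
      rw [Real.norm_of_nonneg (h0 y)])
  have i1 := hpow (kappaK_nonneg r) (memLp_kappaK hr p)
  have i2 : Integrable (uStat k n fun y => kappaK r y ^ p) (Measure.pi fun _ => P) :=
    memLp_one_iff_integrable.1 (memLp_uStat n (memLp_one_iff_integrable.2 i1))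
  rw [← integral_uStat hkn i1, ← integral_const_mul]
  refine integral_mono (hpow (varStat_nonneg hn r) (memLp_varStat hr n p)) (i2.const_mul _)
    fun x => ?_
  have h1 : varStat r n x ≤ 2 * uStat k n (kappaK r) x := by
    have := neg_abs_le (uStat (k + k) n (kappa2K r) x)
    have := abs_uStat_kappa2K_le hn r x
    unfold varStat
    linarith
  refine (pow_le_pow_left₀ (varStat_nonneg hn r x) h1 p).trans ?_
  rw [mul_pow]
  refine mul_le_mul_of_nonneg_left ?_ (by positivity)
  have h2 := norm_avg_pow_le (c := (n.descFactorial k : ℝ)) (by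
    rw [Fintype.card_embedding_eq, Fintype.card_fin, Fintype.card_fin])
    (descFactorial_cast_ne_zero hkn) (fun i : Fin k ↪ Fin n => kappaK r fun a => x (i a)) p
  have h3 : ‖uStat k n (kappaK r) x‖ ^ p ≤ _ := h2
  rw [Real.norm_of_nonneg (uStat_nonneg (kappaK_nonneg r) x)] at h3
  refine h3.trans (le_of_eq ?_)
  unfold uStat
  rw [smul_eq_mul]
  congr 1
  refine Finset.sum_congr rfl fun i _ => ?_
  rw [Real.norm_of_nonneg (kappaK_nonneg r _)]

/-- The covariance of the variance estimator and the U-statistic is of the order of the first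
nonzero canonical function. -/
lemma exists_abs_integral_varStat_mul_inner_le [CompleteSpace H] {c k : ℕ} (hk : 0 < k)
    (hck : c ≤ k) {r q : (Fin k → 𝒳) → H}
    (hr : ∀ p : ℕ, MemLp r p (Measure.pi fun _ => P)) (hqs : IsSymmetric q)
    (hq : MemLp q 2 (Measure.pi fun _ => P))
    (hc : ∀ l < c, ∀ᵐ x ∂(Measure.pi fun _ : Fin l => P), canonical P q l x = 0) (d : H) :
    ∃ K : ℝ, 0 ≤ K ∧ ∀ n : ℕ, k + k ≤ n →
      |∫ x, varStat r n x * inner ℝ (uStat k n q x) d ∂(Measure.pi fun _ => P)|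
        ≤ K * ((n : ℝ) ^ c)⁻¹ := by
  set Q := ∫ y, ‖q y‖ ^ 2 ∂(Measure.pi fun _ => P) with hQ
  have hQ0 : 0 ≤ Q := integral_nonneg fun _ => by positivity
  have hB0 : ∀ {m : ℕ} (G : (Fin m → 𝒳) → H), 0 ≤ ∫ y, ‖G y‖ ^ 2 ∂(Measure.pi fun _ => P) :=
    fun G => integral_nonneg fun _ => by positivity
  have key : ∀ {m : ℕ} {g : (Fin m → 𝒳) → ℝ}, m ≤ k + k → MemLp g 2 (Measure.pi fun _ => P) →
      ∃ K : ℝ, 0 ≤ K ∧ ∀ n : ℕ, k + k ≤ n →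
      Integrable (fun x => uStat m n g x * inner ℝ (uStat k n q x) d) (Measure.pi fun _ => P) ∧
      |∫ x, uStat m n g x * inner ℝ (uStat k n q x) d ∂(Measure.pi fun _ => P)|
        ≤ K * ((n : ℝ) ^ c)⁻¹ := by
    intro m g hm hg
    -- Multiplying the scalar kernel by d turns the product of U_m(g) with ⟨U_k(q), d⟩ into an inner
    -- product of two H-valued U-statistics.
    have hG : MemLp (fun y => g y • d) 2 (Measure.pi fun _ => P) := by
      refine (hg.norm.mul_const ‖d‖).of_le (hg.1.smul_const d) (ae_of_all _ fun y => ?_)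
      rw [norm_smul, norm_mul, norm_norm, norm_norm]
    refine ⟨(k.descFactorial c * m ^ c : ℕ) * 2 ^ c *
      (∫ y, ‖g y • d‖ ^ 2 ∂(Measure.pi fun _ => P) + Q),
      mul_nonneg (by positivity) (add_nonneg (hB0 _) hQ0), fun n hn => ?_⟩
    have h1 := abs_integral_inner_uStat_le (n := n) (by omega) (by omega) hqs hG hq hc
    have h2 : ∀ x : Fin n → 𝒳, (inner ℝ (uStat m n (fun y => g y • d) x) (uStat k n q x) : ℝ)
        = uStat m n g x * inner ℝ (uStat k n q x) d := fun x => by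
      rw [uStat_smul_const, real_inner_smul_left, real_inner_comm]
    have h3 := memLp_two_integrable_inner (memLp_uStat n hG) (memLp_uStat n hq)
    simp_rw [h2] at h1 h3
    refine ⟨h3, h1.trans ?_⟩
    have h4 := inv_descFactorial_le (c := c) (n := n) (by omega) (by omega)
    calc _ ≤ ((k.descFactorial c * m ^ c : ℕ) : ℝ) * (2 ^ c * ((n : ℝ) ^ c)⁻¹) *
        (∫ y, ‖g y • d‖ ^ 2 ∂(Measure.pi fun _ => P) + Q) := by
          have := add_nonneg (hB0 fun y => g y • d) hQ0
          gcongr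
      _ = _ := by ring
  obtain ⟨K₁, hK₁, h₁⟩ := key (by omega) (memLp_kappaK hr 2)
  obtain ⟨K₂, hK₂, h₂⟩ := key le_rfl (memLp_kappa2K hr 2)
  refine ⟨K₁ + K₂, by positivity, fun n hn => ?_⟩
  unfold varStat
  simp_rw [sub_mul]
  rw [integral_sub (h₁ n hn).1 (h₂ n hn).1, add_mul]
  exact (abs_sub _ _).trans (add_le_add (h₁ n hn).2 (h₂ n hn).2)

lemma inv_choose_le {k n : ℕ} (hn : k + k ≤ n) :
    (n.choose k : ℝ)⁻¹ ≤ k.factorial * 2 ^ k * ((n : ℝ) ^ k)⁻¹ := by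
  rcases Nat.eq_zero_or_pos n with rfl | h0
  · obtain rfl : k = 0 := by omega
    simp
  have h1 := inv_descFactorial_le (c := k) (n := n) (by omega) h0
  have h2 : (n.choose k : ℝ)⁻¹ = k.factorial * (n.descFactorial k : ℝ)⁻¹ := by
    rw [Nat.descFactorial_eq_factorial_mul_choose, Nat.cast_mul, mul_inv, ← mul_assoc,
      mul_inv_cancel₀ (by exact_mod_cast k.factorial_ne_zero), one_mul]
  rw [h2, mul_assoc]
  gcongr

end UStatisticMoments

/-! ### Pointwise bounds on the shrinkage coefficient. -/

section Normed

variable {H : Type*} [NormedAddCommGroup H]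

/-- This includes the case δ = w = 0, where the quotient is 0 by convention. -/
lemma shrinkCoeff_mem_Icc {δ w : ℝ} (hδ : 0 ≤ δ) (hw : 0 ≤ w) : δ / (δ + w) ∈ Set.Icc (0 : ℝ) 1 :=
  ⟨by positivity, div_le_one_of_le₀ (by linarith) (by positivity)⟩

lemma shrinkCoeff_le_of_norm_le {δ : ℝ} (hδ : 0 ≤ δ) {z d : H} (hd : d ≠ 0)
    (hz : ‖z‖ ≤ ‖d‖ / 2) : ‖d‖ ^ 2 / 4 ≤ ‖z - d‖ ^ 2 ∧ δ / (δ + ‖z - d‖ ^ 2) ≤ 4 / ‖d‖ ^ 2 * δ := by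
  have hD : 0 < ‖d‖ := norm_pos_iff.2 hd
  have h1 : ‖d‖ / 2 ≤ ‖z - d‖ := by
    have := norm_sub_norm_le d z
    rw [norm_sub_rev] at this
    linarith
  have h2 : ‖d‖ ^ 2 / 4 ≤ ‖z - d‖ ^ 2 := by
    have := pow_le_pow_left₀ (by positivity) h1 2
    linarith [this, (by ring : (‖d‖ / 2) ^ 2 = ‖d‖ ^ 2 / 4)]
  refine ⟨h2, ?_⟩
  calc δ / (δ + ‖z - d‖ ^ 2) ≤ δ / (‖d‖ ^ 2 / 4) := by
        gcongr
        linarith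
    _ = _ := by field_simp

/-- For ‖z‖ ≤ ‖d‖/2 the denominator is at least ‖d‖²/4. Otherwise the coefficient is at most 1,
hence at most (2‖z‖/‖d‖)^p, so that high moments of z control this case. -/
lemma shrinkCoeff_le {δ : ℝ} (hδ : 0 ≤ δ) (z : H) {d : H} (hd : d ≠ 0) (p : ℕ) :
    δ / (δ + ‖z - d‖ ^ 2) ≤ 4 / ‖d‖ ^ 2 * δ + (2 / ‖d‖) ^ p * ‖z‖ ^ p := by
  have hD : 0 < ‖d‖ := norm_pos_iff.2 hd
  rcases le_total ‖z‖ (‖d‖ / 2) with hz | hz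
  · have := (shrinkCoeff_le_of_norm_le hδ hd hz).2
    have : 0 ≤ (2 / ‖d‖) ^ p * ‖z‖ ^ p := by positivity
    linarith
  · have h1 : 1 ≤ (2 / ‖d‖) ^ p * ‖z‖ ^ p := by
      rw [← mul_pow]
      refine one_le_pow₀ ?_
      rw [div_mul_eq_mul_div, le_div_iff₀ hD]
      linarith
    have := (shrinkCoeff_mem_Icc hδ (sq_nonneg ‖z - d‖)).2
    have : 0 ≤ 4 / ‖d‖ ^ 2 * δ := by positivity
    linarith

end Normed

/-! ### Pointwise expansion of the shrunken squared error. -/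

section Pointwise

variable {H : Type*} [NormedAddCommGroup H] [InnerProductSpace ℝ H]

lemma norm_sq_convex_comb (a : ℝ) (z d : H) : ‖(1 - a) • z + a • d‖ ^ 2
    = (1 - a) ^ 2 * ‖z‖ ^ 2 + 2 * (a * (1 - a)) * inner ℝ z d + a ^ 2 * ‖d‖ ^ 2 := by
  rw [norm_add_sq_real, norm_smul, norm_smul, real_inner_smul_left, real_inner_smul_right, mul_pow,
    mul_pow, Real.norm_eq_abs, Real.norm_eq_abs, sq_abs, sq_abs]
  ring

/-- The difference carries a factor a, so its mean is controlled by that of a(1 + ‖z‖²). -/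
lemma abs_norm_sq_convex_comb_sub_le {a : ℝ} (ha : a ∈ Set.Icc (0 : ℝ) 1) (z d : H) :
    |‖(1 - a) • z + a • d‖ ^ 2 - ‖z‖ ^ 2| ≤ (3 + 2 * ‖d‖ ^ 2) * (a * (1 + ‖z‖ ^ 2)) := by
  obtain ⟨h0, h1⟩ := ha
  have hi := abs_le.1 (abs_real_inner_le_norm z d)
  have hz := norm_nonneg z
  have hd := norm_nonneg d
  set i : ℝ := inner ℝ z d with hi'
  set x := ‖z‖
  set D := ‖d‖
  have e : ‖(1 - a) • z + a • d‖ ^ 2 - x ^ 2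
      = a * (-(2 - a) * x ^ 2 + 2 * (1 - a) * i + a * D ^ 2) := by
    rw [norm_sq_convex_comb]; ring
  rw [e, abs_mul, abs_of_nonneg h0, mul_left_comm]
  refine mul_le_mul_of_nonneg_left ?_ h0
  have hxD : 2 * (x * D) ≤ x ^ 2 + D ^ 2 := by nlinarith [sq_nonneg (x - D)]
  have hi2 : |2 * i| ≤ x ^ 2 + D ^ 2 := by
    rw [abs_le]; constructor <;> linarith
  have hi3 : |(1 - a) * (2 * i)| ≤ x ^ 2 + D ^ 2 := by
    rw [abs_mul, abs_of_nonneg (by linarith : 0 ≤ 1 - a)]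
    have := abs_nonneg (2 * i)
    nlinarith
  have hi4 := abs_le.1 hi3
  have h5 : 0 ≤ D ^ 2 * x ^ 2 := by positivity
  have h6 : a * D ^ 2 ≤ D ^ 2 := mul_le_of_le_one_left (sq_nonneg D) h1
  have h7 : 0 ≤ a * D ^ 2 := mul_nonneg h0 (sq_nonneg D)
  have h8 : 0 ≤ a * x ^ 2 := mul_nonneg h0 (sq_nonneg x)
  have h9 : a * x ^ 2 ≤ x ^ 2 := mul_le_of_le_one_left (sq_nonneg x) h1
  rw [abs_le]
  constructor <;> nlinarith

lemma mul_add_mul_le_mul_add {a b c u v w : ℝ} (ha : 0 ≤ a) (hb : 0 ≤ b) (hc : 0 ≤ c) (hu : 0 ≤ u)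
    (hv : 0 ≤ v) (hw : 0 ≤ w) : a * u + b * v ≤ (a + b + c) * (u + v + w) := by
  have e : (a + b + c) * (u + v + w)
      = a * u + b * v + (a * (v + w) + b * (u + w) + c * (u + v + w)) := by ring
  rw [e]
  exact le_add_of_nonneg_right (by positivity)

/-- With coefficient a, the difference of squares is 2a⟨z, d⟩ up to terms of size a‖z‖² and a²; near
z = 0, a is δ/‖d‖² to first order. The explicit main term is what allows cancellation in the mean.
The power p is free, so that the contribution of large z can be made as small as needed. -/
lemma norm_sq_shrink_sub_ge {δ : ℝ} (hδ : 0 ≤ δ) (z : H) {d : H} (hd : d ≠ 0) (p : ℕ) :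
    2 / ‖d‖ ^ 2 * (δ * inner ℝ z d) -
      (28 / ‖d‖ ^ 2 + 40 / ‖d‖ ^ 3 + (2 / ‖d‖) ^ p + (2 / ‖d‖) ^ (p + 2)) *
        (δ * ‖z‖ ^ 2 + δ ^ 2 * (1 + ‖z‖ ^ 2) + (1 + δ) * ‖z‖ ^ (p + 2))
    ≤ ‖(1 - δ / (δ + ‖z - d‖ ^ 2)) • z + (δ / (δ + ‖z - d‖ ^ 2)) • d‖ ^ 2 - ‖z‖ ^ 2 := by
  have hD : 0 < ‖d‖ := norm_pos_iff.2 hd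
  have hi := abs_real_inner_le_norm z d
  have hi' := abs_le.1 hi
  have hz := norm_nonneg z
  have hcoef := shrinkCoeff_mem_Icc hδ (sq_nonneg ‖z - d‖)
  have hw : ‖z - d‖ ^ 2 = ‖z‖ ^ 2 - 2 * inner ℝ z d + ‖d‖ ^ 2 := norm_sub_sq_real z d
  set a := δ / (δ + ‖z - d‖ ^ 2) with ha
  obtain ⟨h0, h1⟩ := hcoef
  rcases le_total ‖z‖ (‖d‖ / 2) with hzd | hzd
  · obtain ⟨hw4, ha4⟩ := shrinkCoeff_le_of_norm_le hδ hd hzd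
    rw [← ha] at ha4
    -- The factor 4 comes from the denominator ‖z - d‖² ≥ ‖d‖²/4, and 5/2 from ‖z‖² + 2|⟨z, d⟩| ≤
    -- (1/2 + 2)‖d‖‖z‖.
    have hdiff : |a - δ / ‖d‖ ^ 2| ≤ 4 / ‖d‖ ^ 4 * (δ * (δ + 5 / 2 * ‖d‖ * ‖z‖)) := by
      have hw0 : 0 < δ + ‖z - d‖ ^ 2 := by
        have : 0 < ‖d‖ ^ 2 / 4 := by positivity
        linarith
      have e : a - δ / ‖d‖ ^ 2
          = δ * (‖d‖ ^ 2 - δ - ‖z - d‖ ^ 2) / (‖d‖ ^ 2 * (δ + ‖z - d‖ ^ 2)) := by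
        rw [ha, div_sub_div _ _ hw0.ne' (by positivity)]
        congr 1 <;> ring
      have hnum : |‖d‖ ^ 2 - δ - ‖z - d‖ ^ 2| ≤ δ + 5 / 2 * ‖d‖ * ‖z‖ := by
        rw [hw, abs_le]
        constructor <;> nlinarith
      rw [e, abs_div, abs_mul, abs_of_nonneg hδ, abs_of_nonneg (a := ‖d‖ ^ 2 * _) (by positivity)]
      calc _ ≤ δ * (δ + 5 / 2 * ‖d‖ * ‖z‖) / (‖d‖ ^ 2 * (‖d‖ ^ 2 / 4)) := by
            gcongr
            linarith
        _ = _ := by field_simp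
    rw [norm_sq_convex_comb]
    set i : ℝ := inner ℝ z d
    set x := ‖z‖
    set D := ‖d‖
    have t1 : a * x ^ 2 ≤ 4 / D ^ 2 * δ * x ^ 2 := by gcongr
    have t2 : δ / D ^ 2 * i - 4 / D ^ 4 * (δ * (δ + 5 / 2 * D * x)) * (x * D) ≤ a * i := by
      have h3 : |(a - δ / D ^ 2) * i| ≤ 4 / D ^ 4 * (δ * (δ + 5 / 2 * D * x)) * (x * D) := by
        rw [abs_mul]
        gcongr
      have := (abs_le.1 h3).1
      linarith
    have t3 : a ^ 2 * i ≤ (4 / D ^ 2 * δ) ^ 2 * (x * D) := by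
      calc a ^ 2 * i ≤ a ^ 2 * (x * D) := by
            gcongr
            exact hi'.2
        _ ≤ _ := by gcongr
    -- The nonnegative terms a²‖z‖² and a²‖d‖² are dropped.
    have t4 : (1 - a) ^ 2 * x ^ 2 + 2 * (a * (1 - a)) * i + a ^ 2 * D ^ 2 - x ^ 2
        ≥ -2 * (a * x ^ 2) + 2 * (a * i) - 2 * (a ^ 2 * i) := by
      nlinarith [mul_nonneg (sq_nonneg a) (sq_nonneg x), mul_nonneg (sq_nonneg a) (sq_nonneg D)]
    have e1 : 4 / D ^ 4 * (δ * (δ + 5 / 2 * D * x)) * (x * D)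
        = 4 / D ^ 3 * (δ ^ 2 * x) + 10 / D ^ 2 * (δ * x ^ 2) := by
      field_simp
      ring
    have e2 : (4 / D ^ 2 * δ) ^ 2 * (x * D) = 16 / D ^ 3 * (δ ^ 2 * x) := by
      field_simp
      ring
    have hx1 : δ ^ 2 * x ≤ δ ^ 2 * (1 + x ^ 2) := by
      gcongr
      nlinarith [sq_nonneg (x - 1)]
    have c1 : 0 ≤ 28 / D ^ 2 := by positivity
    have c2 : 0 ≤ 40 / D ^ 3 := by positivity
    have c3 : 0 ≤ (2 / D) ^ p + (2 / D) ^ (p + 2) := by positivity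
    have s1 : 0 ≤ δ * x ^ 2 := by positivity
    have s2 : 0 ≤ δ ^ 2 * (1 + x ^ 2) := by positivity
    have s3 : 0 ≤ (1 + δ) * x ^ (p + 2) := by positivity
    -- The errors doubled in `t4` add up to 28 = 2·4 + 2·10 and 40 = 2·4 + 2·16.
    have key : 28 / D ^ 2 * (δ * x ^ 2) + 40 / D ^ 3 * (δ ^ 2 * x)
        ≤ (28 / D ^ 2 + 40 / D ^ 3 + (2 / D) ^ p + (2 / D) ^ (p + 2)) *
          (δ * x ^ 2 + δ ^ 2 * (1 + x ^ 2) + (1 + δ) * x ^ (p + 2)) := by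
      have b1 := mul_le_mul_of_nonneg_left hx1 c2
      rw [add_assoc (28 / D ^ 2 + 40 / D ^ 3)]
      exact (add_le_add_right b1 _).trans (mul_add_mul_le_mul_add c1 c2 c3 s1 s2 s3)
    have e3 : 2 / D ^ 2 * (δ * i) = 2 * (δ / D ^ 2 * i) := by ring
    have e4 : 28 / D ^ 2 * (δ * x ^ 2) = 2 * (4 / D ^ 2 * δ * x ^ 2) + 2 * (10 / D ^ 2 * (δ * x ^ 2)) := by
      ring
    have e5 : 40 / D ^ 3 * (δ ^ 2 * x)
        = 2 * (4 / D ^ 3 * (δ ^ 2 * x)) + 2 * (16 / D ^ 3 * (δ ^ 2 * x)) := by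
      ring
    rw [e1] at t2
    rw [e2] at t3
    linarith
  -- For large z the new squared norm is only bounded below by 0, and ‖z‖² and the main term are
  -- absorbed using 2‖z‖/‖d‖ ≥ 1.
  · set i : ℝ := inner ℝ z d
    set x := ‖z‖
    set D := ‖d‖
    have hx1 : 1 ≤ 2 / D * x := by
      rw [div_mul_eq_mul_div, le_div_iff₀ hD]
      linarith
    have b1 : x ^ 2 ≤ (2 / D) ^ p * x ^ (p + 2) := by
      have := one_le_pow₀ hx1 (n := p)
      rw [mul_pow] at this
      rw [pow_add, ← mul_assoc]
      exact le_mul_of_one_le_left (sq_nonneg x) this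
    have b2 : 2 / D * x ≤ (2 / D) ^ (p + 2) * x ^ (p + 2) := by
      rw [← mul_pow]
      exact le_self_pow₀ hx1 (by omega)
    have b3 : 2 / D ^ 2 * (δ * i) ≤ δ * (2 / D * x) := by
      calc 2 / D ^ 2 * (δ * i) ≤ 2 / D ^ 2 * (δ * (x * D)) := by
            gcongr
            exact hi'.2
        _ = _ := by field_simp
    have b4 := mul_le_mul_of_nonneg_left b2 hδ
    have s5 : 0 ≤ δ * x ^ (p + 2) := by positivity
    have b5 := mul_add_mul_le_mul_add (a := (2 / D) ^ p) (b := (2 / D) ^ (p + 2))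
      (c := 28 / D ^ 2 + 40 / D ^ 3) (u := x ^ (p + 2)) (v := δ * x ^ (p + 2))
      (w := δ * x ^ 2 + δ ^ 2 * (1 + x ^ 2)) (by positivity) (by positivity) (by positivity)
      (by positivity) (by positivity) (by positivity)
    have e : (28 / D ^ 2 + 40 / D ^ 3 + (2 / D) ^ p + (2 / D) ^ (p + 2)) *
        (δ * x ^ 2 + δ ^ 2 * (1 + x ^ 2) + (1 + δ) * x ^ (p + 2))
        = ((2 / D) ^ p + (2 / D) ^ (p + 2) + (28 / D ^ 2 + 40 / D ^ 3)) *
          (x ^ (p + 2) + δ * x ^ (p + 2) + (δ * x ^ 2 + δ ^ 2 * (1 + x ^ 2))) := by ring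
    rw [e]
    have b6 := sq_nonneg ‖(1 - a) • z + a • d‖
    have e2 : δ * ((2 / D) ^ (p + 2) * x ^ (p + 2)) = (2 / D) ^ (p + 2) * (δ * x ^ (p + 2)) := by
      ring
    rw [e2] at b4
    linarith

/-- Truncation at level s: beyond it, t ≤ t (t/s)^p. -/
lemma le_add_inv_pow_mul_pow {t s : ℝ} (ht : 0 ≤ t) (hs : 0 < s) (p : ℕ) :
    t ≤ s + (s ^ p)⁻¹ * t ^ (p + 1) := by
  rcases le_total t s with h | h
  · have : 0 ≤ (s ^ p)⁻¹ * t ^ (p + 1) := by positivity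
    linarith
  · have h1 : s ^ p ≤ t ^ p := pow_le_pow_left₀ hs.le h p
    have h2 : t ≤ (s ^ p)⁻¹ * t ^ (p + 1) := by
      rw [inv_mul_eq_div, le_div_iff₀ (by positivity), pow_succ, mul_comm t]
      gcongr
    linarith

end Pointwise

/-- Markov's inequality, applied to an integrable majorant V of |Y|. -/
lemma isBigOP_of_integral_le {Ω : Type*} [MeasurableSpace Ω] {μ : Measure Ω}
    [IsFiniteMeasure μ] {Y V : ℕ → Ω → ℝ} {a : ℕ → ℝ} {K : ℝ} {n₀ : ℕ}
    (ha : ∀ n ≥ n₀, 0 < a n) (hY : ∀ n ≥ n₀, ∀ ω, |Y n ω| ≤ V n ω)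
    (hV : ∀ n ≥ n₀, Integrable (V n) μ) (hK : ∀ n ≥ n₀, ∫ ω, V n ω ∂μ ≤ K * a n) :
    IsBigOP μ Y a := by
  intro ε hε
  refine ⟨(|K| + 1) / ε, by positivity, n₀, fun n hn => ?_⟩
  have han := ha n hn
  have hM : 0 < (|K| + 1) / ε * a n := by positivity
  have h1 := mul_meas_ge_le_integral_of_nonneg (μ := μ)
    (ae_of_all μ fun ω => (abs_nonneg _).trans (hY n hn ω)) (hV n hn) ((|K| + 1) / ε * a n)
  have h2 : μ.real {ω | (|K| + 1) / ε * a n ≤ V n ω} ≤ ε := by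
    have h3 : (|K| + 1) / ε * a n * μ.real {ω | (|K| + 1) / ε * a n ≤ V n ω}
        ≤ (|K| + 1) / ε * a n * ε := by
      refine h1.trans ((hK n hn).trans ?_)
      have : (|K| + 1) / ε * a n * ε = (|K| + 1) * a n := by field_simp
      rw [this]
      gcongr
      linarith [le_abs_self K]
    exact le_of_mul_le_mul_left h3 hM
  calc μ {ω | (|K| + 1) / ε * a n < |Y n ω|}
      ≤ μ {ω | (|K| + 1) / ε * a n ≤ V n ω} :=
        measure_mono fun ω hω => le_of_lt (lt_of_lt_of_le hω (hY n hn ω))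
    _ = ENNReal.ofReal (μ.real {ω | (|K| + 1) / ε * a n ≤ V n ω}) :=
        (ofReal_measureReal (by finiteness)).symm
    _ ≤ ENNReal.ofReal ε := ENNReal.ofReal_le_ofReal h2

/-! ### Rates of convergence deduced from moment bounds alone. -/

section Asymptotics

variable {Ω : Type*} [MeasurableSpace Ω] {μ : Measure Ω}
  {H : Type*} [NormedAddCommGroup H]

/-- Moment bounds for an estimation error `Z n`, an unnormalized risk estimator `T n ≥ 0` and
normalizing constants `β n = O(n ^ (-k))`. -/
structure MomentBounds (μ : Measure Ω) (n₀ k : ℕ) (Z : ℕ → Ω → H) (T : ℕ → Ω → ℝ) (β : ℕ → ℝ) :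
    Prop where
  one_le : 1 ≤ n₀
  memLp_error : ∀ n p : ℕ, MemLp (Z n) p μ
  memLp_stat : ∀ n p : ℕ, MemLp (T n) p μ
  stat_nonneg : ∀ n ≥ n₀, ∀ ω, 0 ≤ T n ω
  integral_error_le : ∀ m : ℕ, ∃ K : ℝ, 0 ≤ K ∧ ∀ n ≥ n₀,
    ∫ ω, ‖Z n ω‖ ^ (2 * m) ∂μ ≤ K * ((n : ℝ) ^ m)⁻¹
  integral_stat_le : ∀ p : ℕ, ∃ A : ℝ, 0 ≤ A ∧ ∀ n ≥ n₀, ∫ ω, T n ω ^ p ∂μ ≤ A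
  norm_const_nonneg : ∀ n, 0 ≤ β n
  norm_const_le : ∃ b : ℝ, 0 ≤ b ∧ ∀ n ≥ n₀, β n ≤ b * ((n : ℝ) ^ k)⁻¹

/-- The random shrinkage coefficient. -/
noncomputable def randCoeff (Z : ℕ → Ω → H) (T : ℕ → Ω → ℝ) (β : ℕ → ℝ) (d : H) (n : ℕ) (ω : Ω) : ℝ :=
  β n * T n ω / (β n * T n ω + ‖Z n ω - d‖ ^ 2)

/-- The error of the shrunken estimator. -/
noncomputable def shrunkError [NormedSpace ℝ H] (Z : ℕ → Ω → H) (T : ℕ → Ω → ℝ) (β : ℕ → ℝ) (d : H) (n : ℕ) (ω : Ω) : H :=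
  (1 - randCoeff Z T β d n ω) • Z n ω + randCoeff Z T β d n ω • d

lemma oracle_le {Δ D : ℝ} (hΔ : 0 ≤ Δ) (hD : 0 < D) :
    0 ≤ Δ / (Δ + D ^ 2) ∧ Δ / (Δ + D ^ 2) ≤ (D ^ 2)⁻¹ * Δ := by
  refine ⟨by positivity, ?_⟩
  rw [inv_mul_eq_div]
  gcongr
  linarith

namespace MomentBounds

variable {n₀ k : ℕ} {Z : ℕ → Ω → H} {T : ℕ → Ω → ℝ} {β : ℕ → ℝ}

lemma cast_pos (h : MomentBounds μ n₀ k Z T β) {n : ℕ} (hn : n₀ ≤ n) : (0 : ℝ) < n := by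
  exact_mod_cast h.one_le.trans hn

lemma one_le_cast (h : MomentBounds μ n₀ k Z T β) {n : ℕ} (hn : n₀ ≤ n) : (1 : ℝ) ≤ n := by
  exact_mod_cast h.one_le.trans hn

lemma randCoeff_mem_Icc (h : MomentBounds μ n₀ k Z T β) (d : H) {n : ℕ} (hn : n₀ ≤ n) (ω : Ω) :
    randCoeff Z T β d n ω ∈ Set.Icc (0 : ℝ) 1 :=
  shrinkCoeff_mem_Icc (mul_nonneg (h.norm_const_nonneg n) (h.stat_nonneg n hn ω)) (sq_nonneg _)

lemma exists_integral_norm_sq_le (h : MomentBounds μ n₀ k Z T β) :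
    ∃ K : ℝ, 0 ≤ K ∧ ∀ n ≥ n₀, ∫ ω, ‖Z n ω‖ ^ 2 ∂μ ≤ K * (n : ℝ)⁻¹ := by
  simpa using h.integral_error_le 1

lemma aestronglyMeasurable_randCoeff (h : MomentBounds μ n₀ k Z T β) (d : H) (n : ℕ) :
    AEStronglyMeasurable (randCoeff Z T β d n) μ := by
  have h1 := ((h.memLp_stat n 0).1.const_mul (β n)).aemeasurable
  have h2 := (((h.memLp_error n 0).1.sub (aestronglyMeasurable_const (b := d))).norm.pow 2).aemeasurable
  exact (h1.div (h1.add h2)).aestronglyMeasurable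

variable [IsProbabilityMeasure μ]

lemma integrable_norm_sq_error (h : MomentBounds μ n₀ k Z T β) (n : ℕ) :
    Integrable (fun ω => ‖Z n ω‖ ^ 2) μ := (h.memLp_error n 2).integrable_norm_pow'

/-- Weighted arithmetic-geometric mean inequality: T^i ‖Z‖^{2j} ≤ n^{-j} T^{2i} + n^j ‖Z‖^{4j}, both
terms having mean O(n^{-j}). -/
lemma exists_integral_mul_le (h : MomentBounds μ n₀ k Z T β) (i j : ℕ) :
    ∃ K : ℝ, 0 ≤ K ∧ ∀ n ≥ n₀, Integrable (fun ω => T n ω ^ i * ‖Z n ω‖ ^ (2 * j)) μ ∧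
      ∫ ω, T n ω ^ i * ‖Z n ω‖ ^ (2 * j) ∂μ ≤ K * ((n : ℝ) ^ j)⁻¹ := by
  obtain ⟨K, hK, hZ⟩ := h.integral_error_le (2 * j)
  obtain ⟨A, hA, hT⟩ := h.integral_stat_le (2 * i)
  refine ⟨A + K, by positivity, fun n hn => ?_⟩
  have hn0 := h.cast_pos hn
  have iT : Integrable (fun ω => T n ω ^ (2 * i)) μ :=
    (h.memLp_stat n (2 * i)).integrable_norm_pow'.congr (ae_of_all _ fun ω => by
      dsimp only
      rw [Real.norm_of_nonneg (h.stat_nonneg n hn ω)])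
  have iZ := (h.memLp_error n (2 * (2 * j))).integrable_norm_pow'
  have hpt : ∀ ω, T n ω ^ i * ‖Z n ω‖ ^ (2 * j)
      ≤ ((n : ℝ) ^ j)⁻¹ * T n ω ^ (2 * i) + (n : ℝ) ^ j * ‖Z n ω‖ ^ (2 * (2 * j)) := by
    intro ω
    have hu : 0 < (n : ℝ) ^ j := by positivity
    set u := (n : ℝ) ^ j
    have e1 : T n ω ^ (2 * i) = (T n ω ^ i) ^ 2 := by rw [← pow_mul, mul_comm]
    have e2 : ‖Z n ω‖ ^ (2 * (2 * j)) = (‖Z n ω‖ ^ (2 * j)) ^ 2 := by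
      rw [← pow_mul, mul_comm 2 (2 * j)]
    rw [e1, e2]
    set t := T n ω ^ i
    set z := ‖Z n ω‖ ^ (2 * j)
    have h1 : u⁻¹ * t ^ 2 + u * z ^ 2 - t * z = u⁻¹ * ((t - u * z / 2) ^ 2 + 3 / 4 * (u * z) ^ 2) := by
      field_simp
      ring
    have h2 : 0 ≤ u⁻¹ * ((t - u * z / 2) ^ 2 + 3 / 4 * (u * z) ^ 2) := by positivity
    linarith
  have hint : Integrable (fun ω => T n ω ^ i * ‖Z n ω‖ ^ (2 * j)) μ := by
    refine ((iT.const_mul (((n : ℝ) ^ j)⁻¹)).add (iZ.const_mul ((n : ℝ) ^ j))).mono'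
      (((h.memLp_stat n 0).1.pow i).mul ((h.memLp_error n 0).1.norm.pow _)) (ae_of_all _ fun ω => ?_)
    have := h.stat_nonneg n hn ω
    rw [Real.norm_of_nonneg (by positivity)]
    exact hpt ω
  refine ⟨hint, ?_⟩
  calc _ ≤ ∫ ω, (((n : ℝ) ^ j)⁻¹ * T n ω ^ (2 * i) + (n : ℝ) ^ j * ‖Z n ω‖ ^ (2 * (2 * j))) ∂μ :=
        integral_mono hint ((iT.const_mul _).add (iZ.const_mul _)) hpt
    _ = ((n : ℝ) ^ j)⁻¹ * ∫ ω, T n ω ^ (2 * i) ∂μ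
        + (n : ℝ) ^ j * ∫ ω, ‖Z n ω‖ ^ (2 * (2 * j)) ∂μ := by
        rw [integral_add (iT.const_mul _) (iZ.const_mul _), integral_const_mul, integral_const_mul]
    _ ≤ ((n : ℝ) ^ j)⁻¹ * A + (n : ℝ) ^ j * (K * ((n : ℝ) ^ (2 * j))⁻¹) := by
        gcongr
        · exact hT n hn
        · exact hZ n hn
    _ = (A + K) * ((n : ℝ) ^ j)⁻¹ := by
        rw [mul_comm 2 j, pow_mul]
        field_simp

/-- The rate behind all upper bounds. The part of the coefficient proportional to β is O(n^{-k})
with k ≥ 2, and the part due to large Z is controlled by moments of Z. -/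
lemma exists_integral_randCoeff_le (h : MomentBounds μ n₀ k Z T β) (hk : 2 ≤ k) {d : H}
    (hd : d ≠ 0) : ∃ K : ℝ, 0 ≤ K ∧ ∀ n ≥ n₀,
      Integrable (fun ω => randCoeff Z T β d n ω * (1 + ‖Z n ω‖ ^ 2)) μ ∧
      ∫ ω, randCoeff Z T β d n ω * (1 + ‖Z n ω‖ ^ 2) ∂μ ≤ K * ((n : ℝ) ^ 2)⁻¹ := by
  obtain ⟨b, hb, hβ⟩ := h.norm_const_le
  obtain ⟨K₁, hK₁, h₁⟩ := h.exists_integral_mul_le 1 0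
  obtain ⟨K₂, hK₂, h₂⟩ := h.exists_integral_mul_le 1 1
  obtain ⟨K₃, hK₃, h₃⟩ := h.exists_integral_mul_le 0 2
  obtain ⟨K₄, hK₄, h₄⟩ := h.exists_integral_mul_le 0 3
  set c₁ := 4 / ‖d‖ ^ 2 with hc₁
  set c₂ := (2 / ‖d‖) ^ 4 with hc₂
  have hc₁0 : 0 ≤ c₁ := by positivity
  have hc₂0 : 0 ≤ c₂ := by positivity
  refine ⟨c₁ * b * (K₁ + K₂) + c₂ * (K₃ + K₄), by positivity, fun n hn => ?_⟩
  have hn0 := h.cast_pos hn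
  have hn1 := h.one_le_cast hn
  obtain ⟨i₁, b₁⟩ := h₁ n hn
  obtain ⟨i₂, b₂⟩ := h₂ n hn
  obtain ⟨i₃, b₃⟩ := h₃ n hn
  obtain ⟨i₄, b₄⟩ := h₄ n hn
  have hβ0 := h.norm_const_nonneg n
  have hpt : ∀ ω, randCoeff Z T β d n ω * (1 + ‖Z n ω‖ ^ 2) ≤
      (c₁ * β n) * (T n ω ^ 1 * ‖Z n ω‖ ^ (2 * 0) + T n ω ^ 1 * ‖Z n ω‖ ^ (2 * 1))
        + c₂ * (T n ω ^ 0 * ‖Z n ω‖ ^ (2 * 2) + T n ω ^ 0 * ‖Z n ω‖ ^ (2 * 3)) := by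
    intro ω
    -- The exponent 4 is chosen because E‖Z‖⁴ = O(n^{-2}).
    have h5 := shrinkCoeff_le (mul_nonneg hβ0 (h.stat_nonneg n hn ω)) (Z n ω) hd 4
    have h6 := mul_le_mul_of_nonneg_right h5 (by positivity : 0 ≤ 1 + ‖Z n ω‖ ^ 2)
    refine h6.trans (le_of_eq ?_)
    ring
  have i₁₂ := (i₁.add i₂).const_mul (c₁ * β n)
  have i₃₄ := (i₃.add i₄).const_mul c₂
  have hint : Integrable (fun ω => randCoeff Z T β d n ω * (1 + ‖Z n ω‖ ^ 2)) μ := by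
    refine (i₁₂.add i₃₄).mono' ((h.aestronglyMeasurable_randCoeff d n).mul
      (aestronglyMeasurable_const.add ((h.memLp_error n 0).1.norm.pow 2))) (ae_of_all _ fun ω => ?_)
    rw [Real.norm_of_nonneg (mul_nonneg (h.randCoeff_mem_Icc d hn ω).1 (by positivity))]
    exact hpt ω
  refine ⟨hint, (integral_mono hint (i₁₂.add i₃₄) hpt).trans ?_⟩
  have hk2 : ((n : ℝ) ^ k)⁻¹ ≤ ((n : ℝ) ^ 2)⁻¹ :=
    inv_anti₀ (by positivity) (pow_le_pow_right₀ hn1 hk)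
  have hle : ∀ j, ((n : ℝ) ^ j)⁻¹ ≤ 1 := fun j => inv_le_one_of_one_le₀ (one_le_pow₀ hn1)
  have h32 : ((n : ℝ) ^ 3)⁻¹ ≤ ((n : ℝ) ^ 2)⁻¹ :=
    inv_anti₀ (by positivity) (pow_le_pow_right₀ hn1 (by norm_num))
  have hβn := (hβ n hn).trans (mul_le_mul_of_nonneg_left hk2 hb)
  have e : ∫ ω, ((c₁ * β n) * (T n ω ^ 1 * ‖Z n ω‖ ^ (2 * 0) + T n ω ^ 1 * ‖Z n ω‖ ^ (2 * 1))
        + c₂ * (T n ω ^ 0 * ‖Z n ω‖ ^ (2 * 2) + T n ω ^ 0 * ‖Z n ω‖ ^ (2 * 3))) ∂μ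
      = (c₁ * β n) * (∫ ω, T n ω ^ 1 * ‖Z n ω‖ ^ (2 * 0) ∂μ + ∫ ω, T n ω ^ 1 * ‖Z n ω‖ ^ (2 * 1) ∂μ)
        + c₂ * (∫ ω, T n ω ^ 0 * ‖Z n ω‖ ^ (2 * 2) ∂μ + ∫ ω, T n ω ^ 0 * ‖Z n ω‖ ^ (2 * 3) ∂μ) := by
    rw [integral_add (by exact i₁₂) (by exact i₃₄), integral_const_mul, integral_const_mul,
      integral_add i₁ i₂, integral_add i₃ i₄]
  refine (le_of_eq e).trans ?_
  calc _ ≤ (c₁ * (b * ((n : ℝ) ^ 2)⁻¹)) * (K₁ * 1 + K₂ * 1)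
        + c₂ * (K₃ * ((n : ℝ) ^ 2)⁻¹ + K₄ * ((n : ℝ) ^ 2)⁻¹) := by
        have g₁ := b₁.trans (mul_le_mul_of_nonneg_left (hle 0) hK₁)
        have g₂ := b₂.trans (mul_le_mul_of_nonneg_left (hle 1) hK₂)
        have g₄ := b₄.trans (mul_le_mul_of_nonneg_left h32 hK₄)
        have g₀ : 0 ≤ ∫ ω, T n ω ^ 1 * ‖Z n ω‖ ^ (2 * 0) ∂μ
            + ∫ ω, T n ω ^ 1 * ‖Z n ω‖ ^ (2 * 1) ∂μ := by
          refine add_nonneg (integral_nonneg fun ω => ?_) (integral_nonneg fun ω => ?_) <;>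
          · have := h.stat_nonneg n hn ω
            dsimp only
            positivity
        gcongr
    _ = _ := by ring

/-- No cancellation is needed: the two coefficients have means O(n^{-2}) and O(n^{-1}) separately.
-/
lemma isBigOP_randCoeff_sub (h : MomentBounds μ n₀ k Z T β) (hk : 2 ≤ k) {d : H} (hd : d ≠ 0) :
    IsBigOP μ (fun n ω => randCoeff Z T β d n ω
      - (∫ ω, ‖Z n ω‖ ^ 2 ∂μ) / (∫ ω, ‖Z n ω‖ ^ 2 ∂μ + ‖d‖ ^ 2)) (fun n => (n : ℝ)⁻¹) := by
  obtain ⟨K, hK, hb⟩ := h.exists_integral_randCoeff_le hk hd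
  obtain ⟨L, hL, hΔ⟩ := h.exists_integral_norm_sq_le
  have hD : 0 < ‖d‖ := norm_pos_iff.2 hd
  have hΔ0 : ∀ n, 0 ≤ ∫ ω, ‖Z n ω‖ ^ 2 ∂μ := fun n => integral_nonneg fun _ => by positivity
  refine isBigOP_of_integral_le (n₀ := n₀) (K := K + (‖d‖ ^ 2)⁻¹ * L)
    (V := fun n ω => randCoeff Z T β d n ω * (1 + ‖Z n ω‖ ^ 2) + (‖d‖ ^ 2)⁻¹ * ∫ ω, ‖Z n ω‖ ^ 2 ∂μ)
    (fun n hn => inv_pos.2 (h.cast_pos hn)) (fun n hn ω => ?_)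
    (fun n hn => (hb n hn).1.add (integrable_const _)) (fun n hn => ?_)
  · obtain ⟨h0, -⟩ := h.randCoeff_mem_Icc d hn ω
    obtain ⟨g0, g1⟩ := oracle_le (hΔ0 n) hD
    have h2 : 0 ≤ randCoeff Z T β d n ω * ‖Z n ω‖ ^ 2 := by positivity
    rw [abs_le]
    constructor <;> linarith
  · have hn1 := h.one_le_cast hn
    have hn2 : ((n : ℝ) ^ 2)⁻¹ ≤ (n : ℝ)⁻¹ :=
      inv_anti₀ (h.cast_pos hn) (le_self_pow₀ hn1 two_ne_zero)
    rw [integral_add (hb n hn).1 (integrable_const _)]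
    simp only [integral_const, probReal_univ, one_smul]
    rw [add_mul, mul_assoc (‖d‖ ^ 2)⁻¹ L]
    exact add_le_add ((hb n hn).2.trans (mul_le_mul_of_nonneg_left hn2 hK))
      (mul_le_mul_of_nonneg_left (hΔ n hn) (by positivity))

variable [InnerProductSpace ℝ H]

lemma memLp_shrunkError (h : MomentBounds μ n₀ k Z T β) (d : H) {n : ℕ} (hn : n₀ ≤ n) :
    MemLp (shrunkError Z T β d n) 2 μ := by
  have hm := h.aestronglyMeasurable_randCoeff d n
  have hZ := h.memLp_error n 2
  refine (hZ.norm.add (memLp_const ‖d‖)).of_le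
    (((aestronglyMeasurable_const.sub hm).smul hZ.1).add (hm.smul_const d))
    (ae_of_all _ fun ω => ?_)
  obtain ⟨h0, h1⟩ := h.randCoeff_mem_Icc d hn ω
  simp only [Pi.add_apply]
  rw [Real.norm_of_nonneg (by positivity)]
  refine (norm_add_le _ _).trans ?_
  rw [norm_smul, norm_smul, Real.norm_of_nonneg h0, Real.norm_of_nonneg (by linarith)]
  have := norm_nonneg (Z n ω)
  have := norm_nonneg d
  nlinarith

lemma integrable_norm_sq_shrunkError (h : MomentBounds μ n₀ k Z T β) (d : H) {n : ℕ}
    (hn : n₀ ≤ n) : Integrable (fun ω => ‖shrunkError Z T β d n ω‖ ^ 2) μ :=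
  (memLp_two_iff_integrable_sq_norm (h.memLp_shrunkError d hn).1).1 (h.memLp_shrunkError d hn)

lemma exists_abs_integral_sub_le (h : MomentBounds μ n₀ k Z T β) (hk : 2 ≤ k) {d : H}
    (hd : d ≠ 0) : ∃ K : ℝ, 0 ≤ K ∧ ∀ n ≥ n₀,
      |∫ ω, ‖shrunkError Z T β d n ω‖ ^ 2 ∂μ - ∫ ω, ‖Z n ω‖ ^ 2 ∂μ| ≤ K * ((n : ℝ) ^ 2)⁻¹ := by
  obtain ⟨K, hK, hb⟩ := h.exists_integral_randCoeff_le hk hd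
  refine ⟨(3 + 2 * ‖d‖ ^ 2) * K, by positivity, fun n hn => ?_⟩
  obtain ⟨i, b⟩ := hb n hn
  rw [← integral_sub (h.integrable_norm_sq_shrunkError d hn) (h.integrable_norm_sq_error n),
    ← Real.norm_eq_abs]
  refine (norm_integral_le_of_norm_le (i.const_mul (3 + 2 * ‖d‖ ^ 2)) (ae_of_all _ fun ω => ?_)).trans ?_
  · exact abs_norm_sq_convex_comb_sub_le (h.randCoeff_mem_Icc d hn ω) _ _
  · rw [integral_const_mul, mul_assoc]
    gcongr

/-- By the reverse triangle inequality the difference is at most |a - s| ‖d - Z‖, with a the random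
coefficient, and ‖d - Z‖ ≤ (1 + ‖d‖)(1 + ‖Z‖²). -/
lemma isBigOP_norm_shrunkError_sub (h : MomentBounds μ n₀ k Z T β) (hk : 2 ≤ k) {d : H}
    (hd : d ≠ 0) (s : ℕ → ℝ)
    (hs : s = fun n => (∫ ω, ‖Z n ω‖ ^ 2 ∂μ) / (∫ ω, ‖Z n ω‖ ^ 2 ∂μ + ‖d‖ ^ 2)) :
    IsBigOP μ (fun n ω => ‖shrunkError Z T β d n ω‖ - ‖(1 - s n) • Z n ω + s n • d‖)
      (fun n => (n : ℝ)⁻¹) := by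
  obtain ⟨K, hK, hb⟩ := h.exists_integral_randCoeff_le hk hd
  obtain ⟨L, hL, hΔ⟩ := h.exists_integral_norm_sq_le
  have hD : 0 < ‖d‖ := norm_pos_iff.2 hd
  have hΔ0 : ∀ n, 0 ≤ ∫ ω, ‖Z n ω‖ ^ 2 ∂μ := fun n => integral_nonneg fun _ => by positivity
  have hi : ∀ n, Integrable (fun ω => 1 + ‖Z n ω‖ ^ 2) μ := fun n =>
    (integrable_const (1 : ℝ)).add (h.integrable_norm_sq_error n)
  refine isBigOP_of_integral_le (n₀ := n₀) (K := (1 + ‖d‖) * (K + (‖d‖ ^ 2)⁻¹ * L * (1 + L)))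
    (V := fun n ω => (1 + ‖d‖) * (randCoeff Z T β d n ω * (1 + ‖Z n ω‖ ^ 2)
      + s n * (1 + ‖Z n ω‖ ^ 2)))
    (fun n hn => inv_pos.2 (h.cast_pos hn)) (fun n hn ω => ?_)
    (fun n hn => ((hb n hn).1.add ((hi n).const_mul _)).const_mul _) (fun n hn => ?_)
  · obtain ⟨h0, -⟩ := h.randCoeff_mem_Icc d hn ω
    have g0 : 0 ≤ s n := by rw [hs]; exact (oracle_le (hΔ0 n) hD).1
    refine (abs_norm_sub_norm_le _ _).trans ?_
    have e : shrunkError Z T β d n ω - ((1 - s n) • Z n ω + s n • d)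
        = (randCoeff Z T β d n ω - s n) • (d - Z n ω) := by
      unfold shrunkError
      module
    rw [e, norm_smul, Real.norm_eq_abs]
    have h1 : |randCoeff Z T β d n ω - s n| ≤ randCoeff Z T β d n ω + s n := by
      rw [abs_le]; constructor <;> linarith
    have h2 : ‖d - Z n ω‖ ≤ (1 + ‖d‖) * (1 + ‖Z n ω‖ ^ 2) := by
      refine (norm_sub_le _ _).trans ?_
      have h3 : 0 ≤ ‖d‖ * ‖Z n ω‖ ^ 2 := by positivity
      nlinarith [sq_nonneg (‖Z n ω‖ - 1), norm_nonneg (Z n ω)]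
    calc _ ≤ (randCoeff Z T β d n ω + s n) * ((1 + ‖d‖) * (1 + ‖Z n ω‖ ^ 2)) := by gcongr
      _ = _ := by ring
  · have hn1 := h.one_le_cast hn
    have hn2 : ((n : ℝ) ^ 2)⁻¹ ≤ (n : ℝ)⁻¹ :=
      inv_anti₀ (h.cast_pos hn) (le_self_pow₀ hn1 two_ne_zero)
    have hn3 : (n : ℝ)⁻¹ ≤ 1 := inv_le_one_of_one_le₀ hn1
    have hn4 : (0 : ℝ) ≤ (n : ℝ)⁻¹ := by positivity
    have hsn : s n ≤ (‖d‖ ^ 2)⁻¹ * (L * (n : ℝ)⁻¹) := by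
      rw [hs]
      exact (oracle_le (hΔ0 n) hD).2.trans (mul_le_mul_of_nonneg_left (hΔ n hn) (by positivity))
    have g0 : 0 ≤ s n := by rw [hs]; exact (oracle_le (hΔ0 n) hD).1
    have e : ∫ ω, (1 + ‖Z n ω‖ ^ 2) ∂μ = 1 + ∫ ω, ‖Z n ω‖ ^ 2 ∂μ := by
      rw [integral_add (integrable_const _) (h.integrable_norm_sq_error n)]
      simp
    rw [integral_const_mul, mul_assoc]
    refine mul_le_mul_of_nonneg_left ?_ (by positivity)
    rw [integral_add (hb n hn).1 ((hi n).const_mul _), integral_const_mul, e, add_mul]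
    refine add_le_add ((hb n hn).2.trans (mul_le_mul_of_nonneg_left hn2 hK)) ?_
    calc _ ≤ (‖d‖ ^ 2)⁻¹ * (L * (n : ℝ)⁻¹) * (1 + L * 1) := by
          have g2 := (hΔ n hn).trans (mul_le_mul_of_nonneg_left hn3 hL)
          have := hΔ0 n
          gcongr
      _ = _ := by ring

lemma isBigOP_norm_shrunkError (h : MomentBounds μ n₀ k Z T β) (hk : 2 ≤ k) {d : H}
    (hd : d ≠ 0) :
    IsBigOP μ (fun n ω => ‖shrunkError Z T β d n ω‖) (fun n => (n : ℝ) ^ (-(1 / 2) : ℝ)) := by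
  obtain ⟨K, hK, hb⟩ := h.exists_integral_randCoeff_le hk hd
  obtain ⟨L, hL, hΔ⟩ := h.exists_integral_norm_sq_le
  have hrw : ∀ n : ℕ, (n : ℝ) ^ (-(1 / 2) : ℝ) = (√(n : ℝ))⁻¹ := fun n => by
    rw [Real.rpow_neg n.cast_nonneg, ← Real.sqrt_eq_rpow]
  simp_rw [hrw]
  have iZ := h.integrable_norm_sq_error
  refine isBigOP_of_integral_le (n₀ := n₀) (K := 1 + L + ‖d‖ * K)
    (V := fun n ω => ((√(n : ℝ))⁻¹ + √(n : ℝ) * ‖Z n ω‖ ^ 2)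
      + ‖d‖ * (randCoeff Z T β d n ω * (1 + ‖Z n ω‖ ^ 2)))
    (fun n hn => inv_pos.2 (Real.sqrt_pos.2 (h.cast_pos hn))) (fun n hn ω => ?_)
    (fun n hn => ((integrable_const _).add ((iZ n).const_mul _)).add ((hb n hn).1.const_mul _))
    (fun n hn => ?_)
  · obtain ⟨h0, h1⟩ := h.randCoeff_mem_Icc d hn ω
    have hs : 0 < √(n : ℝ) := Real.sqrt_pos.2 (h.cast_pos hn)
    rw [abs_of_nonneg (norm_nonneg _)]
    refine (norm_add_le _ _).trans ?_
    rw [norm_smul, norm_smul, Real.norm_of_nonneg h0, Real.norm_of_nonneg (by linarith)]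
    set s := √(n : ℝ)
    -- With s = √n both terms have mean O(n^{-1/2}).
    have h2 : ‖Z n ω‖ ≤ s⁻¹ + s * ‖Z n ω‖ ^ 2 := by
      have e : s⁻¹ + s * ‖Z n ω‖ ^ 2 - ‖Z n ω‖
          = s⁻¹ * ((1 - s * ‖Z n ω‖ / 2) ^ 2 + 3 / 4 * (s * ‖Z n ω‖) ^ 2) := by
        field_simp
        ring
      have : 0 ≤ s⁻¹ * ((1 - s * ‖Z n ω‖ / 2) ^ 2 + 3 / 4 * (s * ‖Z n ω‖) ^ 2) := by positivity
      linarith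
    have h3 : (1 - randCoeff Z T β d n ω) * ‖Z n ω‖ ≤ ‖Z n ω‖ :=
      mul_le_of_le_one_left (norm_nonneg _) (by linarith)
    have h4 : 0 ≤ ‖d‖ * (randCoeff Z T β d n ω * ‖Z n ω‖ ^ 2) := by positivity
    linarith
  · have hn0 := h.cast_pos hn
    have hn1 := h.one_le_cast hn
    have hs : 0 < √(n : ℝ) := Real.sqrt_pos.2 hn0
    have hs1 : 1 ≤ √(n : ℝ) := Real.one_le_sqrt.2 hn1
    have hss : √(n : ℝ) ^ 2 = n := Real.sq_sqrt hn0.le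
    have hn2 : ((n : ℝ) ^ 2)⁻¹ ≤ (√(n : ℝ))⁻¹ := by
      refine inv_anti₀ hs ?_
      have h4 : (n : ℝ) ^ 2 = √(n : ℝ) ^ 4 := by rw [← hss]; simp only [Real.sqrt_sq hs.le]; ring
      rw [h4]
      exact le_self_pow₀ hs1 four_ne_zero
    have e : √(n : ℝ) * (L * (n : ℝ)⁻¹) = L * (√(n : ℝ))⁻¹ := by
      have h4 : (n : ℝ)⁻¹ = (√(n : ℝ))⁻¹ * (√(n : ℝ))⁻¹ := by rw [← mul_inv, ← sq, hss]
      rw [h4]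
      field_simp
    have i1 : Integrable (fun ω => (√(n : ℝ))⁻¹ + √(n : ℝ) * ‖Z n ω‖ ^ 2) μ :=
      (integrable_const _).add ((iZ n).const_mul _)
    rw [integral_add i1 ((hb n hn).1.const_mul _),
      integral_add (integrable_const _) ((iZ n).const_mul _), integral_const_mul, integral_const_mul]
    simp only [integral_const, probReal_univ, one_smul]
    have g1 := mul_le_mul_of_nonneg_left (hΔ n hn) hs.le
    have g2 := mul_le_mul_of_nonneg_left
      ((hb n hn).2.trans (mul_le_mul_of_nonneg_left hn2 hK)) (norm_nonneg d)
    rw [e] at g1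
    linarith

end MomentBounds

end Asymptotics

/-! ### Comparison with the oracle when the risk has exact order n^{-c}, c < k. -/

namespace MomentBounds

variable {Ω : Type*} [MeasurableSpace Ω] {μ : Measure Ω}
  {H : Type*} [NormedAddCommGroup H]
  {n₀ k : ℕ} {Z : ℕ → Ω → H} {T : ℕ → Ω → ℝ} {β : ℕ → ℝ}

lemma integrable_stat_mul_inner [InnerProductSpace ℝ H] (h : MomentBounds μ n₀ k Z T β) (d : H) (n : ℕ) :
    Integrable (fun ω => T n ω * inner ℝ (Z n ω) d) μ := by
  have hm : AEStronglyMeasurable (fun ω => (inner ℝ (Z n ω) d : ℝ)) μ :=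
    (h.memLp_error n 0).1.inner aestronglyMeasurable_const
  have h0 : MemLp (fun ω => ‖Z n ω‖ * ‖d‖) 2 μ := (h.memLp_error n 2).norm.mul_const ‖d‖
  have h1 : MemLp (fun ω => (inner ℝ (Z n ω) d : ℝ)) 2 μ := h0.of_le hm (ae_of_all _ fun ω => by
    rw [norm_mul, norm_norm, norm_norm]
    exact norm_inner_le_norm _ _)
  have h2 : MemLp (T n) 2 μ := h.memLp_stat n 2
  exact h2.integrable_mul h1

variable [IsProbabilityMeasure μ]

/-- T is truncated at √n. Below this level the order n^{-c} of E‖Z‖² is kept at the cost of a factor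
√n; above it, 2k extra powers of T gain n^{-k}. The general product bound would give only n^{-1}. -/
lemma integral_stat_mul_norm_sq_le (h : MomentBounds μ n₀ k Z T β) {c : ℕ} (hck : c < k)
    {K : ℝ} (hK : 0 ≤ K) (hΔ : ∀ n ≥ n₀, ∫ ω, ‖Z n ω‖ ^ 2 ∂μ ≤ K * ((n : ℝ) ^ c)⁻¹) :
    ∃ L : ℝ, 0 ≤ L ∧ ∀ n ≥ n₀, ∫ ω, T n ω ^ 1 * ‖Z n ω‖ ^ (2 * 1) ∂μ
      ≤ L * (√(n : ℝ) * ((n : ℝ) ^ c)⁻¹) := by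
  obtain ⟨K₁, hK₁, h₁⟩ := h.exists_integral_mul_le 1 1
  obtain ⟨K₂, hK₂, h₂⟩ := h.exists_integral_mul_le (2 * k + 1) 1
  refine ⟨K + K₂, by positivity, fun n hn => ?_⟩
  have hn0 := h.cast_pos hn
  have hn1 := h.one_le_cast hn
  have hs : 0 < √(n : ℝ) := Real.sqrt_pos.2 hn0
  have hs1 : 1 ≤ √(n : ℝ) := Real.one_le_sqrt.2 hn1
  have hs2k : √(n : ℝ) ^ (2 * k) = (n : ℝ) ^ k := by rw [pow_mul, Real.sq_sqrt hn0.le]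
  have hpt : ∀ ω, T n ω ^ 1 * ‖Z n ω‖ ^ (2 * 1) ≤ √(n : ℝ) * ‖Z n ω‖ ^ 2
      + ((n : ℝ) ^ k)⁻¹ * (T n ω ^ (2 * k + 1) * ‖Z n ω‖ ^ (2 * 1)) := by
    intro ω
    have h3 := le_add_inv_pow_mul_pow (h.stat_nonneg n hn ω) hs (2 * k)
    rw [hs2k] at h3
    have h4 := mul_le_mul_of_nonneg_right h3 (sq_nonneg ‖Z n ω‖)
    rw [pow_one, mul_one]
    linarith
  have iZ := (h.integrable_norm_sq_error n).const_mul √(n : ℝ)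
  have iT := (h₂ n hn).1.const_mul ((n : ℝ) ^ k)⁻¹
  refine (integral_mono (h₁ n hn).1 (iZ.add iT) hpt).trans ?_
  have e : ∫ ω, (√(n : ℝ) * ‖Z n ω‖ ^ 2
      + ((n : ℝ) ^ k)⁻¹ * (T n ω ^ (2 * k + 1) * ‖Z n ω‖ ^ (2 * 1))) ∂μ
      = √(n : ℝ) * ∫ ω, ‖Z n ω‖ ^ 2 ∂μ
        + ((n : ℝ) ^ k)⁻¹ * ∫ ω, T n ω ^ (2 * k + 1) * ‖Z n ω‖ ^ (2 * 1) ∂μ := by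
    rw [integral_add iZ iT, integral_const_mul, integral_const_mul]
  refine (le_of_eq e).trans ?_
  have hkc : ((n : ℝ) ^ k)⁻¹ ≤ ((n : ℝ) ^ c)⁻¹ :=
    inv_anti₀ (by positivity) (pow_le_pow_right₀ hn1 hck.le)
  have hle : ((n : ℝ) ^ 1)⁻¹ ≤ 1 := inv_le_one_of_one_le₀ (one_le_pow₀ hn1)
  have h5 := (h₂ n hn).2.trans (mul_le_mul_of_nonneg_left hle hK₂)
  have hc0 : 0 < ((n : ℝ) ^ c)⁻¹ := by positivity
  calc _ ≤ √(n : ℝ) * (K * ((n : ℝ) ^ c)⁻¹) + ((n : ℝ) ^ c)⁻¹ * (K₂ * 1) := by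
        refine add_le_add (mul_le_mul_of_nonneg_left (hΔ n hn) hs.le) ?_
        refine (mul_le_mul_of_nonneg_left h5 (by positivity)).trans ?_
        gcongr
    _ ≤ √(n : ℝ) * (K * ((n : ℝ) ^ c)⁻¹) + (√(n : ℝ) * ((n : ℝ) ^ c)⁻¹) * (K₂ * 1) := by
        have := le_mul_of_one_le_left hc0.le hs1
        gcongr
    _ = _ := by ring


/-- If the risk is of exact order `n ^ (-c)` with `c < k`, then shrinkage with the estimated
coefficient is asymptotically not better than the oracle. -/
lemma eventually_nonneg_excess [InnerProductSpace ℝ H] (h : MomentBounds μ n₀ k Z T β) {c : ℕ} (hck : c < k) {d : H}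
    (hd : d ≠ 0) {K : ℝ} (hK : 0 ≤ K)
    (hΔ : ∀ n ≥ n₀, ∫ ω, ‖Z n ω‖ ^ 2 ∂μ ≤ K * ((n : ℝ) ^ c)⁻¹) {C : ℝ} (hC : 0 ≤ C)
    (hcov : ∀ n ≥ n₀, |∫ ω, T n ω * inner ℝ (Z n ω) d ∂μ| ≤ C * ((n : ℝ) ^ c)⁻¹)
    {a : ℝ} (ha : 0 < a) (hlow : ∀ᶠ n : ℕ in atTop, a * ((n : ℝ) ^ c)⁻¹ ≤ ∫ ω, ‖Z n ω‖ ^ 2 ∂μ) :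
    ∀ᶠ n : ℕ in atTop, 0 ≤ ∫ ω, ‖shrunkError Z T β d n ω‖ ^ 2 ∂μ - ∫ ω, ‖Z n ω‖ ^ 2 ∂μ
      + (∫ ω, ‖Z n ω‖ ^ 2 ∂μ) ^ 2 / (∫ ω, ‖Z n ω‖ ^ 2 ∂μ + ‖d‖ ^ 2) := by
  have hD : 0 < ‖d‖ := norm_pos_iff.2 hd
  obtain ⟨b, hb, hβ⟩ := h.norm_const_le
  obtain ⟨L₁, hL₁, h₁⟩ := h.integral_stat_mul_norm_sq_le hck hK hΔ
  obtain ⟨_, _, h₁'⟩ := h.exists_integral_mul_le 1 1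
  obtain ⟨L₂, hL₂, h₂⟩ := h.exists_integral_mul_le 2 0
  obtain ⟨L₃, hL₃, h₃⟩ := h.exists_integral_mul_le 2 1
  obtain ⟨L₄, hL₄, h₄⟩ := h.exists_integral_mul_le 0 (2 * k + 1)
  obtain ⟨L₅, hL₅, h₅⟩ := h.exists_integral_mul_le 1 (2 * k + 1)
  -- The exponent 4k makes the contribution of large Z a moment of order 4k + 2, which is
  -- O(n^{-2k-1}).
  set M := 28 / ‖d‖ ^ 2 + 40 / ‖d‖ ^ 3 + (2 / ‖d‖) ^ (4 * k) + (2 / ‖d‖) ^ (4 * k + 2) with hM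
  have hM0 : 0 ≤ M := by positivity
  set R := 2 / ‖d‖ ^ 2 * (b * C) + M * (b * L₁ + b ^ 2 * (L₂ + L₃) + (L₄ + b * L₅)) with hR
  have hR0 : 0 ≤ R := by positivity
  have hbound : ∀ n ≥ n₀, -(R * ((((n : ℝ) ^ c)⁻¹) ^ 2 * (√(n : ℝ))⁻¹)) ≤
      ∫ ω, ‖shrunkError Z T β d n ω‖ ^ 2 ∂μ - ∫ ω, ‖Z n ω‖ ^ 2 ∂μ := by
    intro n hn
    have hn0 := h.cast_pos hn
    have hn1 := h.one_le_cast hn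
    have hs : 0 < √(n : ℝ) := Real.sqrt_pos.2 hn0
    have hs1 : 1 ≤ √(n : ℝ) := Real.one_le_sqrt.2 hn1
    have hβ0 := h.norm_const_nonneg n
    obtain ⟨i₂, b₂⟩ := h₂ n hn
    obtain ⟨i₃, b₃⟩ := h₃ n hn
    obtain ⟨i₄, b₄⟩ := h₄ n hn
    obtain ⟨i₅, b₅⟩ := h₅ n hn
    have i₁ := (h₁' n hn).1
    have i₀ := h.integrable_stat_mul_inner d n
    have hpt : ∀ ω, 2 / ‖d‖ ^ 2 * β n * (T n ω * inner ℝ (Z n ω) d)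
        - M * (β n * (T n ω ^ 1 * ‖Z n ω‖ ^ (2 * 1))
          + β n ^ 2 * (T n ω ^ 2 * ‖Z n ω‖ ^ (2 * 0) + T n ω ^ 2 * ‖Z n ω‖ ^ (2 * 1))
          + (T n ω ^ 0 * ‖Z n ω‖ ^ (2 * (2 * k + 1))
            + β n * (T n ω ^ 1 * ‖Z n ω‖ ^ (2 * (2 * k + 1)))))
        ≤ ‖shrunkError Z T β d n ω‖ ^ 2 - ‖Z n ω‖ ^ 2 := by
      intro ω
      refine le_trans (le_of_eq ?_) (norm_sq_shrink_sub_ge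
        (mul_nonneg hβ0 (h.stat_nonneg n hn ω)) (Z n ω) hd (4 * k))
      have e : 4 * k + 2 = 2 * (2 * k + 1) := by ring
      rw [hM, e]
      ring
    have j₁ := i₁.const_mul (β n)
    have j₂₃ : Integrable (fun ω => β n ^ 2 *
        (T n ω ^ 2 * ‖Z n ω‖ ^ (2 * 0) + T n ω ^ 2 * ‖Z n ω‖ ^ (2 * 1))) μ :=
      (i₂.add i₃).const_mul _
    have j₄₅ : Integrable (fun ω => T n ω ^ 0 * ‖Z n ω‖ ^ (2 * (2 * k + 1))
            + β n * (T n ω ^ 1 * ‖Z n ω‖ ^ (2 * (2 * k + 1)))) μ := i₄.add (i₅.const_mul _)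
    have j₁₂₃ : Integrable (fun ω => β n * (T n ω ^ 1 * ‖Z n ω‖ ^ (2 * 1))
          + β n ^ 2 * (T n ω ^ 2 * ‖Z n ω‖ ^ (2 * 0) + T n ω ^ 2 * ‖Z n ω‖ ^ (2 * 1))) μ :=
      j₁.add j₂₃
    have j : Integrable (fun ω => β n * (T n ω ^ 1 * ‖Z n ω‖ ^ (2 * 1))
          + β n ^ 2 * (T n ω ^ 2 * ‖Z n ω‖ ^ (2 * 0) + T n ω ^ 2 * ‖Z n ω‖ ^ (2 * 1))
          + (T n ω ^ 0 * ‖Z n ω‖ ^ (2 * (2 * k + 1))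
            + β n * (T n ω ^ 1 * ‖Z n ω‖ ^ (2 * (2 * k + 1))))) μ := j₁₂₃.add j₄₅
    have hI := integral_mono ((i₀.const_mul (2 / ‖d‖ ^ 2 * β n)).sub (j.const_mul M))
      ((h.integrable_norm_sq_shrunkError d hn).sub (h.integrable_norm_sq_error n)) hpt
    simp only [Pi.sub_apply] at hI
    rw [integral_sub (h.integrable_norm_sq_shrunkError d hn) (h.integrable_norm_sq_error n),
      integral_sub (i₀.const_mul _) (j.const_mul M), integral_const_mul, integral_const_mul,
      integral_add j₁₂₃ j₄₅, integral_add j₁ j₂₃, integral_add i₄ (i₅.const_mul _),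
      integral_const_mul, integral_const_mul, integral_const_mul, integral_add i₂ i₃] at hI
    refine le_trans ?_ hI
    have g₀ := (abs_le.1 (hcov n hn)).1
    have g₁ := h₁ n hn
    have hle : ∀ j, ((n : ℝ) ^ j)⁻¹ ≤ 1 := fun j => inv_le_one_of_one_le₀ (one_le_pow₀ hn1)
    -- Here c < k enters: β is O(u t²) with u = n^{-c} and t = n^{-1/2}. Each error term below is
    -- then O(u² t).
    have hkc : ((n : ℝ) ^ k)⁻¹ ≤ ((n : ℝ) ^ c)⁻¹ * (√(n : ℝ))⁻¹ ^ 2 := by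
      rw [inv_pow, Real.sq_sqrt hn0.le, ← mul_inv, ← pow_succ]
      exact inv_anti₀ (by positivity) (pow_le_pow_right₀ hn1 hck)
    have h2k : ((n : ℝ) ^ (2 * k + 1))⁻¹ ≤ (((n : ℝ) ^ k)⁻¹) ^ 2 := by
      rw [inv_pow, ← pow_mul]
      exact inv_anti₀ (by positivity) (pow_le_pow_right₀ hn1 (by omega))
    have hut : √(n : ℝ) * (√(n : ℝ))⁻¹ = 1 := mul_inv_cancel₀ hs.ne'
    have ht1 : (√(n : ℝ))⁻¹ ≤ 1 := inv_le_one_of_one_le₀ hs1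
    have ht0 : 0 < (√(n : ℝ))⁻¹ := by positivity
    have hu0 : 0 < ((n : ℝ) ^ c)⁻¹ := by positivity
    have hβn := (hβ n hn).trans (mul_le_mul_of_nonneg_left hkc hb)
    have b₂' := b₂.trans (mul_le_mul_of_nonneg_left (hle 0) hL₂)
    have b₃' := b₃.trans (mul_le_mul_of_nonneg_left (hle 1) hL₃)
    have h2k' : ((n : ℝ) ^ (2 * k + 1))⁻¹ ≤ (((n : ℝ) ^ c)⁻¹ * (√(n : ℝ))⁻¹ ^ 2) ^ 2 :=
      h2k.trans (pow_le_pow_left₀ (by positivity) hkc 2)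
    have b₄' := b₄.trans (mul_le_mul_of_nonneg_left h2k' hL₄)
    have b₅' := b₅.trans (mul_le_mul_of_nonneg_left h2k' hL₅)
    have hβ1 : β n ≤ b := (hβ n hn).trans (mul_le_of_le_one_right hb (hle k))
    set s := √(n : ℝ)
    set t := s⁻¹
    set u := ((n : ℝ) ^ c)⁻¹
    have ht2 : t ^ 2 ≤ t := pow_le_of_le_one ht0.le ht1 two_ne_zero
    have ht4 : t ^ 4 ≤ t := pow_le_of_le_one ht0.le ht1 four_ne_zero
    have hu2 : 0 ≤ u ^ 2 := sq_nonneg u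
    have f₀ : -(b * C * (u ^ 2 * t)) ≤ β n * ∫ ω, T n ω * inner ℝ (Z n ω) d ∂μ := by
      have q1 : β n * (C * u) ≤ b * C * (u ^ 2 * t) := by
        calc β n * (C * u) ≤ b * (u * t ^ 2) * (C * u) := by gcongr
          _ = b * C * (u ^ 2 * t ^ 2) := by ring
          _ ≤ _ := by gcongr
      have q2 := mul_le_mul_of_nonneg_left g₀ hβ0
      linarith
    -- The factor √n lost by truncation cancels one of the two factors t of β.
    have f₁ : β n * ∫ ω, T n ω ^ 1 * ‖Z n ω‖ ^ (2 * 1) ∂μ ≤ b * L₁ * (u ^ 2 * t) := by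
      calc _ ≤ β n * (L₁ * (s * u)) := by gcongr
        _ ≤ b * (u * t ^ 2) * (L₁ * (s * u)) := by gcongr
        _ = b * L₁ * (u ^ 2 * t) * (s * t) := by ring
        _ = _ := by rw [hut, mul_one]
    have f₂ : β n ^ 2 * (∫ ω, T n ω ^ 2 * ‖Z n ω‖ ^ (2 * 0) ∂μ
        + ∫ ω, T n ω ^ 2 * ‖Z n ω‖ ^ (2 * 1) ∂μ) ≤ b ^ 2 * (L₂ + L₃) * (u ^ 2 * t) := by
      calc _ ≤ β n ^ 2 * (L₂ * 1 + L₃ * 1) := by gcongr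
        _ ≤ (b * (u * t ^ 2)) ^ 2 * (L₂ * 1 + L₃ * 1) := by gcongr
        _ = b ^ 2 * (L₂ + L₃) * (u ^ 2 * t ^ 4) := by ring
        _ ≤ _ := by gcongr
    have f₄ : ∫ ω, T n ω ^ 0 * ‖Z n ω‖ ^ (2 * (2 * k + 1)) ∂μ ≤ L₄ * (u ^ 2 * t) := by
      calc _ ≤ L₄ * (u * t ^ 2) ^ 2 := b₄'
        _ = L₄ * (u ^ 2 * t ^ 4) := by ring
        _ ≤ _ := by gcongr
    have f₅ : β n * ∫ ω, T n ω ^ 1 * ‖Z n ω‖ ^ (2 * (2 * k + 1)) ∂μ ≤ b * L₅ * (u ^ 2 * t) := by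
      calc _ ≤ β n * (L₅ * (u * t ^ 2) ^ 2) := by gcongr
        _ ≤ b * (L₅ * (u * t ^ 2) ^ 2) := by gcongr
        _ = b * L₅ * (u ^ 2 * t ^ 4) := by ring
        _ ≤ _ := by gcongr
    have e₁ := mul_le_mul_of_nonneg_left f₀ (by positivity : 0 ≤ 2 / ‖d‖ ^ 2)
    have e₂ := mul_le_mul_of_nonneg_left (add_le_add (add_le_add f₁ f₂) (add_le_add f₄ f₅)) hM0
    have e₃ : R * (u ^ 2 * t) = 2 / ‖d‖ ^ 2 * (b * C * (u ^ 2 * t))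
        + M * (b * L₁ * (u ^ 2 * t) + b ^ 2 * (L₂ + L₃) * (u ^ 2 * t)
          + (L₄ * (u ^ 2 * t) + b * L₅ * (u ^ 2 * t))) := by rw [hR]; ring
    rw [e₃]
    linarith
  have hlim : Tendsto (fun n : ℕ => R * (√(n : ℝ))⁻¹) atTop (nhds 0) := by
    have := (tendsto_inv_atTop_zero.comp (Real.tendsto_sqrt_atTop.comp
      tendsto_natCast_atTop_atTop)).const_mul R
    simpa using this
  have hpos : 0 < a ^ 2 / (K + ‖d‖ ^ 2) := by positivity
  filter_upwards [hlow, eventually_ge_atTop n₀, hlim.eventually (gt_mem_nhds hpos)] with n hn1 hn2 hn3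
  have hb := hbound n hn2
  have hup := hΔ n hn2
  have hn0 := h.cast_pos hn2
  have hu1 : ((n : ℝ) ^ c)⁻¹ ≤ 1 := inv_le_one_of_one_le₀ (one_le_pow₀ (h.one_le_cast hn2))
  have hu0 : 0 < ((n : ℝ) ^ c)⁻¹ := by positivity
  set Δ := ∫ ω, ‖Z n ω‖ ^ 2 ∂μ
  set u := ((n : ℝ) ^ c)⁻¹
  have hΔ0 : 0 ≤ Δ := le_trans (by positivity) hn1
  have hΔK : Δ ≤ K := hup.trans (mul_le_of_le_one_right hK hu1)
  -- The oracle gain is at least a constant times n^{-2c}, which dominates the loss of order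
  -- n^{-2c-1/2}.
  have h6 : a ^ 2 / (K + ‖d‖ ^ 2) * u ^ 2 ≤ Δ ^ 2 / (Δ + ‖d‖ ^ 2) := by
    calc _ = (a * u) ^ 2 / (K + ‖d‖ ^ 2) := by ring
      _ ≤ _ := by gcongr
  have h7 := mul_le_mul_of_nonneg_right hn3.le (sq_nonneg u)
  have h8 : R * (u ^ 2 * (√(n : ℝ))⁻¹) = R * (√(n : ℝ))⁻¹ * u ^ 2 := by ring
  linarith

end MomentBounds

/-! ### The oracle risk, and application to U-statistics. -/

section Assembly

lemma IsBigOP.congr {Ω : Type*} [MeasurableSpace Ω] {μ : Measure Ω} {Y Y' : ℕ → Ω → ℝ}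
    {a : ℕ → ℝ} (h : IsBigOP μ Y a) {n₀ : ℕ} (hY : ∀ n ≥ n₀, ∀ ω, Y' n ω = Y n ω) :
    IsBigOP μ Y' a := by
  intro ε hε
  obtain ⟨M, hM, N, hN⟩ := h ε hε
  refine ⟨M, hM, max N n₀, fun n hn => ?_⟩
  simp_rw [hY n (le_of_max_le_right hn)]
  exact hN n (le_of_max_le_left hn)

/-- Completing the square in α, with vertex Δ/(Δ + D²). -/
lemma isLeast_range_quadratic {Δ D : ℝ} (hΔ : 0 ≤ Δ) (hD : 0 < D) :
    IsLeast (Set.range fun α : ℝ => (1 - α) ^ 2 * Δ + α ^ 2 * D ^ 2) (Δ - Δ ^ 2 / (Δ + D ^ 2)) := by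
  have hpos : 0 < Δ + D ^ 2 := by positivity
  have e : ∀ α : ℝ, (1 - α) ^ 2 * Δ + α ^ 2 * D ^ 2
      = Δ - Δ ^ 2 / (Δ + D ^ 2) + (Δ + D ^ 2) * (α - Δ / (Δ + D ^ 2)) ^ 2 := by
    intro α
    field_simp
    ring
  refine ⟨⟨Δ / (Δ + D ^ 2), ?_⟩, ?_⟩
  · dsimp only
    rw [e]
    simp
  · rintro _ ⟨α, rfl⟩
    dsimp only
    rw [e]
    exact le_add_of_nonneg_right (by positivity)

variable {𝒳 : Type*} [MeasurableSpace 𝒳] {P : Measure 𝒳}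
  {Ω : Type*} [MeasurableSpace Ω] {μ : Measure Ω} {X : ℕ → Ω → 𝒳}
  {H : Type*} [NormedAddCommGroup H] [InnerProductSpace ℝ H]

lemma measurePreserving_sample (hXm : ∀ i, Measurable (X i)) (hXlaw : ∀ i, μ.map (X i) = P)
    (hXind : iIndepFun X μ) (n : ℕ) :
    MeasurePreserving (sample X n) μ (Measure.pi fun _ => P) := by
  have hind : iIndepFun (fun i : Fin n => X i) μ := hXind.precomp Fin.val_injective
  have h := iIndepFun.map_fun_eq_pi_map (fun i : Fin n => (hXm i).aemeasurable) hind
  refine ⟨measurable_pi_lambda _ fun i => hXm i, h.trans ?_⟩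
  simp_rw [hXlaw]

variable [IsProbabilityMeasure P] [CompleteSpace H]

lemma momentBounds_uStat (hs : ∀ n, MeasurePreserving (sample X n) μ (Measure.pi fun _ => P))
    {k : ℕ} (hk : 0 < k) {r q : (Fin k → 𝒳) → H}
    (hr : ∀ p : ℕ, MemLp r p (Measure.pi fun _ => P))
    (hq : ∀ p : ℕ, MemLp q p (Measure.pi fun _ => P))
    (hq0 : ∫ x, q x ∂(Measure.pi fun _ => P) = 0) :
    MomentBounds μ (k + k) k (fun n ω => uStat k n q (sample X n ω))
      (fun n ω => varStat r n (sample X n ω)) (fun n => (n.choose k : ℝ)⁻¹) where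
  one_le := by omega
  memLp_error n p := (memLp_uStat n (hq p)).comp_measurePreserving (hs n)
  memLp_stat n p := (memLp_varStat hr n p).comp_measurePreserving (hs n)
  stat_nonneg n hn ω := varStat_nonneg hn r _
  integral_error_le m := by
    obtain ⟨K, hK, h⟩ := exists_integral_norm_uStat_pow_le hk hq hq0 m
    refine ⟨K, hK, fun n hn => le_trans (le_of_eq ?_) (h n (by omega))⟩
    exact integral_comp_measurePreserving (hs n) (g := fun x => ‖uStat k n q x‖ ^ (2 * m))
      ((memLp_uStat n (hq 0)).1.norm.pow _)
  integral_stat_le p := by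
    obtain ⟨A, hA, h⟩ := exists_integral_varStat_pow_le hr p
    refine ⟨A, hA, fun n hn => le_trans (le_of_eq ?_) (h n hn)⟩
    exact integral_comp_measurePreserving (hs n) (g := fun x => varStat r n x ^ p)
      ((memLp_varStat hr n 0).1.pow _)
  norm_const_nonneg n := by positivity
  norm_const_le := ⟨k.factorial * 2 ^ k, by positivity, fun n hn => inv_choose_le hn⟩

variable [IsProbabilityMeasure μ]

/-- The cross term vanishes because Z is centred. -/
lemma integral_norm_sq_convex_comb {Z : Ω → H} (hZ : MemLp Z 2 μ) (h0 : ∫ ω, Z ω ∂μ = 0) (d : H)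
    (α : ℝ) : Integrable (fun ω => ‖(1 - α) • Z ω + α • d‖ ^ 2) μ ∧
    ∫ ω, ‖(1 - α) • Z ω + α • d‖ ^ 2 ∂μ
      = (1 - α) ^ 2 * ∫ ω, ‖Z ω‖ ^ 2 ∂μ + α ^ 2 * ‖d‖ ^ 2 := by
  have i1 := (memLp_two_iff_integrable_sq_norm hZ.1).1 hZ
  have hZi := hZ.integrable one_le_two
  have i2 : Integrable (fun ω => (inner ℝ (Z ω) d : ℝ)) μ := hZi.inner_const d
  have z2 : ∫ ω, (inner ℝ (Z ω) d : ℝ) ∂μ = 0 := by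
    simp_rw [real_inner_comm d]
    rw [integral_inner hZi, h0, inner_zero_right]
  have i12 : Integrable (fun ω => (1 - α) ^ 2 * ‖Z ω‖ ^ 2
      + 2 * (α * (1 - α)) * (inner ℝ (Z ω) d : ℝ)) μ := (i1.const_mul _).add (i2.const_mul _)
  simp_rw [norm_sq_convex_comb]
  refine ⟨i12.add (integrable_const _), ?_⟩
  rw [integral_add i12 (integrable_const _), integral_add (i1.const_mul _) (i2.const_mul _),
    integral_const_mul, integral_const_mul, z2]
  simp

/-- Here c is the first order with a nonzero canonical function. Overlaps below c do not contribute,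
so the risk and the covariance with T are O(n^{-c}); overlaps equal to c bound the risk below by a
multiple of n^{-c}. -/
lemma eventually_nonneg_excess_uStat
    (hs : ∀ n, MeasurePreserving (sample X n) μ (Measure.pi fun _ => P))
    {k : ℕ} (hk : 0 < k) {r q : (Fin k → 𝒳) → H}
    (hr : ∀ p : ℕ, MemLp r p (Measure.pi fun _ => P)) (hqs : IsSymmetric q)
    (hq : ∀ p : ℕ, MemLp q p (Measure.pi fun _ => P))
    (hq0 : ∫ x, q x ∂(Measure.pi fun _ => P) = 0) {d : H} (hd : d ≠ 0) {c : ℕ} (hck : c < k)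
    (hc : ∀ l < c, ∀ᵐ x ∂(Measure.pi fun _ : Fin l => P), canonical P q l x = 0)
    (hc' : ¬ ∀ᵐ x ∂(Measure.pi fun _ : Fin c => P), canonical P q c x = 0)
    {Z : ℕ → Ω → H} {T : ℕ → Ω → ℝ} {β : ℕ → ℝ}
    (hZ : Z = fun n ω => uStat k n q (sample X n ω))
    (hT : T = fun n ω => varStat r n (sample X n ω)) (hβ : β = fun n => (n.choose k : ℝ)⁻¹) :
    ∀ᶠ n : ℕ in atTop, 0 ≤ ∫ ω, ‖shrunkError Z T β d n ω‖ ^ 2 ∂μ - ∫ ω, ‖Z n ω‖ ^ 2 ∂μ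
      + (∫ ω, ‖Z n ω‖ ^ 2 ∂μ) ^ 2 / (∫ ω, ‖Z n ω‖ ^ 2 ∂μ + ‖d‖ ^ 2) := by
  have hM := momentBounds_uStat hs hk hr hq hq0
  rw [← hZ, ← hT, ← hβ] at hM
  have hq2 : MemLp q 2 (Measure.pi fun _ => P) := hq 2
  have hΔeq : ∀ n, ∫ ω, ‖Z n ω‖ ^ 2 ∂μ
      = ∫ x, ‖uStat k n q x‖ ^ 2 ∂(Measure.pi fun _ => P) := fun n => by
    rw [hZ]
    exact integral_comp_measurePreserving (hs n) (g := fun x => ‖uStat k n q x‖ ^ 2)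
      ((memLp_uStat n (hq 0)).1.norm.pow _)
  obtain ⟨C, hC, hcov⟩ := exists_abs_integral_varStat_mul_inner_le hk hck.le hr hqs hq2 hc d
  set V := ∫ y, ‖q y‖ ^ 2 ∂(Measure.pi fun _ => P) with hV
  have hV0 : 0 ≤ V := integral_nonneg fun _ => by positivity
  set ζ := ∫ x, ‖canonical P q c x‖ ^ 2 ∂(Measure.pi fun _ => P) with hζ
  have hζ0 : 0 < ζ := by
    refine lt_of_le_of_ne (integral_nonneg fun _ => by positivity) fun h0 => hc' ?_
    have hi := (integral_inner_canonical_self hck.le hqs hq2 (Fin.castLEEmb hck.le)).1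
    have h1 := (integral_eq_zero_iff_of_nonneg (fun _ => by positivity) hi).1 h0.symm
    filter_upwards [h1] with x hx
    simpa using hx
  refine hM.eventually_nonneg_excess hck hd (K := (k.descFactorial c * k ^ c : ℕ) * 2 ^ c * (V + V))
    (by positivity) (fun n hn => ?_) hC (fun n hn => ?_) (half_pos hζ0) ?_
  · have h1 := abs_integral_inner_uStat_le (n := n) (by omega) (by omega) hqs hq2 hq2 hc
    simp_rw [real_inner_self_eq_norm_sq] at h1
    have h2 := inv_descFactorial_le (c := c) (n := n) (by omega) (by omega)
    rw [hΔeq]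
    refine (le_abs_self _).trans (h1.trans ?_)
    calc _ ≤ ((k.descFactorial c * k ^ c : ℕ) : ℝ) * (2 ^ c * ((n : ℝ) ^ c)⁻¹) * (V + V) := by
          gcongr
      _ = _ := by ring
  · refine le_trans (le_of_eq ?_) (hcov n hn)
    rw [hZ, hT]
    congr 1
    exact integral_comp_measurePreserving (hs n)
      (g := fun x => varStat r n x * inner ℝ (uStat k n q x) d)
      ((memLp_varStat hr n 0).1.mul ((memLp_uStat n (hq 0)).1.inner aestronglyMeasurable_const))
  · filter_upwards [eventually_ge_atTop (2 * (k * k) + c + k + 1)] with n hn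
    rw [hΔeq]
    refine le_trans ?_ (integral_norm_sq_uStat_ge hck.le (by omega) hqs hq2)
    have := mul_le_mul_of_nonneg_right (inv_descFactorial_sub_ge (c := c) (n := n) k (by omega))
      hζ0.le
    refine le_trans (le_of_eq ?_) this
    ring

end Assembly

end Shrinkage

theorem theorem4
    {𝒳 : Type*} [MeasurableSpace 𝒳] (P : Measure 𝒳) [IsProbabilityMeasure P]
    {H : Type*} [NormedAddCommGroup H] [InnerProductSpace ℝ H] [CompleteSpace H]
    [TopologicalSpace.SeparableSpace H]
    {Ω : Type*} [MeasurableSpace Ω] (μ : Measure Ω) [IsProbabilityMeasure μ]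
    -- an i.i.d. sequence with law `P`
    (X : ℕ → Ω → 𝒳) (hXm : ∀ i, Measurable (X i)) (hXlaw : ∀ i, μ.map (X i) = P)
    (hXind : iIndepFun X μ)
    -- the kernel and the shrinkage target
    (k : ℕ) (hk : 2 ≤ k) (r : (Fin k → 𝒳) → H) (hr : IsSymmetric r)
    (hr2 : MemLp r 2 (Measure.pi fun _ : Fin k => P))
    (f : H) (hf : target P r ≠ f)
    -- the moment conditions
    (σ σ₁ σ₂ θ θ₁ θ₂ : ℝ) (hσ : 0 < σ) (hσ₁ : 0 < σ₁) (hσ₂ : 0 < σ₂)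
    (hθ : 0 < θ) (hθ₁ : 0 < θ₁) (hθ₂ : 0 < θ₂)
    (hB : BernsteinMoments (Measure.pi fun _ : Fin k => P)
      (fun x => r x - target P r) σ θ)
    (hB₁ : BernsteinMoments (Measure.pi fun _ : Fin k => P)
      (fun x => kappaK r x - ∫ y, kappaK r y ∂(Measure.pi fun _ : Fin k => P)) σ₁ θ₁)
    (hB₂ : BernsteinMoments (Measure.pi fun _ : Fin (k + k) => P)
      (fun x => kappa2K r x - ∫ y, kappa2K r y ∂(Measure.pi fun _ : Fin (k + k) => P)) σ₂ θ₂) :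
    -- (i)
    IsBigOP μ (fun n ω => alphaDegen r f n (sample X n ω) - alphaStar P μ X r f n)
      (fun n => (n : ℝ)⁻¹) ∧
    -- (ii)
    IsBigOP μ
      (fun n ω =>
        ‖shrink r f n (alphaDegen r f n (sample X n ω)) (sample X n ω) - target P r‖
          - ‖shrink r f n (alphaStar P μ X r f n) (sample X n ω) - target P r‖)
      (fun n => (n : ℝ)⁻¹) ∧
    -- (iii)
    IsBigOP μ
      (fun n ω =>
        ‖shrink r f n (alphaDegen r f n (sample X n ω)) (sample X n ω) - target P r‖)
      (fun n => (n : ℝ) ^ (-(1 / 2) : ℝ)) ∧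
    -- (iv): the risks are finite, the oracle minimum is attained, the excess risk is `O(n^{-3/2})`
    (∀ n ≥ 2 * k,
      Integrable (fun ω =>
        ‖shrink r f n (alphaDegen r f n (sample X n ω)) (sample X n ω) - target P r‖ ^ 2) μ ∧
      (∀ α : ℝ, Integrable (fun ω =>
        ‖shrink r f n α (sample X n ω) - target P r‖ ^ 2) μ) ∧
      IsLeast (Set.range fun α : ℝ => risk P μ X r f n (fun _ => α)) (oracleRisk P μ X r f n)) ∧
    (∃ K : ℝ, ∀ n ≥ 2 * k,
      |risk P μ X r f n (alphaDegen r f n) - oracleRisk P μ X r f n|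
        ≤ K * (n : ℝ) ^ (-(3 / 2) : ℝ)) ∧
    -- (iv), lower bound: exact for large `n` whenever `r - C` is not completely degenerate
    (¬ IsCompletelyDegenerate P (fun x => r x - target P r) →
      ∀ᶠ n : ℕ in atTop,
        oracleRisk P μ X r f n ≤ risk P μ X r f n (alphaDegen r f n)) := by
  have hs := measurePreserving_sample hXm hXlaw hXind
  have hk0 : 0 < k := by omega
  set C := target P r with hC
  set q : (Fin k → 𝒳) → H := fun x => r x - C with hq_def
  set d : H := f - C with hd_def
  have hd : d ≠ 0 := sub_ne_zero.2 (Ne.symm hf)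
  have hD : 0 < ‖d‖ := norm_pos_iff.2 hd
  have hqs : IsSymmetric q := fun s x => by simp only [hq_def, hr s x]
  have hqm : AEStronglyMeasurable q (Measure.pi fun _ => P) := hr2.1.sub aestronglyMeasurable_const
  have hq := memLp_of_integrable_norm_pow hqm fun p hp => (hB p hp).1
  have hrp : ∀ p : ℕ, MemLp r p (Measure.pi fun _ => P) := fun p => by
    have h1 := (hq p).add (memLp_const C)
    have h2 : q + (fun _ => C) = r := by ext x; simp [hq_def]
    rwa [h2] at h1
  have hq0 : ∫ x, q x ∂(Measure.pi fun _ => P) = 0 := by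
    rw [integral_sub (hr2.integrable one_le_two) (integrable_const _)]
    simp [hC, target]
  set Z : ℕ → Ω → H := fun n ω => uStat k n q (sample X n ω) with hZ
  set T : ℕ → Ω → ℝ := fun n ω => varStat r n (sample X n ω) with hT
  set β : ℕ → ℝ := fun n => (n.choose k : ℝ)⁻¹ with hβ
  have hM : MomentBounds μ (k + k) k Z T β := momentBounds_uStat hs hk0 hrp hq hq0
  -- For n < k the U-statistic is an empty average with value 0, so centring the kernel does not
  -- centre it.
  have hZr : ∀ n ≥ k + k, ∀ ω, Z n ω = uStat k n r (sample X n ω) - C := fun n hn ω =>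
    uStat_const_sub (by omega) r C _
  have hα : ∀ n ≥ k + k, ∀ ω, alphaDegen r f n (sample X n ω) = randCoeff Z T β d n ω := by
    intro n hn ω
    have h1 : uStat k n r (sample X n ω) - f = Z n ω - d := by
      rw [hZr n hn ω, hd_def]
      abel
    unfold alphaDegen
    rw [h1]
    rfl
  have hsh : ∀ n ≥ k + k, ∀ ω (α : ℝ), shrink r f n α (sample X n ω) - C
      = (1 - α) • Z n ω + α • d := by
    intro n hn ω α
    rw [hZr n hn ω, hd_def]
    unfold shrink
    module
  have hshD : ∀ n ≥ k + k, ∀ ω, shrink r f n (alphaDegen r f n (sample X n ω)) (sample X n ω) - C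
      = shrunkError Z T β d n ω := by
    intro n hn ω
    rw [hsh n hn, hα n hn]
    rfl
  have hΔ : ∀ n ≥ k + k, delta P μ X r n = ∫ ω, ‖Z n ω‖ ^ 2 ∂μ := fun n hn => by
    unfold delta
    simp_rw [hZr n hn]
    rfl
  have hstar : ∀ n ≥ k + k, alphaStar P μ X r f n
      = (∫ ω, ‖Z n ω‖ ^ 2 ∂μ) / (∫ ω, ‖Z n ω‖ ^ 2 ∂μ + ‖d‖ ^ 2) := fun n hn => by
    unfold alphaStar
    rw [hΔ n hn, norm_sub_rev]
  have hΔ0 : ∀ n, 0 ≤ ∫ ω, ‖Z n ω‖ ^ 2 ∂μ := fun n => integral_nonneg fun _ => by positivity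
  have hZ0 : ∀ n ≥ k + k, ∫ ω, Z n ω ∂μ = 0 := fun n hn => by
    rw [hZ]
    dsimp only
    rw [integral_comp_measurePreserving (hs n) (memLp_uStat n (hq 0)).1,
      integral_uStat (by omega) (memLp_one_iff_integrable.1 (by simpa using hq 1)), hq0]
  have hconst : ∀ n ≥ k + k, ∀ α : ℝ, Integrable (fun ω =>
      ‖shrink r f n α (sample X n ω) - C‖ ^ 2) μ ∧ risk P μ X r f n (fun _ => α)
        = (1 - α) ^ 2 * ∫ ω, ‖Z n ω‖ ^ 2 ∂μ + α ^ 2 * ‖d‖ ^ 2 := by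
    intro n hn α
    unfold risk
    rw [← hC]
    simp_rw [hsh n hn]
    exact integral_norm_sq_convex_comb (by exact_mod_cast hM.memLp_error n 2) (hZ0 n hn) d α
  have hleast : ∀ n ≥ k + k, IsLeast (Set.range fun α : ℝ => risk P μ X r f n (fun _ => α))
      (∫ ω, ‖Z n ω‖ ^ 2 ∂μ - (∫ ω, ‖Z n ω‖ ^ 2 ∂μ) ^ 2 / (∫ ω, ‖Z n ω‖ ^ 2 ∂μ + ‖d‖ ^ 2)) := by
    intro n hn
    simp_rw [fun α => (hconst n hn α).2]
    exact isLeast_range_quadratic (hΔ0 n) hD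
  have horacle : ∀ n ≥ k + k, oracleRisk P μ X r f n
      = ∫ ω, ‖Z n ω‖ ^ 2 ∂μ - (∫ ω, ‖Z n ω‖ ^ 2 ∂μ) ^ 2 / (∫ ω, ‖Z n ω‖ ^ 2 ∂μ + ‖d‖ ^ 2) :=
    fun n hn => (hleast n hn).csInf_eq
  have hrisk : ∀ n ≥ k + k, risk P μ X r f n (alphaDegen r f n)
      = ∫ ω, ‖shrunkError Z T β d n ω‖ ^ 2 ∂μ := by
    intro n hn
    unfold risk
    rw [← hC]
    simp_rw [hshD n hn]
  refine ⟨?_, ?_, ?_, ?_, ?_, ?_⟩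
  · refine (hM.isBigOP_randCoeff_sub hk hd).congr (n₀ := k + k) fun n hn ω => ?_
    rw [hα n hn, hstar n hn]
  · refine (hM.isBigOP_norm_shrunkError_sub hk hd _ rfl).congr (n₀ := k + k) fun n hn ω => ?_
    rw [hshD n hn, hsh n hn, hstar n hn]
  · refine (hM.isBigOP_norm_shrunkError hk hd).congr (n₀ := k + k) fun n hn ω => ?_
    rw [hshD n hn]
  · intro n hn
    rw [two_mul] at hn
    refine ⟨?_, fun α => (hconst n hn α).1, ?_⟩
    · simp_rw [hshD n hn]
      exact hM.integrable_norm_sq_shrunkError d hn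
    · rw [horacle n hn]
      exact hleast n hn
  · obtain ⟨K, hK, hrate⟩ := hM.exists_abs_integral_sub_le hk hd
    obtain ⟨L, hL, hvar⟩ := hM.exists_integral_norm_sq_le
    -- K bounds the risk change from estimated shrinkage and L²/‖d‖² the oracle gain, both at rate
    -- n^{-2}.
    refine ⟨K + (‖d‖ ^ 2)⁻¹ * L ^ 2, fun n hn => ?_⟩
    rw [two_mul] at hn
    have hn1 := hM.one_le_cast hn
    have hpow : ((n : ℝ) ^ 2)⁻¹ ≤ (n : ℝ) ^ (-(3 / 2) : ℝ) := by
      rw [← Real.rpow_natCast, ← Real.rpow_neg n.cast_nonneg]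
      exact Real.rpow_le_rpow_of_exponent_le hn1 (by norm_num)
    rw [hrisk n hn, horacle n hn]
    have h1 := hrate n hn
    have h2 := hvar n hn
    have h3 := hΔ0 n
    set Δ := ∫ ω, ‖Z n ω‖ ^ 2 ∂μ
    set R := ∫ ω, ‖shrunkError Z T β d n ω‖ ^ 2 ∂μ
    have h4 : Δ ^ 2 / (Δ + ‖d‖ ^ 2) ≤ (‖d‖ ^ 2)⁻¹ * L ^ 2 * ((n : ℝ) ^ 2)⁻¹ := by
      calc Δ ^ 2 / (Δ + ‖d‖ ^ 2) ≤ (L * (n : ℝ)⁻¹) ^ 2 / ‖d‖ ^ 2 := by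
            gcongr
            linarith
        _ = _ := by ring
    have h5 : 0 ≤ Δ ^ 2 / (Δ + ‖d‖ ^ 2) := by positivity
    calc |R - (Δ - Δ ^ 2 / (Δ + ‖d‖ ^ 2))| = |(R - Δ) + Δ ^ 2 / (Δ + ‖d‖ ^ 2)| := by
          congr 1
          ring
      _ ≤ |R - Δ| + Δ ^ 2 / (Δ + ‖d‖ ^ 2) := by
          refine (abs_add_le _ _).trans (le_of_eq ?_)
          rw [abs_of_nonneg h5]
      _ ≤ K * ((n : ℝ) ^ 2)⁻¹ + (‖d‖ ^ 2)⁻¹ * L ^ 2 * ((n : ℝ) ^ 2)⁻¹ := add_le_add h1 h4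
      _ = (K + (‖d‖ ^ 2)⁻¹ * L ^ 2) * ((n : ℝ) ^ 2)⁻¹ := by ring
      _ ≤ _ := by gcongr
  · intro hdeg
    -- If all canonical functions of order below k vanish, the failure of complete degeneracy means
    -- that r - C is almost everywhere constant, hence 0.
    by_cases hall : ∀ i < k, ∀ᵐ x ∂(Measure.pi fun _ : Fin i => P), canonical P q i x = 0
    · have hcst : ∃ c : H, ∀ᵐ x ∂(Measure.pi fun _ : Fin k => P), q x = c := by
        by_contra hcon
        exact hdeg ⟨hall, hcon⟩
      obtain ⟨c, hc⟩ := hcst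
      have hc0 : c = 0 := by
        rw [← hq0, integral_congr_ae hc]
        simp
      have hV : ∫ y, ‖q y‖ ^ 2 ∂(Measure.pi fun _ => P) = 0 := by
        refine integral_eq_zero_of_ae ?_
        filter_upwards [hc] with x hx
        simp [hx, hc0]
      filter_upwards [eventually_ge_atTop (k + k)] with n hn
      have hZn : ∫ ω, ‖Z n ω‖ ^ 2 ∂μ = 0 := by
        have hq2 : MemLp q 2 (Measure.pi fun _ => P) := hq 2
        -- With c = 0 the degeneracy hypothesis is vacuous, and the risk is bounded by a multiple of
        -- E‖q‖² = 0.
        have h1 := abs_integral_inner_uStat_le (n := n) (c := 0) (by omega) (by omega) hqs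
          hq2 hq2 (fun l hl => absurd hl (by omega))
        simp_rw [real_inner_self_eq_norm_sq] at h1
        rw [hV, add_zero, mul_zero] at h1
        refine Eq.trans ?_ (abs_nonpos_iff.1 h1)
        exact integral_comp_measurePreserving (hs n) (g := fun x => ‖uStat k n q x‖ ^ 2)
          ((memLp_uStat n (hq 0)).1.norm.pow _)
      rw [horacle n hn, hrisk n hn, hZn]
      simpa using integral_nonneg fun ω => sq_nonneg ‖shrunkError Z T β d n ω‖
    · classical
      have hex : ∃ i, i < k ∧ ¬ ∀ᵐ x ∂(Measure.pi fun _ : Fin i => P), canonical P q i x = 0 := by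
        simpa only [not_forall, exists_prop] using hall
      obtain ⟨hck, hc'⟩ := Nat.find_spec hex
      have hc : ∀ l < Nat.find hex, ∀ᵐ x ∂(Measure.pi fun _ : Fin l => P),
          canonical P q l x = 0 := by
        intro l hl
        by_contra hcon
        exact Nat.find_min hex hl ⟨hl.trans hck, hcon⟩
      filter_upwards [eventually_ge_atTop (k + k),
        eventually_nonneg_excess_uStat hs hk0 hrp hqs hq hq0 hd hck hc hc' hZ hT hβ] with n hn hexc
      rw [horacle n hn, hrisk n hn]
      linarith
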